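/- Let $(M^4,J)$ be a compact connected complex surface. Let $\mathfrak t$ be an abelian $2$-dimensional real Lie algebra of smooth vector fields on $M$ such that every $V\in\mathfrak t$ satisfies $\mathcal L_VJ=0$, $J\mathfrak t=\mathfrak t$, and the evaluation map $\mathfrak t\to T_xM$ is injective for every $x\in M$. Fix a basis $(V_1,V_2)$ of $\mathfrak t$ with $V_2=JV_1$. Let $g$ be a smooth Hermitian metric on $(M,J)$ that is $\mathfrak t$-invariant (i.e. $\mathcal L_Vg=0$ for all $V\in\mathfrak t$), with fundamental form $\omega=g(J\cdot,\cdot)$. Let $\mathcal H$ be the $g$-orthogonal complement of the vertical distribution $\mathcal V$, $\mathcal V_x=\{V_x : V\in\mathfrak t\}$, let $\mu_1,\mu_2$ be the $1$-forms with $\mu_i(V_j)=\delta_{ij}$ and $\mu_i|_{\mathcal H}=0$, let $\lambda=g(JV_1,V_2)$, and let $\check\omega$ be the $2$-form that agrees with $\omega$ on $\mathcal H$ and vanishes when one argument is vertical, so that $\omega=\lambda\,\mu_1\wedge\mu_2+\check\omega$. A $k$-form $\alpha$ is called basic if it is smooth and $\mathcal L_V\alpha=0$, $V\lrcorner\alpha=0$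 for all $V\in\mathfrak t$. The basic cohomology $H^k_{\rm d}(M)_{\mathfrak t}$ is the space of closed basic $k$-forms modulo exterior derivatives of basic $(k-1)$-forms. The metric $g$ is called pluriclosed if ${\rm d}J{\rm d}\omega=0$. The Lee form of $g$ is the unique $1$-form $\theta$ with ${\rm d}\omega=\theta\wedge\omega$. Then there are unique functions $\sigma_1,\sigma_2:M\to\mathbb R$ with ${\rm d}\mu_1=\sigma_1\check\omega$ and ${\rm d}\mu_2=\sigma_2\check\omega$; they are smooth and $\mathfrak t$-invariant. The form $\check\omega$ is basic and closed, and the following hold. i) $g$ is pluriclosed if and only if $\lambda$ is constant. ii) If $g$ is pluriclosed, then its Lee form is $\theta=\lambda(\sigma_1\mu_2-\sigma_2\mu_1)$. iii) If $g$ is pluriclosed, then ${\rm d}\theta=0$ if and only if $\sigma_1$ and $\sigma_2$ are both constant. iv) If $g$ is pluriclosed, then the class of $\check\omega$ in $H^2_{\rm d}(M)_{\mathfrak t}$ is non-zero. -/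

import Mathlib

open scoped Manifold ContDiff Topology
open VectorField

namespace TSurface

section

variable {E : Type*} [NormedAddCommGroup E] [NormedSpace ℂ E]
variable {M : Type*} [TopologicalSpace M] [ChartedSpace E M]

/-- A complex manifold (holomorphic transition functions) is a smooth manifold over the reals
with the same charts. -/
instance isManifold_real [IsManifold 𝓘(ℂ, E) ω M] : IsManifold 𝓘(ℝ, E) ∞ M := by
  refine isManifold_of_contDiffOn _ _ _ fun e e' he he' => ?_
  have h := (contDiffGroupoid ω 𝓘(ℂ, E)).compatible he he'
  have h2 : e.symm ≫ₕ e' ∈ contDiffGroupoid ∞ 𝓘(ℂ, E) := (contDiffGroupoid_le (I := 𝓘(ℂ, E)) (n := ω) (m := ∞) le_top) h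
  rw [contDiffGroupoid, mem_groupoid_of_pregroupoid] at h2
  exact ContDiffOn.restrict_scalars (𝕜' := ℂ) ℝ h2.1

variable (E M)

/-- (Not necessarily continuous) real vector fields. -/
abbrev VField := Π x : M, TangentSpace 𝓘(ℝ, E) x

/-- (Not necessarily continuous) real differential `k`-forms. -/
abbrev DForm (k : ℕ) := Π x : M, TangentSpace 𝓘(ℝ, E) x [⋀^Fin k]→L[ℝ] ℝ

variable {E M}

/-- The complex structure `J`: multiplication by `i` on each tangent space.  (In Mathlib the tangent
space at `x` is the model space `E`, via the preferred chart at `x`; as the transition functions are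
holomorphic, multiplication by `i` does not depend on the chart.) -/
noncomputable def J (x : M) : TangentSpace 𝓘(ℝ, E) x →L[ℝ] TangentSpace 𝓘(ℝ, E) x :=
  ((Complex.I • ContinuousLinearMap.id ℂ E : E →L[ℂ] E).restrictScalars ℝ : E →L[ℝ] E)

lemma J_J (x : M) (v : TangentSpace 𝓘(ℝ, E) x) : J x (J x v) = -v := by
  change (Complex.I • (Complex.I • (show E from v)) : E) = -(show E from v)
  rw [smul_smul, Complex.I_mul_I, neg_one_smul]

/-- The vector field `J V`. -/
noncomputable def JField (V : VField E M) : VField E M := fun x => J x (V x)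

/-! ### Differential forms -/

/-- The form `α` read in the preferred chart at `x₀`, i.e. its pull-back by the inverse of the
chart (meaningful on the target of the chart). -/
noncomputable def chartRep {k : ℕ} (x₀ : M) (α : DForm E M k) (y : E) : E [⋀^Fin k]→L[ℝ] ℝ :=
  (α ((extChartAt 𝓘(ℝ, E) x₀).symm y)).compContinuousLinearMap
    (mfderiv 𝓘(ℝ, E) 𝓘(ℝ, E) (extChartAt 𝓘(ℝ, E) x₀).symm y)

/-- `α` is a smooth differential form. -/
def SmoothForm {k : ℕ} (α : DForm E M k) : Prop :=
  ∀ x₀ : M, ContDiffOn ℝ ∞ (chartRep x₀ α) (extChartAt 𝓘(ℝ, E) x₀).target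

/-- The exterior derivative of a differential form: computed in the preferred chart at `x` and
pulled back to the tangent space at `x`. -/
noncomputable def extD {k : ℕ} (α : DForm E M k) : DForm E M (k + 1) := fun x =>
  (extDeriv (chartRep x α) (extChartAt 𝓘(ℝ, E) x x)).compContinuousLinearMap
    (mfderiv 𝓘(ℝ, E) 𝓘(ℝ, E) (extChartAt 𝓘(ℝ, E) x) x)

/-- The action of `J` on `k`-forms, `(Jα)(v₁, …, vₖ) = α(J⁻¹v₁, …, J⁻¹vₖ)`, where `J⁻¹ = -J`. -/
noncomputable def JForm {k : ℕ} (α : DForm E M k) : DForm E M k := fun x =>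
  (α x).compContinuousLinearMap (-(J x))

/-- The wedge product of a `1`-form and a `k`-form,
`(θ ∧ α)(v₀, …, vₖ) = ∑ᵢ (-1)ⁱ θ(vᵢ) α(v₀, …, v̂ᵢ, …, vₖ)`. -/
noncomputable def wedge {k : ℕ} (θ : DForm E M 1) (α : DForm E M k) : DForm E M (k + 1) := fun x =>
  ContinuousAlternatingMap.alternatizeUncurryFin (𝕜 := ℝ) (E := E) (F := ℝ)
    (((ContinuousAlternatingMap.ofSubsingleton ℝ E ℝ (0 : Fin 1)).symm (θ x)).smulRight
      (α x : E [⋀^Fin k]→L[ℝ] ℝ))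

/-! ### Vector fields and invariance -/

/-- The vector field `V` is smooth. -/
def SmoothField [IsManifold 𝓘(ℂ, E) ω M] (V : VField E M) : Prop :=
  ContMDiff 𝓘(ℝ, E) (𝓘(ℝ, E).prod 𝓘(ℝ, E)) ∞
    (fun x => (⟨x, V x⟩ : TangentBundle 𝓘(ℝ, E) M))

/-- The derivative `V f` of the real function `f` along the vector field `V`. -/
noncomputable def fieldDeriv (V : VField E M) (f : M → ℝ) (x : M) : ℝ :=
  (mfderiv 𝓘(ℝ, E) 𝓘(ℝ, ℝ) f x : TangentSpace 𝓘(ℝ, E) x →L[ℝ] ℝ) (V x)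

lemma fieldDeriv_add (V : VField E M) {f h : M → ℝ} {x : M}
    (hf : MDifferentiableAt 𝓘(ℝ, E) 𝓘(ℝ, ℝ) f x) (hh : MDifferentiableAt 𝓘(ℝ, E) 𝓘(ℝ, ℝ) h x) :
    fieldDeriv V (f + h) x = fieldDeriv V f x + fieldDeriv V h x :=
  congrArg (fun L : TangentSpace 𝓘(ℝ, E) x →L[ℝ] ℝ => L (V x))
    (hf.hasMFDerivAt.add hh.hasMFDerivAt).mfderiv

lemma fieldDeriv_smul (V : VField E M) (c : ℝ) {f : M → ℝ} {x : M}
    (hf : MDifferentiableAt 𝓘(ℝ, E) 𝓘(ℝ, ℝ) f x) :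
    fieldDeriv V (c • f) x = c * fieldDeriv V f x :=
  congrArg (fun L : TangentSpace 𝓘(ℝ, E) x →L[ℝ] ℝ => L (V x))
    (hf.hasMFDerivAt.const_smul c).mfderiv

lemma fieldDeriv_zero (V : VField E M) (x : M) : fieldDeriv V (fun _ : M => (0 : ℝ)) x = 0 := by
  rw [fieldDeriv, mfderiv_const]; rfl

/-- The covariant `k`-tensor field `T` satisfies `ℒ_V T = 0`:
`V (T(X₁, …, Xₖ)) = ∑ᵢ T(X₁, …, [V, Xᵢ], …, Xₖ)` for all smooth vector fields `X₁, …, Xₖ`.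
For `k = 0` this says that the function `T` is constant along `V`. -/
def LieInvariant [IsManifold 𝓘(ℂ, E) ω M] {k : ℕ} (V : VField E M)
    (T : Π x : M, (Fin k → TangentSpace 𝓘(ℝ, E) x) → ℝ) : Prop :=
  ∀ X : Fin k → VField E M, (∀ i, SmoothField (X i)) → ∀ x : M,
    fieldDeriv V (fun p => T p (fun i => X i p)) x =
      ∑ i, T x (Function.update (fun j => X j x) i (mlieBracket 𝓘(ℝ, E) V (X i) x))

/-- `𝔱` is an abelian Lie algebra of smooth vector fields that preserves `J`, is free (the
evaluation map is injective at every point) and is `J`-invariant. -/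
structure IsFreeAbelianHolomorphic [IsManifold 𝓘(ℂ, E) ω M]
    (𝔱 : Submodule ℝ (VField E M)) : Prop where
  smooth : ∀ V ∈ 𝔱, SmoothField V
  abelian : ∀ V ∈ 𝔱, ∀ W ∈ 𝔱, mlieBracket 𝓘(ℝ, E) V W = 0
  /-- `ℒ_V J = 0`. -/
  preserves_J : ∀ V ∈ 𝔱, ∀ X : VField E M, SmoothField X →
    mlieBracket 𝓘(ℝ, E) V (JField X) = JField (mlieBracket 𝓘(ℝ, E) V X)
  free : ∀ V ∈ 𝔱, ∀ x : M, V x = 0 → V = 0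
  J_mem : ∀ V ∈ 𝔱, JField V ∈ 𝔱

/-! ### Basic cohomology -/

/-- In the chart at `x₀`, `α(X₁, …, Xₖ)` is the chart representation of `α` applied to those of
the `Xᵢ`. -/
lemma apply_eq_chartRep [IsManifold 𝓘(ℂ, E) ω M] {k : ℕ} (α : DForm E M k) (x₀ : M) {p : M}
    (hp : p ∈ (chartAt E x₀).source) (v : Fin k → TangentSpace 𝓘(ℝ, E) p) :
    α p v = chartRep x₀ α (extChartAt 𝓘(ℝ, E) x₀ p)
      (fun i => mfderiv 𝓘(ℝ, E) 𝓘(ℝ, E) (extChartAt 𝓘(ℝ, E) x₀) p (v i)) := by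
  have hp' : p ∈ (extChartAt 𝓘(ℝ, E) x₀).source := by rwa [extChartAt_source]
  have h := mfderivWithin_extChartAt_symm_comp_mfderiv_extChartAt' (I := 𝓘(ℝ, E)) hp'
  rw [modelWithCornersSelf_coe, Set.range_id, mfderivWithin_univ] at h
  have hv : ∀ w : TangentSpace 𝓘(ℝ, E) p,
      (mfderiv 𝓘(ℝ, E) 𝓘(ℝ, E) (extChartAt 𝓘(ℝ, E) x₀).symm (extChartAt 𝓘(ℝ, E) x₀ p) : E → E)
        (mfderiv 𝓘(ℝ, E) 𝓘(ℝ, E) (extChartAt 𝓘(ℝ, E) x₀) p w) = w := fun w =>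
    congrArg (fun L => L w) h
  have key : ∀ q : M, q = p → ∀ w : Fin k → E, (w = v) → (α p : (Fin k → E) → ℝ) v =
      (α q : (Fin k → E) → ℝ) w := by
    rintro q rfl w rfl; rfl
  exact key _ ((extChartAt 𝓘(ℝ, E) x₀).left_inv hp') _ (funext fun i => hv (v i))

/-- A smooth form evaluated on smooth vector fields is differentiable. -/
lemma SmoothForm.mdifferentiableAt_apply [IsManifold 𝓘(ℂ, E) ω M] {k : ℕ} {α : DForm E M k}
    (hα : SmoothForm α) {X : Fin k → VField E M} (hX : ∀ i, SmoothField (X i)) (x : M) :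
    MDifferentiableAt 𝓘(ℝ, E) 𝓘(ℝ, ℝ) (fun p => α p (fun i => X i p)) x := by
  have hY : ∀ i, ContMDiffAt 𝓘(ℝ, E) 𝓘(ℝ, E) ∞ (fun p : M =>
      (mfderiv 𝓘(ℝ, E) 𝓘(ℝ, E) (extChartAt 𝓘(ℝ, E) x) p (X i p) : E)) x := fun i => by
    have h := (Bundle.contMDiffAt_section x).1 (hX i x)
    refine h.congr_of_eventuallyEq ?_
    filter_upwards [(chartAt E x).open_source.mem_nhds (mem_chart_source E x)] with p hp
    rw [← TangentBundle.continuousLinearMapAt_trivializationAt hp]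
    exact Bundle.Trivialization.continuousLinearMapAt_apply_of_mem (R := ℝ)
      (trivializationAt E (TangentSpace 𝓘(ℝ, E)) x) hp (X i p)
  have hα' : MDifferentiableAt 𝓘(ℝ, E) 𝓘(ℝ, E [⋀^Fin k]→L[ℝ] ℝ)
      (fun p => chartRep x α (extChartAt 𝓘(ℝ, E) x p)) x :=
    (((hα x).contDiffAt (extChartAt_target_mem_nhds x)).differentiableAt
      (by simp)).mdifferentiableAt.comp x
        (mdifferentiableAt_extChartAt (mem_chart_source E x))
  have hev : Differentiable ℝ (fun q : (E [⋀^Fin k]→L[ℝ] ℝ) × (Fin k → E) => q.1 q.2) :=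
    differentiable_fst.continuousAlternatingMap_apply
      (fun i => differentiable_pi.1 differentiable_snd i)
  have h := (hev (chartRep x α (extChartAt 𝓘(ℝ, E) x x), fun i =>
    (mfderiv 𝓘(ℝ, E) 𝓘(ℝ, E) (extChartAt 𝓘(ℝ, E) x) x (X i x) : E))).mdifferentiableAt.comp x
      (hα'.prodMk_space ((contMDiffAt_pi_space.2 hY).mdifferentiableAt (by simp)))
  refine h.congr_of_eventuallyEq ?_
  filter_upwards [(chartAt E x).open_source.mem_nhds (mem_chart_source E x)] with p hp
  exact apply_eq_chartRep α x hp _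

lemma chartRep_add {k : ℕ} (x₀ : M) (α β : DForm E M k) :
    chartRep x₀ (α + β) = chartRep x₀ α + chartRep x₀ β := rfl

lemma chartRep_smul {k : ℕ} (x₀ : M) (c : ℝ) (α : DForm E M k) :
    chartRep x₀ (c • α) = c • chartRep x₀ α := rfl

lemma SmoothForm.differentiableAt {k : ℕ} {α : DForm E M k} (hα : SmoothForm α) (x : M) :
    DifferentiableAt ℝ (chartRep x α) (extChartAt 𝓘(ℝ, E) x x) :=
  ((hα x).contDiffAt (extChartAt_target_mem_nhds x)).differentiableAt (by simp)

lemma extD_add {k : ℕ} {α β : DForm E M k} (hα : SmoothForm α) (hβ : SmoothForm β) :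
    extD (α + β) = extD α + extD β := by
  funext x
  ext v
  simp only [extD, chartRep_add]
  rw [extDeriv_add (hα.differentiableAt x) (hβ.differentiableAt x)]
  rfl

lemma extD_smul {k : ℕ} (c : ℝ) (α : DForm E M k) : extD (c • α) = c • extD α := by
  funext x
  ext v
  simp only [extD, chartRep_smul]
  rw [extDeriv_smul]
  rfl

/-- Basic `k`-forms: smooth, `𝔱`-invariant and horizontal (`V ⌟ α = 0` for all `V ∈ 𝔱`). -/
def basicForms [IsManifold 𝓘(ℂ, E) ω M] (𝔱 : Submodule ℝ (VField E M)) (k : ℕ) :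
    Submodule ℝ (DForm E M k) where
  carrier := {α | SmoothForm α ∧ ∀ V ∈ 𝔱, LieInvariant V (fun x v => α x v) ∧
    ∀ (x : M) (v : Fin k → TangentSpace 𝓘(ℝ, E) x), (∃ i, v i = V x) → α x v = 0}
  add_mem' := by
    rintro α β ⟨hα, hα'⟩ ⟨hβ, hβ'⟩
    refine ⟨fun x₀ => ?_, fun V hV => ⟨fun X hX x => ?_, fun x v hv => ?_⟩⟩
    · rw [chartRep_add]; exact (hα x₀).add (hβ x₀)
    · have h1 := (hα' V hV).1 X hX x
      have h2 := (hβ' V hV).1 X hX x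
      calc _ = _ := fieldDeriv_add V (hα.mdifferentiableAt_apply hX x)
            (hβ.mdifferentiableAt_apply hX x)
        _ = _ := congrArg₂ (· + ·) h1 h2
        _ = _ := Finset.sum_add_distrib.symm
    · have h1 := (hα' V hV).2 x v hv
      have h2 := (hβ' V hV).2 x v hv
      simp [h1, h2]
  zero_mem' := by
    refine ⟨fun x₀ => ?_, fun V hV => ⟨fun X hX x => ?_, fun x v hv => rfl⟩⟩
    · exact contDiffOn_const (c := 0)
    · exact (fieldDeriv_zero V x).trans Finset.sum_const_zero.symm
  smul_mem' := by
    rintro c α ⟨hα, hα'⟩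
    refine ⟨fun x₀ => ?_, fun V hV => ⟨fun X hX x => ?_, fun x v hv => ?_⟩⟩
    · rw [chartRep_smul]; exact (hα x₀).const_smul c
    · have h1 := (hα' V hV).1 X hX x
      calc _ = _ := fieldDeriv_smul V c (hα.mdifferentiableAt_apply hX x)
        _ = _ := congrArg (c * ·) h1
        _ = _ := Finset.mul_sum _ _ _
    · have h1 := (hα' V hV).2 x v hv
      simp [h1]

/-- The vector space of basic `k`-forms. -/
def BasicForm [IsManifold 𝓘(ℂ, E) ω M] (𝔱 : Submodule ℝ (VField E M)) (k : ℕ) := basicForms 𝔱 k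

section

variable [IsManifold 𝓘(ℂ, E) ω M] (𝔱 : Submodule ℝ (VField E M)) (k : ℕ)

noncomputable instance : AddCommGroup (BasicForm 𝔱 k) :=
  inferInstanceAs (AddCommGroup (basicForms 𝔱 k))

noncomputable instance : Module ℝ (BasicForm 𝔱 k) :=
  inferInstanceAs (Module ℝ (basicForms 𝔱 k))

/-- The inclusion of basic `k`-forms into `k`-forms. -/
noncomputable def basicIncl : BasicForm 𝔱 k →ₗ[ℝ] DForm E M k := (basicForms 𝔱 k).subtype

/-- The exterior derivative on basic `k`-forms. -/
noncomputable def basicD : BasicForm 𝔱 k →ₗ[ℝ] DForm E M (k + 1) where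
  toFun α := extD (basicIncl 𝔱 k α)
  map_add' α β := by
    rw [map_add]
    exact extD_add α.2.1 β.2.1
  map_smul' c α := by
    rw [map_smul]
    exact extD_smul c _

/-- Closed basic `k`-forms. -/
noncomputable def closedBasic : Submodule ℝ (BasicForm 𝔱 k) := LinearMap.ker (basicD 𝔱 k)

/-- Basic `k`-forms that are exterior derivatives of basic forms. -/
noncomputable def exactBasic : (k : ℕ) → Submodule ℝ (BasicForm 𝔱 k)
  | 0 => ⊥
  | k + 1 => (LinearMap.range (basicD 𝔱 k)).comap (basicIncl 𝔱 (k + 1))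

/-- The basic de Rham cohomology space `Hᵏ(M)_𝔱`. -/
abbrev BasicCohomology := closedBasic 𝔱 k ⧸ (exactBasic 𝔱 k).submoduleOf (closedBasic 𝔱 k)

end

/-! ### Hermitian metrics -/

variable (E M)

/-- A smooth Hermitian metric: a smooth Riemannian metric with `g(Ju, Jv) = g(u, v)`. -/
structure HermitianMetric [IsManifold 𝓘(ℂ, E) ω M] extends
    Bundle.ContMDiffRiemannianMetric 𝓘(ℝ, E) ∞ E (fun x : M => TangentSpace 𝓘(ℝ, E) x) where
  hermitian : ∀ (x : M) (u v : TangentSpace 𝓘(ℝ, E) x), inner x (J x u) (J x v) = inner x u v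

variable {E M}

namespace HermitianMetric

variable [IsManifold 𝓘(ℂ, E) ω M] (g : HermitianMetric E M)

/-- The fundamental `2`-form `ω(u, v) = g(Ju, v)`. -/
noncomputable def fundForm : DForm E M 2 := fun x =>
  { toContinuousMultilinearMap :=
      { toFun := fun v => g.inner x (J x (v 0)) (v 1)
        map_update_add' := by
          intro _ m i u v
          fin_cases i <;> simp
        map_update_smul' := by
          intro _ m i c u
          fin_cases i <;> simp
        cont := by
          let B : E →L[ℝ] E →L[ℝ] ℝ := (g.inner x).comp (J x)
          have hB : Continuous fun v : Fin 2 → E => B (v 0) (v 1) := by fun_prop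
          exact hB }
    map_eq_zero_of_eq' := by
      intro v i j hij hne
      have key : ∀ u : TangentSpace 𝓘(ℝ, E) x, g.inner x (J x u) u = 0 := fun u => by
        have h1 := g.hermitian x (J x u) u
        rw [J_J, map_neg, neg_apply, g.symm x u] at h1
        linarith
      have h01 : v 0 = v 1 := by
        fin_cases i <;> fin_cases j <;> simp_all
      change g.inner x (J x (v 0)) (v 1) = 0
      rw [h01, key] }

/-- `dJdω = 0`. -/
def IsPluriclosed : Prop := extD (JForm (extD g.fundForm)) = 0

/-- `θ` is the Lee form of `g` (in complex dimension two): `dω = θ ∧ ω`. -/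
def IsLeeForm (θ : DForm E M 1) : Prop := extD g.fundForm = wedge θ g.fundForm

/-- `ℒ_V g = 0` for all `V ∈ 𝔱`. -/
def IsInvariant (𝔱 : Submodule ℝ (VField E M)) : Prop :=
  ∀ V ∈ 𝔱, LieInvariant (k := 2) V (fun x v => g.inner x (v 0) (v 1))

/-- For a basis `(V₁, V₂)` of `𝔱` with `V₂ = JV₁`, the component `μᵢ` of the principal connection
induced by `g`, i.e. `μᵢ(Vⱼ) = δᵢⱼ` and `μᵢ` vanishes on the `g`-orthogonal complement of
`V₁, V₂`, as shown by the two lemmas below. Because `V₁` and `V₂` are `g`-orthogonal,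
it is `μᵢ = g(Vᵢ, ·) / g(Vᵢ, Vᵢ)`. -/
noncomputable def conn {𝔱 : Submodule ℝ (VField E M)} (b : Module.Basis (Fin 2) ℝ 𝔱) (i : Fin 2) :
    DForm E M 1 := fun x =>
  ContinuousAlternatingMap.ofSubsingleton ℝ (TangentSpace 𝓘(ℝ, E) x) ℝ (0 : Fin 1)
    ((g.inner x ((b i).1 x) ((b i).1 x))⁻¹ • g.inner x ((b i).1 x))

@[simp]
lemma conn_apply {𝔱 : Submodule ℝ (VField E M)} (b : Module.Basis (Fin 2) ℝ 𝔱) (i : Fin 2) (x : M)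
    (v : Fin 1 → TangentSpace 𝓘(ℝ, E) x) :
    g.conn b i x v =
      (g.inner x ((b i).1 x) ((b i).1 x))⁻¹ * g.inner x ((b i).1 x) (v 0) := rfl

lemma inner_basis_pos {𝔱 : Submodule ℝ (VField E M)} (h𝔱 : IsFreeAbelianHolomorphic 𝔱)
    (b : Module.Basis (Fin 2) ℝ 𝔱) (i : Fin 2) (x : M) :
    0 < g.inner x ((b i).1 x) ((b i).1 x) :=
  g.pos x _ fun h => b.ne_zero i (Subtype.ext (h𝔱.free _ (b i).2 x h))

/-- `μᵢ(Vⱼ) = δᵢⱼ`. -/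
lemma conn_basis {𝔱 : Submodule ℝ (VField E M)} (h𝔱 : IsFreeAbelianHolomorphic 𝔱)
    (b : Module.Basis (Fin 2) ℝ 𝔱) (hb : (b 1).1 = JField (b 0).1) (i j : Fin 2) (x : M) :
    g.conn b i x (fun _ => (b j).1 x) = if i = j then 1 else 0 := by
  have h01 : g.inner x ((b 0).1 x) ((b 1).1 x) = 0 := by
    have h1 := g.hermitian x ((b 0).1 x) (J x ((b 0).1 x))
    rw [J_J, map_neg, g.symm x (J x _)] at h1
    rw [hb]
    change g.inner x ((b 0).1 x) (J x ((b 0).1 x)) = 0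
    linarith
  have h10 : g.inner x ((b 1).1 x) ((b 0).1 x) = 0 := by rw [g.symm, h01]
  have hp := fun i => (g.inner_basis_pos h𝔱 b i x).ne'
  fin_cases i <;> fin_cases j <;> simp [h01, h10, hp]

/-- The common kernel of the `μᵢ` is the horizontal space, i.e. the orthogonal complement of
the vertical space `{V(x) | V ∈ 𝔱}`. -/
lemma conn_eq_zero_iff {𝔱 : Submodule ℝ (VField E M)} (h𝔱 : IsFreeAbelianHolomorphic 𝔱)
    (b : Module.Basis (Fin 2) ℝ 𝔱) (x : M) (u : TangentSpace 𝓘(ℝ, E) x) :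
    (∀ i, g.conn b i x (fun _ => u) = 0) ↔ ∀ V ∈ 𝔱, g.inner x (V x) u = 0 := by
  have hp := fun i => (g.inner_basis_pos h𝔱 b i x).ne'
  constructor
  · intro h V hV
    have hV' := congrArg Subtype.val (b.sum_repr ⟨V, hV⟩)
    have hVx : V x = b.repr ⟨V, hV⟩ 0 • (b 0).1 x + b.repr ⟨V, hV⟩ 1 • (b 1).1 x := by
      rw [Fin.sum_univ_two] at hV'
      exact (congrFun hV' x).symm
    have h' : ∀ i, g.inner x ((b i).1 x) u = 0 := fun i => by
      simpa [hp i] using h i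
    rw [hVx]
    simp [h']
  · intro h i
    simp [h _ (b i).2]

/-- The `g`-orthogonal projection of `TM` onto the horizontal distribution,
`u ↦ u - μ₁(u)V₁ - μ₂(u)V₂`. -/
noncomputable def horProj {𝔱 : Submodule ℝ (VField E M)} (b : Module.Basis (Fin 2) ℝ 𝔱) (x : M) :
    TangentSpace 𝓘(ℝ, E) x →L[ℝ] TangentSpace 𝓘(ℝ, E) x :=
  ContinuousLinearMap.id ℝ _ - ∑ i,
    ((ContinuousAlternatingMap.ofSubsingleton ℝ (TangentSpace 𝓘(ℝ, E) x) ℝ (0 : Fin 1)).symm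
      (g.conn b i x)).smulRight ((b i).1 x)

/-- The transverse form `ω̌ = ǧ(J·,·)`, where `ǧ` is the restriction of `g` to the horizontal
distribution (extended by zero on vertical vectors). -/
noncomputable def transForm {𝔱 : Submodule ℝ (VField E M)} (b : Module.Basis (Fin 2) ℝ 𝔱) :
    DForm E M 2 := fun x =>
  (g.fundForm x).compContinuousLinearMap (g.horProj b x)

/-- The function `λ = g(JV₁, V₂)`. -/
noncomputable def lam {𝔱 : Submodule ℝ (VField E M)} (b : Module.Basis (Fin 2) ℝ 𝔱) (x : M) : ℝ :=
  g.inner x (J x ((b 0).1 x)) ((b 1).1 x)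

end HermitianMetric

end

end TSurface

open TSurface

/-!
The fields `V₁` and `V₂ = JV₁` commute, preserve `ω = g(J·,·)` and are holomorphic, so that Cartan's
formula turns every statement about the vertical directions into algebra: `ι_V dα = -d(ι_V α)` for
an invariant form `α`. In a holomorphic chart the data are a vector field `v` and a `2`-form `Ω` on
an open set of the model space `E` (`HermData`), and all the local facts are proved there:

* `dμᵢ` and `dω̌` are horizontal, and the horizontal space has real dimension two. Hence `dμᵢ` is a
  multiple of `ω̌` (`HermData.exists_dmu_eq`) and `dω̌ = 0` (`HermData.extDeriv_trans`).
* `ι_{JV} ι_V dJdω` is the exterior derivative of `-dλ ∘ J` (`HermData.deta_vert`), and a `4`-form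
  is determined by this contraction. So `dJdω = 0` if and only if `λ` is pluriharmonic, which on a
  compact connected `M` means constant, by the maximum principle
  (`eventually_eq_of_isLocalMax_pluriharmonic`).
* If `λ` is constant, then `ι_V dω = -d(ι_V ω)` is a constant multiple of `dμᵢ = σᵢ ω̌`, which gives
  the Lee form (`HermData.dΩ_eq_wedge`). Its values on the `Vᵢ` are multiples of the `σⱼ`, so its
  closedness forces `dσⱼ = 0` (`HermData.fderiv_sigma_eq_zero`); the converse holds because
  `dμ₁` and `dμ₂` are proportional.
* If `λ` is constant and `ω̌ = dγ` with `γ` basic, then `d(γ ∧ ω)` contracts with `V, JV` to `λ ω̌`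
  (`HermData.contract_d_wedge`), so it is a positive exact `4`-form on the compact `M`. This
  contradicts Stokes' theorem (`sum_integral_extD_eq_zero`, `not_pos_extD`), which is proved with a
  partition of unity; the integral of a `4`-form is independent of the chart because holomorphic
  maps have nonnegative real Jacobian (`setIntegral_chart_eq`).

The translation between `M` and the charts rests on the naturality of the exterior derivative
(`chartRep_extD`), on extending constant vector fields of a chart to `M`
(`exists_smoothField_eq_const`), and on `HermitianMetric.hermData`.
-/

namespace TSurface

/-! ### Contraction, Lie derivative and Cartan's formula on a vector space -/

section
variable {E : Type*} [NormedAddCommGroup E] [NormedSpace ℝ E] {n : ℕ}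

lemma two_le_infty : (2 : WithTop ℕ∞) ≤ ∞ := WithTop.coe_le_coe.2 le_top

/-- Currying in the first variable, as a continuous linear map on alternating forms. -/
noncomputable def curryLeftCLM (E : Type*) [NormedAddCommGroup E] [NormedSpace ℝ E] (n : ℕ) :
    (E [⋀^Fin (n + 1)]→L[ℝ] ℝ) →L[ℝ] E →L[ℝ] E [⋀^Fin n]→L[ℝ] ℝ :=
  (ContinuousAlternatingMap.curryLeftLI (𝕜 := ℝ) (E := E) (F := ℝ) (n := n)).toContinuousLinearMap

/-- The contraction `ι_v α` of a form with a vector field in the first slot. -/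
noncomputable def contract (v : E → E) (α : E → E [⋀^Fin (n + 1)]→L[ℝ] ℝ) :
    E → E [⋀^Fin n]→L[ℝ] ℝ := fun y => (α y).curryLeft (v y)

lemma contract_apply (v : E → E) (α : E → E [⋀^Fin (n + 1)]→L[ℝ] ℝ) (y : E) (w : Fin n → E) :
    contract v α y w = α y (Matrix.vecCons (v y) w) := rfl

/-- The Lie derivative `ℒ_v α`, evaluated on constant vectors `w`. Since `[v, wᵢ] = -v'(wᵢ)`, the
bracket terms come with a plus sign. -/
noncomputable def lieD (v : E → E) (α : E → E [⋀^Fin n]→L[ℝ] ℝ) (y : E) (w : Fin n → E) : ℝ :=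
  fderiv ℝ α y (v y) w + ∑ i, α y (Function.update w i (fderiv ℝ v y (w i)))

/-- The form `α` is invariant under `v` at the point `y`: `ℒ_v α = 0` there. -/
def InvAt (v : E → E) (α : E → E [⋀^Fin n]→L[ℝ] ℝ) (y : E) : Prop := ∀ w, lieD v α y w = 0

lemma fderiv_contract_apply {v : E → E} {α : E → E [⋀^Fin (n + 1)]→L[ℝ] ℝ} {y : E}
    (hα : DifferentiableAt ℝ α y) (hv : DifferentiableAt ℝ v y) (u : E) (w : Fin n → E) :
    fderiv ℝ (contract v α) y u w =
      fderiv ℝ α y u (Matrix.vecCons (v y) w) + α y (Matrix.vecCons (fderiv ℝ v y u) w) := by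
  have h : HasFDerivAt (fun z => (α z).curryLeft)
      ((curryLeftCLM E n).comp (fderiv ℝ α y)) y :=
    HasFDerivAt.comp (g := curryLeftCLM E n) y (ContinuousLinearMap.hasFDerivAt _) hα.hasFDerivAt
  have h' : HasFDerivAt (contract v α) _ y := h.clm_apply hv.hasFDerivAt
  rw [h'.fderiv]
  simp [add_comm, curryLeftCLM]

lemma differentiableAt_contract {v : E → E} {α : E → E [⋀^Fin (n + 1)]→L[ℝ] ℝ} {y : E}
    (hα : DifferentiableAt ℝ α y) (hv : DifferentiableAt ℝ v y) :
    DifferentiableAt ℝ (contract v α) y :=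
  DifferentiableAt.clm_apply (c := fun z => (α z).curryLeft)
    (DifferentiableAt.comp (g := curryLeftCLM E n) y
      (ContinuousLinearMap.differentiableAt _) hα) hv

lemma contDiffAt_contract {v : E → E} {α : E → E [⋀^Fin (n + 1)]→L[ℝ] ℝ} {y : E} {r : WithTop ℕ∞}
    (hα : ContDiffAt ℝ r α y) (hv : ContDiffAt ℝ r v y) :
    ContDiffAt ℝ r (contract v α) y :=
  ContDiffAt.clm_apply (f := fun z => (α z).curryLeft)
    (ContDiffAt.comp (g := curryLeftCLM E n) y
      (ContinuousLinearMap.contDiff _).contDiffAt hα) hv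

lemma extDeriv_apply' (α : E → E [⋀^Fin n]→L[ℝ] ℝ) (y : E) (w : Fin (n + 1) → E) :
    extDeriv α y w =
      ∑ i : Fin (n + 1), (-1 : ℤ) ^ (i : ℕ) • fderiv ℝ α y (w i) (i.removeNth w) := by
  rw [extDeriv, ContinuousAlternatingMap.alternatizeUncurryFin_apply]

/-- Cartan's formula `ℒ_v α = d(ι_v α) + ι_v dα`. -/
theorem cartan_formula {v : E → E} {α : E → E [⋀^Fin (n + 1)]→L[ℝ] ℝ} {y : E}
    (hα : DifferentiableAt ℝ α y) (hv : DifferentiableAt ℝ v y) (w : Fin (n + 1) → E) :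
    extDeriv (contract v α) y w + contract v (extDeriv α) y w = lieD v α y w := by
  rw [contract_apply, extDeriv_apply', extDeriv_apply', Fin.sum_univ_succ (n := n + 1), lieD]
  have h1 : ∀ i : Fin (n + 1), (-1 : ℤ) ^ (i : ℕ) •
      fderiv ℝ (contract v α) y (w i) (i.removeNth w) =
      (-1 : ℤ) ^ (i : ℕ) • fderiv ℝ α y (w i) (Matrix.vecCons (v y) (i.removeNth w)) +
      α y (Function.update w i (fderiv ℝ v y (w i))) := fun i => by
    rw [fderiv_contract_apply hα hv, smul_add, ← ContinuousAlternatingMap.map_insertNth,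
      ← ContinuousAlternatingMap.map_insertNth, Fin.insertNth_removeNth, Fin.insertNth_removeNth]
  have h2 : ∀ i : Fin (n + 1), i.succ.removeNth (Matrix.vecCons (v y) w) =
      Matrix.vecCons (v y) (i.removeNth w) := fun i => by
    funext j
    refine Fin.cases ?_ (fun j => ?_) j <;> simp [Fin.removeNth]
  rw [Finset.sum_congr rfl (fun i _ => h1 i), Finset.sum_add_distrib]
  simp only [Fin.val_succ, h2, Matrix.cons_val_succ, pow_succ, mul_neg, mul_one, neg_smul,
    Finset.sum_neg_distrib]
  simp
  ring

/-- For an invariant form, Cartan's formula reads `ι_v dα = -d(ι_v α)`. -/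
lemma contract_extDeriv_of_invAt {v : E → E} {α : E → E [⋀^Fin (n + 1)]→L[ℝ] ℝ} {y : E}
    (hα : DifferentiableAt ℝ α y) (hv : DifferentiableAt ℝ v y) (h : InvAt v α y) :
    contract v (extDeriv α) y = - extDeriv (contract v α) y := by
  ext w
  have := cartan_formula hα hv w
  rw [h w] at this
  simp only [ContinuousAlternatingMap.neg_apply]
  linarith

lemma contDiffAt_extDeriv {α : E → E [⋀^Fin n]→L[ℝ] ℝ} {y : E} {r s : WithTop ℕ∞}
    (hα : ContDiffAt ℝ s α y) (hrs : r + 1 ≤ s) : ContDiffAt ℝ r (extDeriv α) y :=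
  ContDiffAt.comp (g := ContinuousAlternatingMap.alternatizeUncurryFinCLM (n := n) ℝ E ℝ) y
    (ContinuousLinearMap.contDiff _).contDiffAt (hα.fderiv_right hrs)

lemma InvAt.extDeriv {v : E → E} {α : E → E [⋀^Fin (n + 1)]→L[ℝ] ℝ} {y : E}
    (hα : ContDiffAt ℝ ∞ α y) (hv : ContDiffAt ℝ ∞ v y) (h : ∀ᶠ z in 𝓝 y, InvAt v α z) :
    InvAt v (extDeriv α) y := by
  intro w
  have hd : ContDiffAt ℝ ∞ (_root_.extDeriv α) y := contDiffAt_extDeriv hα (by simp)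
  rw [← cartan_formula (hd.differentiableAt (by simp)) (hv.differentiableAt (by simp)) w]
  have h1 : contract v (_root_.extDeriv α) =ᶠ[𝓝 y]
      (-1 : ℝ) • _root_.extDeriv (contract v α) := by
    filter_upwards [h, (hα.of_le (m := 1) (by simp)).eventually (by simp),
      (hv.of_le (m := 1) (by simp)).eventually (by simp)] with z hz hα' hv'
    simpa using contract_extDeriv_of_invAt (hα'.differentiableAt (by simp))
      (hv'.differentiableAt (by simp)) hz
  rw [h1.extDeriv_eq, extDeriv_smul, contract_apply,
    extDeriv_extDeriv_apply (hα.of_le (m := 2) two_le_infty) (by simp),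
    extDeriv_extDeriv_apply ((contDiffAt_contract hα hv).of_le (m := 2) two_le_infty) (by simp)]
  simp

/-- Contraction with a field that commutes with `u` preserves `u`-invariance. -/
lemma InvAt.contract {u v : E → E} {α : E → E [⋀^Fin (n + 1)]→L[ℝ] ℝ} {y : E}
    (hα : DifferentiableAt ℝ α y) (hv : DifferentiableAt ℝ v y)
    (h : InvAt u α y) (huv : lieBracket ℝ u v y = 0) : InvAt u (contract v α) y := by
  intro w
  have h1 := h (Matrix.vecCons (v y) w)
  rw [lieD, Fin.sum_univ_succ] at h1
  rw [lieD, fderiv_contract_apply hα hv]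
  rw [lieBracket, sub_eq_zero] at huv
  have h2 : Function.update (Matrix.vecCons (v y) w) 0 (fderiv ℝ u y (v y)) =
      Matrix.vecCons (fderiv ℝ u y (v y)) w := by
    simp [Matrix.vecCons]
  have h3 : ∀ i, Function.update (Matrix.vecCons (v y) w) i.succ (fderiv ℝ u y (w i)) =
      Matrix.vecCons (v y) (Function.update w i (fderiv ℝ u y (w i))) := fun i => by
    simp [Matrix.vecCons]
  simp only [Matrix.cons_val_zero, Matrix.cons_val_succ, h2, h3] at h1
  simp only [contract_apply, huv]
  linarith

lemma InvAt.smul {v : E → E} {f : E → ℝ} {α : E → E [⋀^Fin n]→L[ℝ] ℝ} {y : E}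
    (hf : DifferentiableAt ℝ f y) (hα : DifferentiableAt ℝ α y) (hfv : fderiv ℝ f y (v y) = 0)
    (h : InvAt v α y) : InvAt v (fun z => f z • α z) y := by
  intro w
  have := h w
  rw [lieD] at this ⊢
  rw [fderiv_fun_smul hf hα]
  simp only [add_apply, smul_apply, ContinuousLinearMap.smulRight_apply,
    hfv, ContinuousAlternatingMap.smul_apply, ← Finset.smul_sum, ContinuousAlternatingMap.add_apply]
  rw [zero_smul]
  rw [add_zero, ← smul_add, this, smul_zero]

end

section
variable {E : Type*} [NormedAddCommGroup E] [NormedSpace ℝ E] {n : ℕ}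

/-- The wedge product of a `1`-form and an `n`-form on a vector space, with the conventions of
`wedge`. -/
noncomputable def wedgeForm (θ : E [⋀^Fin 1]→L[ℝ] ℝ) (α : E [⋀^Fin n]→L[ℝ] ℝ) :
    E [⋀^Fin (n + 1)]→L[ℝ] ℝ :=
  ContinuousAlternatingMap.alternatizeUncurryFin
    (((ContinuousAlternatingMap.ofSubsingleton ℝ E ℝ (0 : Fin 1)).symm θ).smulRight α)

lemma ofSubsingleton_symm_apply (θ : E [⋀^Fin 1]→L[ℝ] ℝ) (a : E) :
    (ContinuousAlternatingMap.ofSubsingleton ℝ E ℝ (0 : Fin 1)).symm θ a = θ ![a] := by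
  change θ (fun _ => a) = _
  congr 1
  ext i
  simp [Subsingleton.elim i 0]

lemma wedgeForm_apply (θ : E [⋀^Fin 1]→L[ℝ] ℝ) (α : E [⋀^Fin n]→L[ℝ] ℝ) (w : Fin (n + 1) → E) :
    wedgeForm θ α w = ∑ i : Fin (n + 1), (-1 : ℤ) ^ (i : ℕ) • (θ ![w i] * α (i.removeNth w)) := by
  rw [wedgeForm, ContinuousAlternatingMap.alternatizeUncurryFin_apply]
  simp only [ContinuousLinearMap.smulRight_apply, ofSubsingleton_symm_apply]
  rfl

lemma wedgeForm_apply_two (θ α : E [⋀^Fin 1]→L[ℝ] ℝ) (a b : E) :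
    wedgeForm θ α ![a, b] = θ ![a] * α ![b] - θ ![b] * α ![a] := by
  have h1 : Fin.removeNth 0 ![a, b] = ![b] := by ext i; fin_cases i; rfl
  have h2 : Fin.removeNth 1 ![a, b] = ![a] := by ext i; fin_cases i; rfl
  rw [wedgeForm_apply, Fin.sum_univ_two, h1, h2]
  simp
  ring

lemma wedgeForm_apply_three (θ : E [⋀^Fin 1]→L[ℝ] ℝ) (α : E [⋀^Fin 2]→L[ℝ] ℝ) (a b c : E) :
    wedgeForm θ α ![a, b, c] = θ ![a] * α ![b, c] - θ ![b] * α ![a, c] + θ ![c] * α ![a, b] := by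
  have h1 : Fin.removeNth 0 ![a, b, c] = ![b, c] := by ext i; fin_cases i <;> rfl
  have h2 : Fin.removeNth 1 ![a, b, c] = ![a, c] := by ext i; fin_cases i <;> rfl
  have h3 : Fin.removeNth 2 ![a, b, c] = ![a, b] := by ext i; fin_cases i <;> rfl
  rw [wedgeForm_apply, Fin.sum_univ_three, h1, h2, h3]
  simp
  ring

lemma contDiffAt_wedgeForm {θ : E → E [⋀^Fin 1]→L[ℝ] ℝ} {α : E → E [⋀^Fin n]→L[ℝ] ℝ} {y : E}
    {r : WithTop ℕ∞} (hθ : ContDiffAt ℝ r θ y) (hα : ContDiffAt ℝ r α y) :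
    ContDiffAt ℝ r (fun z => wedgeForm (θ z) (α z)) y := by
  have h1 : ContDiffAt ℝ r (fun z =>
      (ContinuousAlternatingMap.ofSubsingletonLIE (𝕜 := ℝ) (E := E) (F := ℝ) (0 : Fin 1)).symm
        (θ z)) y :=
    ContDiffAt.comp (g := (ContinuousAlternatingMap.ofSubsingletonLIE (𝕜 := ℝ) (E := E) (F := ℝ)
      (0 : Fin 1)).symm) y (LinearIsometryEquiv.contDiff _).contDiffAt hθ
  exact ContDiffAt.comp (g := ContinuousAlternatingMap.alternatizeUncurryFinCLM (n := n) ℝ E ℝ) y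
    (ContinuousLinearMap.contDiff _).contDiffAt (h1.smulRight hα)

lemma wedgeForm_compContinuousLinearMap {F : Type*} [NormedAddCommGroup F] [NormedSpace ℝ F]
    (θ : E [⋀^Fin 1]→L[ℝ] ℝ) (α : E [⋀^Fin n]→L[ℝ] ℝ) (L : F →L[ℝ] E) :
    (wedgeForm θ α).compContinuousLinearMap L =
      wedgeForm (θ.compContinuousLinearMap L) (α.compContinuousLinearMap L) := by
  ext w
  simp only [ContinuousAlternatingMap.compContinuousLinearMap_apply, wedgeForm_apply]
  refine Finset.sum_congr rfl fun i _ => ?_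
  congr 2
  congr 1
  ext j
  fin_cases j
  rfl

lemma apply_swap (α : E [⋀^Fin 2]→L[ℝ] ℝ) (a b : E) : α ![b, a] = -α ![a, b] := by
  have h : α (![a, b] ∘ Equiv.swap 0 1) = -α ![a, b] := α.map_swap ![a, b] (by simp)
  rw [← h]
  congr 1
  ext i
  fin_cases i <;> simp

lemma fderiv_apply_const {α : E → E [⋀^Fin n]→L[ℝ] ℝ} {y : E} (hα : DifferentiableAt ℝ α y)
    (w : Fin n → E) (u : E) : fderiv ℝ (fun z => α z w) y u = fderiv ℝ α y u w :=
  fderiv_continuousAlternatingMap_apply_const_apply hα w u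

lemma differentiableAt_apply_const {α : E → E [⋀^Fin n]→L[ℝ] ℝ} {y : E}
    (hα : DifferentiableAt ℝ α y) (w : Fin n → E) : DifferentiableAt ℝ (fun z => α z w) y :=
  hα.continuousAlternatingMap_apply fun _ => differentiableAt_const _

lemma lieD_one (v : E → E) (α : E → E [⋀^Fin 1]→L[ℝ] ℝ) (y a : E) :
    lieD v α y ![a] = fderiv ℝ α y (v y) ![a] + α y ![fderiv ℝ v y a] := by
  have h : Function.update ![a] 0 (fderiv ℝ v y a) = ![fderiv ℝ v y a] := by
    ext i; fin_cases i; simp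
  simp [lieD, h]

lemma lieD_two (v : E → E) (α : E → E [⋀^Fin 2]→L[ℝ] ℝ) (y a b : E) :
    lieD v α y ![a, b] = fderiv ℝ α y (v y) ![a, b] + α y ![fderiv ℝ v y a, b] +
      α y ![a, fderiv ℝ v y b] := by
  have h : Function.update ![a, b] 0 (fderiv ℝ v y a) = ![fderiv ℝ v y a, b] := by
    ext i; fin_cases i <;> simp
  have h' : Function.update ![a, b] 1 (fderiv ℝ v y b) = ![a, fderiv ℝ v y b] := by
    ext i; fin_cases i <;> simp
  simp [lieD, Fin.sum_univ_two, add_assoc, h, h']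

lemma lieD_three (v : E → E) (α : E → E [⋀^Fin 3]→L[ℝ] ℝ) (y a b c : E) :
    lieD v α y ![a, b, c] = fderiv ℝ α y (v y) ![a, b, c] + α y ![fderiv ℝ v y a, b, c] +
      α y ![a, fderiv ℝ v y b, c] + α y ![a, b, fderiv ℝ v y c] := by
  have h₀ : Function.update ![a, b, c] 0 (fderiv ℝ v y a) = ![fderiv ℝ v y a, b, c] := by
    ext i; fin_cases i <;> simp
  have h₁ : Function.update ![a, b, c] 1 (fderiv ℝ v y b) = ![a, fderiv ℝ v y b, c] := by
    ext i; fin_cases i <;> simp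
  have h₂ : Function.update ![a, b, c] 2 (fderiv ℝ v y c) = ![a, b, fderiv ℝ v y c] := by
    ext i; fin_cases i <;> simp
  simp [lieD, Fin.sum_univ_three, add_assoc, h₀, h₁, h₂]

section
variable {X : Type*}
lemma vec_one (w : Fin 1 → X) : w = ![w 0] := by ext i; fin_cases i; rfl
lemma vec_two (w : Fin 2 → X) : w = ![w 0, w 1] := by ext i; fin_cases i <;> rfl
lemma vec_three (w : Fin 3 → X) : w = ![w 0, w 1, w 2] := by ext i; fin_cases i <;> rfl
end

lemma InvAt.wedgeForm_two {v : E → E} {θ α : E → E [⋀^Fin 1]→L[ℝ] ℝ} {y : E}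
    (hθ : ContDiffAt ℝ 1 θ y) (hα : ContDiffAt ℝ 1 α y)
    (iθ : InvAt v θ y) (iα : InvAt v α y) : InvAt v (fun z => wedgeForm (θ z) (α z)) y := by
  intro w
  have dθ := hθ.differentiableAt (by simp)
  have dα := hα.differentiableAt (by simp)
  have dw := (contDiffAt_wedgeForm hθ hα).differentiableAt (by simp)
  rw [vec_two w]
  generalize w 0 = a, w 1 = b
  rw [lieD_two, ← fderiv_apply_const dw]
  simp only [wedgeForm_apply_two]
  have e := differentiableAt_apply_const dθ
  have e' := differentiableAt_apply_const dα
  rw [fderiv_fun_sub ((e _).fun_mul (e' _)) ((e _).fun_mul (e' _)), fderiv_fun_mul (e _) (e' _),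
    fderiv_fun_mul (e _) (e' _)]
  simp only [sub_apply, add_apply, smul_apply, smul_eq_mul, fderiv_apply_const dθ,
    fderiv_apply_const dα]
  have h1 := iθ ![a]
  have h2 := iθ ![b]
  have h4 := iα ![a]
  have h5 := iα ![b]
  rw [lieD_one, add_eq_zero_iff_eq_neg] at h1 h2 h4 h5
  rw [h1, h2, h4, h5]
  ring

lemma InvAt.wedgeForm_three {v : E → E} {θ : E → E [⋀^Fin 1]→L[ℝ] ℝ}
    {α : E → E [⋀^Fin 2]→L[ℝ] ℝ} {y : E}
    (hθ : ContDiffAt ℝ 1 θ y) (hα : ContDiffAt ℝ 1 α y)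
    (iθ : InvAt v θ y) (iα : InvAt v α y) : InvAt v (fun z => wedgeForm (θ z) (α z)) y := by
  intro w
  have dθ := hθ.differentiableAt (by simp)
  have dα := hα.differentiableAt (by simp)
  have dw := (contDiffAt_wedgeForm hθ hα).differentiableAt (by simp)
  rw [vec_three w]
  generalize w 0 = a, w 1 = b, w 2 = c
  rw [lieD_three, ← fderiv_apply_const dw]
  simp only [wedgeForm_apply_three]
  have e := differentiableAt_apply_const dθ
  have e' := differentiableAt_apply_const dα
  rw [fderiv_fun_add (((e _).fun_mul (e' _)).fun_sub ((e _).fun_mul (e' _))) ((e _).fun_mul (e' _)),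
    fderiv_fun_sub ((e _).fun_mul (e' _)) ((e _).fun_mul (e' _)), fderiv_fun_mul (e _) (e' _),
    fderiv_fun_mul (e _) (e' _), fderiv_fun_mul (e _) (e' _)]
  simp only [sub_apply, add_apply, smul_apply, smul_eq_mul, fderiv_apply_const dθ,
    fderiv_apply_const dα]
  have h1 := iθ ![a]
  have h2 := iθ ![b]
  have h3 := iθ ![c]
  have h4 := iα ![a, b]
  have h5 := iα ![b, c]
  have h6 := iα ![a, c]
  rw [lieD_one, add_eq_zero_iff_eq_neg] at h1 h2 h3
  rw [lieD_two, add_assoc, add_eq_zero_iff_eq_neg] at h4 h5 h6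
  rw [h1, h2, h3, h4, h5, h6]
  ring

lemma InvAt.compContinuousLinearMap {v : E → E} {α : E → E [⋀^Fin n]→L[ℝ] ℝ} {y : E}
    (hα : DifferentiableAt ℝ α y) (h : InvAt v α y) {L : E →L[ℝ] E}
    (hL : ∀ e, fderiv ℝ v y (L e) = L (fderiv ℝ v y e)) :
    InvAt v (fun z => (α z).compContinuousLinearMap L) y := by
  intro w
  have h1 := h (fun i => L (w i))
  rw [lieD] at h1 ⊢
  have hd : DifferentiableAt ℝ (fun z => (α z).compContinuousLinearMap L) y :=
    hα.continuousAlternatingMapCompContinuousLinearMap (differentiableAt_const _)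
  rw [← fderiv_apply_const hd]
  have h2 : (fun z => (α z).compContinuousLinearMap L w) = fun z => α z (fun i => L (w i)) := rfl
  rw [h2, fderiv_apply_const hα, ← h1]
  congr 1
  refine Finset.sum_congr rfl fun i _ => ?_
  rw [ContinuousAlternatingMap.compContinuousLinearMap_apply]
  congr 1
  funext j
  by_cases hj : j = i
  · subst hj; simp [hL]
  · simp [hj]

lemma InvAt.sub {v : E → E} {α β : E → E [⋀^Fin n]→L[ℝ] ℝ} {y : E}
    (hα : DifferentiableAt ℝ α y) (hβ : DifferentiableAt ℝ β y) (h : InvAt v α y)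
    (h' : InvAt v β y) : InvAt v (fun z => α z - β z) y := by
  intro w
  have h1 := h w
  have h2 := h' w
  rw [lieD] at *
  rw [fderiv_fun_sub hα hβ]
  simp only [sub_apply, ContinuousAlternatingMap.sub_apply, Finset.sum_sub_distrib]
  linarith

end

section
variable {E : Type*} [NormedAddCommGroup E] [NormedSpace ℂ E] {n : ℕ}

/-- The real basis `(v, iv, e, ie)` attached to a complex basis `(v, e)`. -/
lemma exists_basis_real (hE : Module.finrank ℂ E = 2) {v e : E}
    (hve : LinearIndependent ℂ ![v, e]) :
    ∃ b : Module.Basis (Fin 2 × Fin 2) ℝ E, b (0, 0) = v ∧ b (1, 0) = Complex.I • v ∧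
      b (0, 1) = e ∧ b (1, 1) = Complex.I • e := by
  have hc : Fintype.card (Fin 2) = Module.finrank ℂ E := by simp [hE]
  refine ⟨Complex.basisOneI.smulTower (basisOfLinearIndependentOfCardEqFinrank hve hc),
    ?_, ?_, ?_, ?_⟩ <;> simp [Module.Basis.smulTower_apply]

lemma apply_eq_zero_of_curryLeft_eq_zero {α : E [⋀^Fin (n + 1)]→L[ℝ] ℝ} {v : E}
    (h : α.curryLeft v = 0) {w : Fin (n + 1) → E} {i : Fin (n + 1)} (hi : w i = v) : α w = 0 := by
  have h1 := ContinuousAlternatingMap.map_insertNth α i v (i.removeNth w)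
  rw [← hi, Fin.insertNth_removeNth, Function.update_eq_self] at h1
  have h2 : α (Matrix.vecCons v (i.removeNth w)) = 0 := by
    have := congrArg (fun β : E [⋀^Fin n]→L[ℝ] ℝ => β (i.removeNth w)) h
    exact this
  rw [h1, hi, h2, smul_zero]

/-- A form of degree at least three that is killed by `v` and `iv` vanishes. -/
lemma eq_zero_of_curryLeft_eq_zero (hE : Module.finrank ℂ E = 2) {v e : E}
    (hve : LinearIndependent ℂ ![v, e]) {α : E [⋀^Fin (n + 3)]→L[ℝ] ℝ}
    (h0 : α.curryLeft v = 0) (h1 : α.curryLeft (Complex.I • v) = 0) : α = 0 := by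
  obtain ⟨b, hb0, hb1, -, -⟩ := exists_basis_real hE hve
  apply ContinuousAlternatingMap.toAlternatingMap_injective
  refine Module.Basis.ext_alternating b fun f hf => ?_
  have h : ∃ i, (f i).2 = 0 := by
    by_contra! hne
    have h2 : ∀ i, (f i).2 = 1 := fun i => by have := hne i; omega
    have h3 : Function.Injective fun i => (f i).1 := fun i j hij =>
      hf (Prod.ext hij ((h2 i).trans (h2 j).symm))
    have := Fintype.card_le_of_injective _ h3
    simp at this
  obtain ⟨i, hi⟩ := h
  change α (fun j => b (f j)) = 0
  have hfi : f i = (0, 0) ∨ f i = (1, 0) := by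
    rcases hfe : f i with ⟨p, q⟩
    rw [hfe] at hi
    fin_cases p <;> simp_all
  rcases hfi with hfi | hfi
  · exact apply_eq_zero_of_curryLeft_eq_zero h0 (i := i) (by simp [hfi, hb0])
  · exact apply_eq_zero_of_curryLeft_eq_zero h1 (i := i) (by simp [hfi, hb1])

/-- A `2`-form killed by `v` and `iv` is determined by its value at `(e, ie)`. -/
lemma two_form_eq_zero (hE : Module.finrank ℂ E = 2) {v e : E}
    (hve : LinearIndependent ℂ ![v, e]) {α : E [⋀^Fin 2]→L[ℝ] ℝ}
    (h0 : α.curryLeft v = 0) (h1 : α.curryLeft (Complex.I • v) = 0)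
    (h2 : α ![e, Complex.I • e] = 0) : α = 0 := by
  obtain ⟨b, hb0, hb1, hb2, hb3⟩ := exists_basis_real hE hve
  apply ContinuousAlternatingMap.toAlternatingMap_injective
  refine Module.Basis.ext_alternating b fun f hf => ?_
  change α (fun j => b (f j)) = 0
  have hd : ∀ i, f i = (0, 0) ∨ f i = (1, 0) ∨ f i = (0, 1) ∨ f i = (1, 1) := by
    intro i
    rcases f i with ⟨p, q⟩
    fin_cases p <;> fin_cases q <;> simp
  have hk : ∀ i, f i = (0, 0) ∨ f i = (1, 0) → α (fun j => b (f j)) = 0 := by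
    rintro i (hfi | hfi)
    · exact apply_eq_zero_of_curryLeft_eq_zero h0 (i := i) (by simp [hfi, hb0])
    · exact apply_eq_zero_of_curryLeft_eq_zero h1 (i := i) (by simp [hfi, hb1])
  have hsw : α ![Complex.I • e, e] = 0 := by rw [apply_swap, h2, neg_zero]
  rw [vec_two (fun j => b (f j))]
  have h01 : f 0 ≠ f 1 := fun h => by simpa using hf h
  have hk' := fun i h => (congrArg α (vec_two (fun j => b (f j)))).symm.trans (hk i h)
  rcases hd 0 with h | h | h | h
  · exact hk' 0 (Or.inl h)
  · exact hk' 0 (Or.inr h)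
  · rcases hd 1 with h' | h' | h' | h'
    · exact hk' 1 (Or.inl h')
    · exact hk' 1 (Or.inr h')
    · exact absurd (h.trans h'.symm) h01
    · rw [h, h', hb2, hb3, h2]
  · rcases hd 1 with h' | h' | h' | h'
    · exact hk' 1 (Or.inl h')
    · exact hk' 1 (Or.inr h')
    · rw [h, h', hb2, hb3, hsw]
    · exact absurd (h.trans h'.symm) h01

end

/-! ### Local model: an invariant Hermitian metric in a chart -/

section
variable {E : Type*} [NormedAddCommGroup E] [NormedSpace ℂ E] {n : ℕ}

variable (E) in
/-- Multiplication by `i`, as a real linear map. -/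
noncomputable def mulI : E →L[ℝ] E :=
  (Complex.I • ContinuousLinearMap.id ℂ E : E →L[ℂ] E).restrictScalars ℝ

@[simp] lemma mulI_apply (e : E) : mulI E e = Complex.I • e := rfl

lemma I_smul_I_smul (e : E) : Complex.I • Complex.I • e = -e := by
  rw [smul_smul, Complex.I_mul_I, neg_one_smul]

/-- The vector field `iv`. -/
noncomputable def rot (v : E → E) : E → E := fun z => Complex.I • v z

/-- An open set of a complex vector space with a holomorphic vector field `v` and a Hermitian
metric, encoded by its fundamental form `Ω`, such that `v` and `iv` preserve `Ω`. Throughout, the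
vertical fields are given as a field `u` with `u = v ∨ u = rot v`. -/
structure HermData (U : Set E) (v : E → E) (Ω : E → E [⋀^Fin 2]→L[ℝ] ℝ) : Prop where
  isOpen : IsOpen U
  smooth_v : ∀ y ∈ U, ContDiffAt ℝ ∞ v y
  smooth_Ω : ∀ y ∈ U, ContDiffAt ℝ ∞ Ω y
  v_ne : ∀ y ∈ U, v y ≠ 0
  hol : ∀ y ∈ U, ∀ e, fderiv ℝ v y (Complex.I • e) = Complex.I • fderiv ℝ v y e
  inv : ∀ y ∈ U, InvAt v Ω y
  inv_rot : ∀ y ∈ U, InvAt (rot v) Ω y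
  herm : ∀ y ∈ U, ∀ a b, Ω y ![Complex.I • a, Complex.I • b] = Ω y ![a, b]
  pos : ∀ y ∈ U, ∀ a, a ≠ 0 → 0 < Ω y ![a, Complex.I • a]

/-- The function `λ = Ω(v, iv)`. -/
noncomputable def lamFun (v : E → E) (Ω : E → E [⋀^Fin 2]→L[ℝ] ℝ) (y : E) : ℝ :=
  Ω y ![v y, Complex.I • v y]

/-- The connection form `μ₁`, with `μ₁(v) = 1` and `μ₁(iv) = 0`. -/
noncomputable def mu₁ (v : E → E) (Ω : E → E [⋀^Fin 2]→L[ℝ] ℝ) : E → E [⋀^Fin 1]→L[ℝ] ℝ :=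
  fun y => (-(lamFun v Ω y)⁻¹) • contract (rot v) Ω y

/-- The connection form `μ₂`, with `μ₂(v) = 0` and `μ₂(iv) = 1`. -/
noncomputable def mu₂ (v : E → E) (Ω : E → E [⋀^Fin 2]→L[ℝ] ℝ) : E → E [⋀^Fin 1]→L[ℝ] ℝ :=
  fun y => (lamFun v Ω y)⁻¹ • contract v Ω y

/-- The transverse form `Ω - λ μ₁ ∧ μ₂`. -/
noncomputable def transFun (v : E → E) (Ω : E → E [⋀^Fin 2]→L[ℝ] ℝ) : E → E [⋀^Fin 2]→L[ℝ] ℝ :=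
  fun y => Ω y - lamFun v Ω y • wedgeForm (mu₁ v Ω y) (mu₂ v Ω y)

lemma fderiv_rot {v : E → E} {y : E} (hv : DifferentiableAt ℝ v y) (e : E) :
    fderiv ℝ (rot v) y e = Complex.I • fderiv ℝ v y e := by
  have h : HasFDerivAt (rot v) ((mulI E).comp (fderiv ℝ v y)) y :=
    HasFDerivAt.comp (g := mulI E) y (mulI E).hasFDerivAt hv.hasFDerivAt
  rw [h.fderiv]
  rfl

lemma contDiffAt_rot {v : E → E} {y : E} {r : WithTop ℕ∞} (hv : ContDiffAt ℝ r v y) :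
    ContDiffAt ℝ r (rot v) y :=
  ContDiffAt.comp (g := mulI E) y (mulI E).contDiff.contDiffAt hv

namespace HermData

variable {U : Set E} {v u w : E → E} {Ω : E → E [⋀^Fin 2]→L[ℝ] ℝ} {y : E}

lemma smooth_vert (H : HermData U v Ω) (hu : u = v ∨ u = rot v) (hy : y ∈ U) :
    ContDiffAt ℝ ∞ u y := by
  rcases hu with rfl | rfl
  exacts [H.smooth_v y hy, contDiffAt_rot (H.smooth_v y hy)]

lemma diff_vert (H : HermData U v Ω) (hu : u = v ∨ u = rot v) (hy : y ∈ U) :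
    DifferentiableAt ℝ u y :=
  (H.smooth_vert hu hy).differentiableAt (by simp)

lemma diff_Ω (H : HermData U v Ω) (hy : y ∈ U) : DifferentiableAt ℝ Ω y :=
  (H.smooth_Ω y hy).differentiableAt (by simp)

lemma eventually_mem (H : HermData U v Ω) (hy : y ∈ U) : ∀ᶠ z in 𝓝 y, z ∈ U :=
  H.isOpen.mem_nhds hy

lemma hol_vert (H : HermData U v Ω) (hu : u = v ∨ u = rot v) (hy : y ∈ U) (e : E) :
    fderiv ℝ u y (Complex.I • e) = Complex.I • fderiv ℝ u y e := by
  rcases hu with rfl | rfl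
  · exact H.hol y hy e
  · rw [fderiv_rot (H.diff_vert (Or.inl rfl) hy), fderiv_rot (H.diff_vert (Or.inl rfl) hy),
      H.hol y hy]

lemma inv_vert (H : HermData U v Ω) (hu : u = v ∨ u = rot v) (hy : y ∈ U) : InvAt u Ω y := by
  rcases hu with rfl | rfl
  exacts [H.inv y hy, H.inv_rot y hy]

/-- The vertical fields commute, as `v` is holomorphic. -/
lemma bracket_vert (H : HermData U v Ω) (hu : u = v ∨ u = rot v) (hw : w = v ∨ w = rot v)
    (hy : y ∈ U) : lieBracket ℝ u w y = 0 := by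
  have hd := H.diff_vert (Or.inl rfl) hy
  have h1 : lieBracket ℝ v (rot v) y = 0 := by
    rw [lieBracket, fderiv_rot hd, rot, H.hol y hy, sub_self]
  rcases hu with rfl | rfl <;> rcases hw with rfl | rfl
  · simp
  · exact h1
  · rw [lieBracket_swap, h1, neg_zero]
  · simp

lemma inv_contract (H : HermData U v Ω) (hu : u = v ∨ u = rot v) (hw : w = v ∨ w = rot v)
    (hy : y ∈ U) {α : E → E [⋀^Fin (n + 1)]→L[ℝ] ℝ} (hα : ContDiffAt ℝ ∞ α y)
    (h : InvAt u α y) : InvAt u (contract w α) y :=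
  h.contract (hα.differentiableAt (by simp)) (H.diff_vert hw hy) (H.bracket_vert hu hw hy)

/-- Contracting twice the exterior derivative of an invariant form: `ι_w ι_u dα = d ι_w ι_u α`. -/
lemma contract_contract_extDeriv (H : HermData U v Ω) (hu : u = v ∨ u = rot v)
    (hw : w = v ∨ w = rot v) {α : E → E [⋀^Fin (n + 2)]→L[ℝ] ℝ}
    (hα : ∀ z ∈ U, ContDiffAt ℝ ∞ α z) (hiu : ∀ z ∈ U, InvAt u α z) (hiw : ∀ z ∈ U, InvAt w α z)
    (hy : y ∈ U) :
    contract w (contract u (extDeriv α)) y = extDeriv (contract w (contract u α)) y := by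
  have h1 := contract_extDeriv_of_invAt ((hα y hy).differentiableAt (by simp)) (H.diff_vert hu hy)
    (hiu y hy)
  have h2 := contract_extDeriv_of_invAt
    ((contDiffAt_contract (hα y hy) (H.smooth_vert hu hy)).differentiableAt (by simp))
    (H.diff_vert hw hy) (H.inv_contract hw hu hy (hα y hy) (hiw y hy))
  rw [contract, h1, ← neg_eq_iff_eq_neg.2 h2]
  rfl

lemma lamFun_eq : lamFun v Ω = fun z => contract (rot v) (contract v Ω) z ![] := rfl

lemma smooth_lam (H : HermData U v Ω) (hy : y ∈ U) : ContDiffAt ℝ ∞ (lamFun v Ω) y := by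
  have h := contDiffAt_contract (contDiffAt_contract (H.smooth_Ω y hy) (H.smooth_v y hy))
    (H.smooth_vert (Or.inr rfl) hy)
  exact (ContinuousAlternatingMap.apply ℝ E ℝ ![]).contDiff.contDiffAt.comp y h

lemma diff_lam (H : HermData U v Ω) (hy : y ∈ U) : DifferentiableAt ℝ (lamFun v Ω) y :=
  (H.smooth_lam hy).differentiableAt (by simp)

lemma lam_pos (H : HermData U v Ω) (hy : y ∈ U) : 0 < lamFun v Ω y :=
  H.pos y hy _ (H.v_ne y hy)

lemma fderiv_lam_vert (H : HermData U v Ω) (hu : u = v ∨ u = rot v) (hy : y ∈ U) :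
    fderiv ℝ (lamFun v Ω) y (u y) = 0 := by
  have hc := contDiffAt_contract (contDiffAt_contract (H.smooth_Ω y hy) (H.smooth_v y hy))
    (H.smooth_vert (Or.inr rfl) hy)
  have h := H.inv_contract hu (Or.inr rfl) hy
    (contDiffAt_contract (H.smooth_Ω y hy) (H.smooth_v y hy))
    (H.inv_contract hu (Or.inl rfl) hy (H.smooth_Ω y hy) (H.inv_vert hu hy)) ![]
  rw [lieD, ← fderiv_apply_const (hc.differentiableAt (by simp))] at h
  simpa [lamFun_eq] using h

lemma smooth_mu₁ (H : HermData U v Ω) (hy : y ∈ U) : ContDiffAt ℝ ∞ (mu₁ v Ω) y :=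
  ((H.smooth_lam hy).inv (H.lam_pos hy).ne').neg.smul
    (contDiffAt_contract (H.smooth_Ω y hy) (H.smooth_vert (Or.inr rfl) hy))

lemma smooth_mu₂ (H : HermData U v Ω) (hy : y ∈ U) : ContDiffAt ℝ ∞ (mu₂ v Ω) y :=
  ((H.smooth_lam hy).inv (H.lam_pos hy).ne').smul
    (contDiffAt_contract (H.smooth_Ω y hy) (H.smooth_v y hy))

lemma smooth_trans (H : HermData U v Ω) (hy : y ∈ U) : ContDiffAt ℝ ∞ (transFun v Ω) y :=
  (H.smooth_Ω y hy).sub ((H.smooth_lam hy).smul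
    (contDiffAt_wedgeForm (H.smooth_mu₁ hy) (H.smooth_mu₂ hy)))

lemma fderiv_lam_inv_vert (H : HermData U v Ω) (hu : u = v ∨ u = rot v) (hy : y ∈ U) :
    fderiv ℝ (fun z => (lamFun v Ω z)⁻¹) y (u y) = 0 := by
  have h : HasFDerivAt (fun z => (lamFun v Ω z)⁻¹) _ y :=
    (hasDerivAt_inv (H.lam_pos hy).ne').comp_hasFDerivAt y (H.diff_lam hy).hasFDerivAt
  rw [h.fderiv]
  simp [H.fderiv_lam_vert hu hy]

lemma inv_mu₁ (H : HermData U v Ω) (hu : u = v ∨ u = rot v) (hy : y ∈ U) :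
    InvAt u (mu₁ v Ω) y := by
  have hd : DifferentiableAt ℝ (fun z => (lamFun v Ω z)⁻¹) y :=
    (H.diff_lam hy).inv (H.lam_pos hy).ne'
  refine InvAt.smul hd.neg (differentiableAt_contract (H.diff_Ω hy) (H.diff_vert (Or.inr rfl) hy))
    ?_ (H.inv_contract hu (Or.inr rfl) hy (H.smooth_Ω y hy) (H.inv_vert hu hy))
  rw [fderiv_fun_neg, neg_apply, H.fderiv_lam_inv_vert hu hy, neg_zero]

lemma inv_mu₂ (H : HermData U v Ω) (hu : u = v ∨ u = rot v) (hy : y ∈ U) :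
    InvAt u (mu₂ v Ω) y := by
  have hd : DifferentiableAt ℝ (fun z => (lamFun v Ω z)⁻¹) y :=
    (H.diff_lam hy).inv (H.lam_pos hy).ne'
  exact InvAt.smul hd (differentiableAt_contract (H.diff_Ω hy) (H.diff_vert (Or.inl rfl) hy))
    (H.fderiv_lam_inv_vert hu hy)
    (H.inv_contract hu (Or.inl rfl) hy (H.smooth_Ω y hy) (H.inv_vert hu hy))

lemma inv_trans (H : HermData U v Ω) (hu : u = v ∨ u = rot v) (hy : y ∈ U) :
    InvAt u (transFun v Ω) y := by
  have hw := contDiffAt_wedgeForm (H.smooth_mu₁ hy) (H.smooth_mu₂ hy)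
  refine InvAt.sub (H.diff_Ω hy) (((H.smooth_lam hy).smul hw).differentiableAt (by simp))
    (H.inv_vert hu hy) (InvAt.smul (H.diff_lam hy) (hw.differentiableAt (by simp))
      (H.fderiv_lam_vert hu hy) (InvAt.wedgeForm_two ?_ ?_ (H.inv_mu₁ hu hy) (H.inv_mu₂ hu hy)))
  · exact (H.smooth_mu₁ hy).of_le (by simp)
  · exact (H.smooth_mu₂ hy).of_le (by simp)

lemma Ω_same (a : E) : Ω y ![a, a] = 0 :=
  (Ω y).map_eq_zero_of_eq _ (i := 0) (j := 1) rfl (by simp)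

lemma Ω_I_left (H : HermData U v Ω) (hy : y ∈ U) (a b : E) :
    Ω y ![a, Complex.I • b] = -Ω y ![Complex.I • a, b] := by
  have h := H.herm y hy a (Complex.I • b)
  rw [I_smul_I_smul] at h
  rw [← h, ← neg_one_smul ℝ b]
  have := (Ω y).map_update_smul ![Complex.I • a, b] 1 (-1 : ℝ) b
  have h2 : ∀ c : E, Function.update ![Complex.I • a, b] 1 c = ![Complex.I • a, c] := fun c => by
    ext i; fin_cases i <;> simp
  rw [h2, h2] at this
  rw [this]; simp

lemma mu₁_apply (a : E) :
    mu₁ v Ω y ![a] = -(lamFun v Ω y)⁻¹ * Ω y ![Complex.I • v y, a] := rfl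

lemma mu₂_apply (a : E) : mu₂ v Ω y ![a] = (lamFun v Ω y)⁻¹ * Ω y ![v y, a] := rfl

lemma mu₁_v (H : HermData U v Ω) (hy : y ∈ U) : mu₁ v Ω y ![v y] = 1 := by
  rw [mu₁_apply, apply_swap]
  have := (H.lam_pos hy).ne'
  change -(lamFun v Ω y)⁻¹ * -lamFun v Ω y = 1
  field_simp

lemma mu₁_rot : mu₁ v Ω y ![Complex.I • v y] = 0 := by
  rw [mu₁_apply, Ω_same, mul_zero]

lemma mu₂_v : mu₂ v Ω y ![v y] = 0 := by
  rw [mu₂_apply, Ω_same, mul_zero]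

lemma mu₂_rot (H : HermData U v Ω) (hy : y ∈ U) : mu₂ v Ω y ![Complex.I • v y] = 1 := by
  rw [mu₂_apply]
  exact inv_mul_cancel₀ (H.lam_pos hy).ne'

lemma transFun_apply (a b : E) : transFun v Ω y ![a, b] = Ω y ![a, b] -
    lamFun v Ω y * (mu₁ v Ω y ![a] * mu₂ v Ω y ![b] - mu₁ v Ω y ![b] * mu₂ v Ω y ![a]) := by
  rw [← wedgeForm_apply_two]
  rfl

lemma contract_trans (H : HermData U v Ω) (hu : u = v ∨ u = rot v) (hy : y ∈ U) :
    contract u (transFun v Ω) y = 0 := by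
  have hl := (H.lam_pos hy).ne'
  ext a
  rw [vec_one a]
  generalize a 0 = a
  change transFun v Ω y ![u y, a] = 0
  rw [transFun_apply]
  rcases hu with rfl | rfl
  · rw [H.mu₁_v hy, mu₂_v, mu₂_apply]
    field_simp
    ring
  · change Ω y ![Complex.I • v y, a] - _ * (mu₁ v Ω y ![Complex.I • v y] * _ -
      _ * mu₂ v Ω y ![Complex.I • v y]) = 0
    rw [mu₁_rot, H.mu₂_rot hy, mu₁_apply]
    field_simp
    ring

/-- There is a horizontal vector: one orthogonal to `v` and `iv`, hence complex independent of
`v`. -/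
lemma exists_horizontal (H : HermData U v Ω) (hE : Module.finrank ℂ E = 2) (hy : y ∈ U) :
    ∃ e, LinearIndependent ℂ ![v y, e] ∧ Ω y ![v y, e] = 0 ∧ Ω y ![Complex.I • v y, e] = 0 := by
  obtain ⟨w, hw⟩ := exists_linearIndependent_pair_of_one_lt_finrank (R := ℂ) (M := E)
    (by rw [hE]; norm_num) (H.v_ne y hy)
  set a := mu₁ v Ω y ![w]
  set b := mu₂ v Ω y ![w]
  have hl := (H.lam_pos hy).ne'
  have hlin : ∀ c : E, Ω y ![c, w - a • v y - b • (Complex.I • v y)] =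
      Ω y ![c, w] - a * Ω y ![c, v y] - b * Ω y ![c, Complex.I • v y] := fun c => by
    let f : E →L[ℝ] ℝ := (ContinuousAlternatingMap.ofSubsingleton ℝ E ℝ (0 : Fin 1)).symm
      ((Ω y).curryLeft c)
    have hf : ∀ d, Ω y ![c, d] = f d := fun d => by
      rw [ofSubsingleton_symm_apply]
      rfl
    rw [hf, hf, hf, hf]
    simp
  refine ⟨w - a • v y - b • (Complex.I • v y), ?_, ?_, ?_⟩
  · rw [LinearIndependent.pair_iff] at hw ⊢
    intro s t hst
    have h := hw (s - t * a - t * b * Complex.I) t (by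
      rw [← hst]
      simp only [sub_smul, smul_sub, mul_smul, Complex.coe_smul]
      abel)
    refine ⟨?_, h.2⟩
    have := h.1
    rw [h.2] at this
    simpa using this
  · rw [hlin, Ω_same]
    change _ - a * 0 - (lamFun v Ω y)⁻¹ * Ω y ![v y, w] * lamFun v Ω y = 0
    field_simp
    ring
  · rw [hlin, Ω_same, apply_swap (Ω y) (v y)]
    change _ - -(lamFun v Ω y)⁻¹ * Ω y ![Complex.I • v y, w] * (-lamFun v Ω y) - b * 0 = 0
    field_simp
    ring

lemma horizontal_I (H : HermData U v Ω) (hy : y ∈ U) {e : E} (h1 : Ω y ![v y, e] = 0)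
    (h2 : Ω y ![Complex.I • v y, e] = 0) :
    Ω y ![v y, Complex.I • e] = 0 ∧ Ω y ![Complex.I • v y, Complex.I • e] = 0 := by
  rw [H.herm y hy, H.Ω_I_left hy, h2, h1]
  simp

/-- The transverse form is positive on the horizontal complex line. -/
lemma trans_pos (H : HermData U v Ω) (hy : y ∈ U) {e : E} (he : LinearIndependent ℂ ![v y, e])
    (h1 : Ω y ![v y, e] = 0) (h2 : Ω y ![Complex.I • v y, e] = 0) :
    0 < transFun v Ω y ![e, Complex.I • e] := by
  rw [transFun_apply, mu₁_apply, mu₂_apply e, h1, h2]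
  simpa using H.pos y hy e (he.ne_zero 1)

lemma trans_ne_zero (H : HermData U v Ω) (hE : Module.finrank ℂ E = 2) (hy : y ∈ U) :
    transFun v Ω y ≠ 0 := by
  obtain ⟨e, he, h1, h2⟩ := H.exists_horizontal hE hy
  intro h
  have := H.trans_pos hy he h1 h2
  rw [h] at this
  exact lt_irrefl _ this

/-- `2`-forms killed by `v` and `iv` are multiples of the transverse form. -/
lemma exists_eq_smul_trans (H : HermData U v Ω) (hE : Module.finrank ℂ E = 2) (hy : y ∈ U)
    {A : E [⋀^Fin 2]→L[ℝ] ℝ} (h0 : A.curryLeft (v y) = 0)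
    (h1 : A.curryLeft (Complex.I • v y) = 0) : ∃ c : ℝ, A = c • transFun v Ω y := by
  obtain ⟨e, he, k1, k2⟩ := H.exists_horizontal hE hy
  have hp := (H.trans_pos hy he k1 k2).ne'
  refine ⟨A ![e, Complex.I • e] / transFun v Ω y ![e, Complex.I • e], ?_⟩
  rw [← sub_eq_zero]
  have t0 : (transFun v Ω y).curryLeft (v y) = 0 := H.contract_trans (Or.inl rfl) hy
  have t1 : (transFun v Ω y).curryLeft (Complex.I • v y) = 0 := H.contract_trans (Or.inr rfl) hy
  have hs : ∀ (c : ℝ) (u : E), (A - c • transFun v Ω y).curryLeft u =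
      A.curryLeft u - c • (transFun v Ω y).curryLeft u := fun c u => rfl
  refine two_form_eq_zero hE he ?_ ?_ ?_
  · rw [hs, h0, t0, smul_zero, sub_zero]
  · rw [hs, h1, t1, smul_zero, sub_zero]
  · rw [ContinuousAlternatingMap.sub_apply, ContinuousAlternatingMap.smul_apply, smul_eq_mul]
    field_simp
    ring

lemma eq_zero_of_contract (H : HermData U v Ω) (hE : Module.finrank ℂ E = 2) (hy : y ∈ U)
    {α : E → E [⋀^Fin (n + 3)]→L[ℝ] ℝ} (h0 : contract v α y = 0) (h1 : contract (rot v) α y = 0) :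
    α y = 0 := by
  obtain ⟨e, he, -, -⟩ := H.exists_horizontal hE hy
  exact eq_zero_of_curryLeft_eq_zero hE he h0 h1

/-- A `4`-form vanishes if its double contraction with `v` and `iv` does. -/
lemma eq_zero_of_contract_contract (H : HermData U v Ω) (hE : Module.finrank ℂ E = 2)
    (hy : y ∈ U) {α : E → E [⋀^Fin 4]→L[ℝ] ℝ} (h : contract (rot v) (contract v α) y = 0) :
    α y = 0 := by
  have h1 : contract v α y = 0 := H.eq_zero_of_contract hE hy
    ((α y).curryLeft_same (v y)) h
  refine H.eq_zero_of_contract hE hy h1 (H.eq_zero_of_contract hE hy ?_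
    ((α y).curryLeft_same (rot v y)))
  ext w
  exact apply_eq_zero_of_curryLeft_eq_zero (i := 1) h1 rfl

end HermData
end

/-! ### Exterior derivatives in the local model -/

section
variable {E : Type*} [NormedAddCommGroup E] [NormedSpace ℂ E] {n : ℕ}
namespace HermData

variable {U : Set E} {v u w : E → E} {Ω : E → E [⋀^Fin 2]→L[ℝ] ℝ} {y : E}

lemma extDeriv_congr_on (H : HermData U v Ω) (hy : y ∈ U) {α β : E → E [⋀^Fin n]→L[ℝ] ℝ}
    (h : ∀ z ∈ U, α z = β z) : extDeriv α y = extDeriv β y :=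
  Filter.EventuallyEq.extDeriv_eq ((H.eventually_mem hy).mono h)

lemma extDeriv_const_form (c : E [⋀^Fin n]→L[ℝ] ℝ) : extDeriv (fun _ : E => c) y = 0 := by
  ext w
  rw [extDeriv_apply']
  simp

/-- An invariant form with constant contraction against `u` satisfies `ι_u dα = 0`. -/
lemma contract_extDeriv_eq_zero (H : HermData U v Ω) (hu : u = v ∨ u = rot v) (hy : y ∈ U)
    {α : E → E [⋀^Fin (n + 1)]→L[ℝ] ℝ} (hα : ContDiffAt ℝ ∞ α y) (hi : InvAt u α y)
    (c : E [⋀^Fin n]→L[ℝ] ℝ) (hc : ∀ z ∈ U, contract u α z = c) :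
    contract u (extDeriv α) y = 0 := by
  rw [contract_extDeriv_of_invAt (hα.differentiableAt (by simp)) (H.diff_vert hu hy) hi,
    H.extDeriv_congr_on hy hc, extDeriv_const_form, neg_zero]

lemma zero_form_eq_const {α : E [⋀^Fin 0]→L[ℝ] ℝ} {c : ℝ} (h : α ![] = c) :
    α = ContinuousAlternatingMap.constOfIsEmpty ℝ E (Fin 0) c := by
  ext w
  rw [Subsingleton.elim w ![], h]
  rfl

lemma contract_mu (H : HermData U v Ω) (hu : u = v ∨ u = rot v) {μ : E → E [⋀^Fin 1]→L[ℝ] ℝ}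
    (hμ : μ = mu₁ v Ω ∨ μ = mu₂ v Ω) : ∃ c, ∀ z ∈ U, contract u μ z = c := by
  rcases hμ with rfl | rfl <;> rcases hu with rfl | rfl
  · exact ⟨_, fun z hz => zero_form_eq_const (H.mu₁_v hz)⟩
  · exact ⟨_, fun z hz => zero_form_eq_const mu₁_rot⟩
  · exact ⟨_, fun z hz => zero_form_eq_const mu₂_v⟩
  · exact ⟨_, fun z hz => zero_form_eq_const (H.mu₂_rot hz)⟩

lemma smooth_mu (H : HermData U v Ω) {μ : E → E [⋀^Fin 1]→L[ℝ] ℝ}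
    (hμ : μ = mu₁ v Ω ∨ μ = mu₂ v Ω) (hy : y ∈ U) : ContDiffAt ℝ ∞ μ y := by
  rcases hμ with rfl | rfl
  exacts [H.smooth_mu₁ hy, H.smooth_mu₂ hy]

lemma inv_mu (H : HermData U v Ω) {μ : E → E [⋀^Fin 1]→L[ℝ] ℝ}
    (hμ : μ = mu₁ v Ω ∨ μ = mu₂ v Ω) (hu : u = v ∨ u = rot v) (hy : y ∈ U) : InvAt u μ y := by
  rcases hμ with rfl | rfl
  exacts [H.inv_mu₁ hu hy, H.inv_mu₂ hu hy]

/-- `dμᵢ` is horizontal, because `μᵢ` is invariant and constant on `v` and `iv`. -/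
lemma contract_dmu (H : HermData U v Ω) {μ : E → E [⋀^Fin 1]→L[ℝ] ℝ}
    (hμ : μ = mu₁ v Ω ∨ μ = mu₂ v Ω) (hu : u = v ∨ u = rot v) (hy : y ∈ U) :
    contract u (extDeriv μ) y = 0 := by
  obtain ⟨c, hc⟩ := H.contract_mu hu hμ
  exact H.contract_extDeriv_eq_zero hu hy (H.smooth_mu hμ hy) (H.inv_mu hμ hu hy) c hc

/-- `dμᵢ` is a multiple of the transverse form. -/
lemma exists_dmu_eq (H : HermData U v Ω) (hE : Module.finrank ℂ E = 2)
    {μ : E → E [⋀^Fin 1]→L[ℝ] ℝ} (hμ : μ = mu₁ v Ω ∨ μ = mu₂ v Ω) (hy : y ∈ U) :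
    ∃ c : ℝ, extDeriv μ y = c • transFun v Ω y :=
  H.exists_eq_smul_trans hE hy (H.contract_dmu hμ (Or.inl rfl) hy)
    (H.contract_dmu hμ (Or.inr rfl) hy)

/-- The transverse form is closed. -/
lemma extDeriv_trans (H : HermData U v Ω) (hE : Module.finrank ℂ E = 2) (hy : y ∈ U) :
    extDeriv (transFun v Ω) y = 0 := by
  have h : ∀ u, (u = v ∨ u = rot v) → contract u (extDeriv (transFun v Ω)) y = 0 := fun u hu =>
    H.contract_extDeriv_eq_zero hu hy (H.smooth_trans hy) (H.inv_trans hu hy) 0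
      fun z hz => H.contract_trans hu hz
  exact H.eq_zero_of_contract (n := 0) hE hy (h _ (Or.inl rfl)) (h _ (Or.inr rfl))

/-- Near each point, `σᵢ` is a quotient of values of `dμᵢ` and of the transverse form on constant
vectors. -/
lemma sigma_eq (H : HermData U v Ω) (hE : Module.finrank ℂ E = 2)
    {μ : E → E [⋀^Fin 1]→L[ℝ] ℝ} {s : E → ℝ}
    (hs : ∀ z ∈ U, extDeriv μ z = s z • transFun v Ω z) (hy : y ∈ U) :
    ∃ e : E, transFun v Ω y ![e, Complex.I • e] ≠ 0 ∧
      s =ᶠ[𝓝 y] fun z => extDeriv μ z ![e, Complex.I • e] / transFun v Ω z ![e, Complex.I • e] := by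
  obtain ⟨e, he, h1, h2⟩ := H.exists_horizontal hE hy
  have hp := (H.trans_pos hy he h1 h2).ne'
  refine ⟨e, hp, ?_⟩
  have hc : ContinuousAt (fun z => transFun v Ω z ![e, Complex.I • e]) y :=
    (differentiableAt_apply_const ((H.smooth_trans hy).differentiableAt (by simp)) _).continuousAt
  filter_upwards [H.eventually_mem hy, hc.eventually_ne hp] with z hz hz'
  rw [hs z hz, ContinuousAlternatingMap.smul_apply, smul_eq_mul, mul_div_cancel_right₀ _ hz']

lemma contDiffAt_apply_const {α : E → E [⋀^Fin n]→L[ℝ] ℝ} {r : WithTop ℕ∞}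
    (hα : ContDiffAt ℝ r α y) (w : Fin n → E) : ContDiffAt ℝ r (fun z => α z w) y :=
  (ContinuousAlternatingMap.apply ℝ E ℝ w).contDiff.contDiffAt.comp y hα

lemma smooth_sigma (H : HermData U v Ω) (hE : Module.finrank ℂ E = 2)
    {μ : E → E [⋀^Fin 1]→L[ℝ] ℝ} (hμ : μ = mu₁ v Ω ∨ μ = mu₂ v Ω) {s : E → ℝ}
    (hs : ∀ z ∈ U, extDeriv μ z = s z • transFun v Ω z) (hy : y ∈ U) : ContDiffAt ℝ ∞ s y := by
  obtain ⟨e, he, hse⟩ := H.sigma_eq hE hs hy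
  refine ContDiffAt.congr_of_eventuallyEq ?_ hse
  exact (contDiffAt_apply_const (contDiffAt_extDeriv (H.smooth_mu hμ hy) (by simp)) _).div
    (contDiffAt_apply_const (H.smooth_trans hy) _) he

/-- `σᵢ` is constant along the vertical directions. -/
lemma fderiv_sigma_vert (H : HermData U v Ω) (hE : Module.finrank ℂ E = 2)
    {μ : E → E [⋀^Fin 1]→L[ℝ] ℝ} (hμ : μ = mu₁ v Ω ∨ μ = mu₂ v Ω) {s : E → ℝ}
    (hs : ∀ z ∈ U, extDeriv μ z = s z • transFun v Ω z) (hu : u = v ∨ u = rot v) (hy : y ∈ U) :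
    fderiv ℝ s y (u y) = 0 := by
  have hsd := (H.smooth_sigma hE hμ hs hy).differentiableAt (by simp)
  have htd := (H.smooth_trans hy).differentiableAt (by simp)
  have hi : InvAt u (extDeriv μ) y := by
    have he : ∀ᶠ z in 𝓝 y, InvAt u μ z := (H.eventually_mem hy).mono fun z hz => H.inv_mu hμ hu hz
    exact InvAt.extDeriv (H.smooth_mu hμ hy) (H.smooth_vert hu hy) he
  have hev : extDeriv μ =ᶠ[𝓝 y] fun z => s z • transFun v Ω z :=
    (H.eventually_mem hy).mono hs
  by_contra hne
  refine H.trans_ne_zero hE hy ?_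
  ext w
  have h1 := hi w
  have h2 := H.inv_trans hu hy w
  rw [lieD, hev.fderiv_eq, hev.eq_of_nhds, fderiv_fun_smul hsd htd] at h1
  rw [lieD] at h2
  simp only [add_apply, smul_apply, ContinuousLinearMap.smulRight_apply,
    ContinuousAlternatingMap.add_apply, ContinuousAlternatingMap.smul_apply,
    smul_eq_mul, ← Finset.mul_sum] at h1
  have h3 : fderiv ℝ s y (u y) * transFun v Ω y w = 0 := by linear_combination h1 - s y * h2
  simpa [hne] using h3

/-- The form `JdΩ`. -/
noncomputable def etaFun (Ω : E → E [⋀^Fin 2]→L[ℝ] ℝ) : E → E [⋀^Fin 3]→L[ℝ] ℝ :=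
  fun z => (extDeriv Ω z).compContinuousLinearMap (-mulI E)

lemma smooth_eta (H : HermData U v Ω) (hy : y ∈ U) : ContDiffAt ℝ ∞ (etaFun Ω) y :=
  ContDiffAt.comp (g := ContinuousAlternatingMap.compContinuousLinearMapCLM
    (ι := Fin 3) (F := ℝ) (-mulI E)) y (ContinuousLinearMap.contDiff _).contDiffAt
    (contDiffAt_extDeriv (H.smooth_Ω y hy) (by simp))

lemma inv_eta (H : HermData U v Ω) (hu : u = v ∨ u = rot v) (hy : y ∈ U) :
    InvAt u (etaFun Ω) y := by
  have he : ∀ᶠ z in 𝓝 y, InvAt u Ω z := (H.eventually_mem hy).mono fun z hz => H.inv_vert hu hz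
  refine InvAt.compContinuousLinearMap
    ((contDiffAt_extDeriv (r := ∞) (H.smooth_Ω y hy) (by simp)).differentiableAt (by simp))
    (InvAt.extDeriv (H.smooth_Ω y hy) (H.smooth_vert hu hy) he) fun e => ?_
  change fderiv ℝ u y (-(Complex.I • e)) = -(Complex.I • fderiv ℝ u y e)
  rw [map_neg, H.hol_vert hu hy]

lemma extDeriv_zero_form {f : E → ℝ} {α : E → E [⋀^Fin 0]→L[ℝ] ℝ} (hα : DifferentiableAt ℝ α y)
    (hf : (fun z => α z ![]) =ᶠ[𝓝 y] f) (a : E) : extDeriv α y ![a] = fderiv ℝ f y a := by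
  rw [extDeriv_apply', Fin.sum_univ_one, ← hf.fderiv_eq, ← fderiv_apply_const hα]
  simp only [Fin.val_zero, pow_zero, one_smul, Matrix.cons_val_zero]
  rw [show Fin.removeNth 0 ![a] = ![] from Subsingleton.elim _ _]

/-- `ι_{iv} ι_v dΩ = dλ`. -/
lemma dΩ_vert (H : HermData U v Ω) (hy : y ∈ U) (a : E) :
    extDeriv Ω y ![v y, Complex.I • v y, a] = fderiv ℝ (lamFun v Ω) y a := by
  have h := H.contract_contract_extDeriv (u := v) (w := rot v) (Or.inl rfl) (Or.inr rfl)
    H.smooth_Ω H.inv H.inv_rot hy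
  have h1 := congrArg (fun β : E [⋀^Fin 1]→L[ℝ] ℝ => β ![a]) h
  have hd := contDiffAt_contract (contDiffAt_contract (H.smooth_Ω y hy) (H.smooth_v y hy))
    (H.smooth_vert (Or.inr rfl) hy)
  exact h1.trans (extDeriv_zero_form (hd.differentiableAt (by simp)) (.of_eq lamFun_eq.symm) a)

/-- `ι_{iv} ι_v JdΩ = -dλ ∘ i`: the pair `(v, iv)` is preserved by `J⁻¹` up to a swap and a sign. -/
lemma eta_vert (H : HermData U v Ω) (hy : y ∈ U) (a : E) :
    contract (rot v) (contract v (etaFun Ω)) y ![a] =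
      -fderiv ℝ (lamFun v Ω) y (Complex.I • a) := by
  rw [← H.dΩ_vert hy]
  change extDeriv Ω y (fun i => (-mulI E) (![v y, Complex.I • v y, a] i)) = _
  have h : (fun i => (-mulI E) (![v y, Complex.I • v y, a] i)) =
      fun i => (![-1, 1, -1] i : ℝ) • (![Complex.I • v y, v y, Complex.I • a] i) := by
    ext i
    fin_cases i <;> simp [I_smul_I_smul]
  rw [h]
  have h2 : extDeriv Ω y
        (fun i => (![-1, 1, -1] i : ℝ) • (![Complex.I • v y, v y, Complex.I • a] i))
      = (∏ i, (![-1, 1, -1] i : ℝ)) • extDeriv Ω y ![Complex.I • v y, v y, Complex.I • a] :=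
    (extDeriv Ω y).toContinuousMultilinearMap.map_smul_univ _ _
  have h3 : extDeriv Ω y (![v y, Complex.I • v y, Complex.I • a] ∘ Equiv.swap 0 1) =
      -extDeriv Ω y ![v y, Complex.I • v y, Complex.I • a] :=
    (extDeriv Ω y).map_swap ![v y, Complex.I • v y, Complex.I • a] (by simp)
  have h4 : ![v y, Complex.I • v y, Complex.I • a] ∘ Equiv.swap (0 : Fin 3) 1 =
      ![Complex.I • v y, v y, Complex.I • a] := by
    ext i
    fin_cases i
    · rfl
    · rfl
    · simp [Equiv.swap_apply_of_ne_of_ne]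
  rw [h2, ← h4, h3]
  simp [Fin.prod_univ_three]

/-- `ι_{iv} ι_v d(JdΩ)` is the exterior derivative of `-dλ ∘ i`. -/
lemma deta_vert (H : HermData U v Ω) (hy : y ∈ U) (a b : E) :
    contract (rot v) (contract v (extDeriv (etaFun Ω))) y ![a, b] =
      fderiv ℝ (fderiv ℝ (lamFun v Ω)) y b (Complex.I • a) -
        fderiv ℝ (fderiv ℝ (lamFun v Ω)) y a (Complex.I • b) := by
  rw [H.contract_contract_extDeriv (u := v) (w := rot v) (Or.inl rfl) (Or.inr rfl)
    (fun z hz => H.smooth_eta hz) (fun z hz => H.inv_eta (Or.inl rfl) hz)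
    (fun z hz => H.inv_eta (Or.inr rfl) hz) hy, extDeriv_apply', Fin.sum_univ_two]
  have hd := (contDiffAt_contract (contDiffAt_contract (H.smooth_eta hy) (H.smooth_v y hy))
    (H.smooth_vert (Or.inr rfl) hy)).differentiableAt (by simp)
  have h1 : Fin.removeNth 0 ![a, b] = ![b] := by ext i; fin_cases i; rfl
  have h2 : Fin.removeNth 1 ![a, b] = ![a] := by ext i; fin_cases i; rfl
  have hD : DifferentiableAt ℝ (fderiv ℝ (lamFun v Ω)) y :=
    ((H.smooth_lam hy).fderiv_right (m := 1)
      (by exact (WithTop.coe_le_coe.2 le_top))).differentiableAt (by simp)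
  have key : ∀ c d : E, fderiv ℝ (contract (rot v) (contract v (etaFun Ω))) y d ![c] =
      -fderiv ℝ (fderiv ℝ (lamFun v Ω)) y d (Complex.I • c) := fun c d => by
    rw [← fderiv_apply_const hd]
    have he : (fun z => contract (rot v) (contract v (etaFun Ω)) z ![c]) =ᶠ[𝓝 y]
        fun z => -fderiv ℝ (lamFun v Ω) z (Complex.I • c) :=
      (H.eventually_mem hy).mono fun z hz => H.eta_vert hz c
    rw [he.fderiv_eq, fderiv_fun_neg, fderiv_clm_apply hD (differentiableAt_const _)]
    simp
  simp only [h1, h2, Matrix.cons_val_zero, Matrix.cons_val_one, key]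
  simp
  ring

/-- If `dJdΩ = 0` then `λ` is pluriharmonic. -/
lemma pluriharmonic (H : HermData U v Ω) (hy : y ∈ U) (h : extDeriv (etaFun Ω) y = 0) (e : E) :
    fderiv ℝ (fderiv ℝ (lamFun v Ω)) y e e +
      fderiv ℝ (fderiv ℝ (lamFun v Ω)) y (Complex.I • e) (Complex.I • e) = 0 := by
  have h1 := H.deta_vert hy e (Complex.I • e)
  rw [I_smul_I_smul, map_neg] at h1
  have h2 : contract (rot v) (contract v (extDeriv (etaFun Ω))) y ![e, Complex.I • e] = 0 := by
    change extDeriv (etaFun Ω) y _ = 0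
    rw [h]
    rfl
  linarith

/-- If `λ` is constant then `dJdΩ = 0`: a `4`-form is determined by its double contraction. -/
lemma extDeriv_eta_eq_zero (H : HermData U v Ω) (hE : Module.finrank ℂ E = 2) (hy : y ∈ U)
    {c : ℝ} (hc : ∀ z ∈ U, lamFun v Ω z = c) : extDeriv (etaFun Ω) y = 0 := by
  refine H.eq_zero_of_contract_contract hE hy ?_
  ext w
  have h0 : fderiv ℝ (lamFun v Ω) =ᶠ[𝓝 y] fun _ => 0 := by
    filter_upwards [eventually_eventually_nhds.2 (H.eventually_mem hy)] with z hz
    have : lamFun v Ω =ᶠ[𝓝 z] fun _ => c := hz.mono hc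
    rw [this.fderiv_eq]
    simp
  rw [vec_two w, H.deta_vert hy, h0.fderiv_eq]
  simp

lemma contract_v_Ω (H : HermData U v Ω) (hy : y ∈ U) :
    contract v Ω y = lamFun v Ω y • mu₂ v Ω y := by
  rw [mu₂, smul_smul, mul_inv_cancel₀ (H.lam_pos hy).ne', one_smul]

lemma contract_rot_Ω (H : HermData U v Ω) (hy : y ∈ U) :
    contract (rot v) Ω y = -lamFun v Ω y • mu₁ v Ω y := by
  rw [mu₁, smul_smul, neg_mul_neg, mul_inv_cancel₀ (H.lam_pos hy).ne', one_smul]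

/-- The Lee form: if `λ` is constant, then `dΩ = λ(σ₁μ₂ - σ₂μ₁) ∧ Ω`. -/
lemma dΩ_eq_wedge (H : HermData U v Ω) (hE : Module.finrank ℂ E = 2) (hy : y ∈ U) {c s₁ s₂ : ℝ}
    (hc : ∀ z ∈ U, lamFun v Ω z = c) (h₁ : extDeriv (mu₁ v Ω) y = s₁ • transFun v Ω y)
    (h₂ : extDeriv (mu₂ v Ω) y = s₂ • transFun v Ω y) :
    extDeriv Ω y = wedgeForm (c • (s₁ • mu₂ v Ω y - s₂ • mu₁ v Ω y)) (Ω y) := by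
  rw [← sub_eq_zero]
  have hlam := hc y hy
  have e₁ : contract v (extDeriv Ω) y = -(c • s₂ • transFun v Ω y) := by
    rw [contract_extDeriv_of_invAt (H.diff_Ω hy) (H.diff_vert (Or.inl rfl) hy) (H.inv y hy),
      H.extDeriv_congr_on hy (β := c • mu₂ v Ω) fun z hz => by
        rw [H.contract_v_Ω hz, hc z hz]; rfl]
    rw [extDeriv_smul, h₂]
  have e₂ : contract (rot v) (extDeriv Ω) y = c • s₁ • transFun v Ω y := by
    rw [contract_extDeriv_of_invAt (H.diff_Ω hy) (H.diff_vert (Or.inr rfl) hy) (H.inv_rot y hy),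
      H.extDeriv_congr_on hy (β := (-c) • mu₁ v Ω) fun z hz => by
        rw [H.contract_rot_Ω hz, hc z hz]; rfl]
    rw [extDeriv_smul, h₁, neg_smul, neg_neg]
  have k₁ : ∀ a b, extDeriv Ω y ![v y, a, b] = -(c * (s₂ * transFun v Ω y ![a, b])) := fun a b =>
    congrArg (fun β : E [⋀^Fin 2]→L[ℝ] ℝ => β ![a, b]) e₁
  have k₂ : ∀ a b, extDeriv Ω y ![Complex.I • v y, a, b] = c * (s₁ * transFun v Ω y ![a, b]) :=
    fun a b => congrArg (fun β : E [⋀^Fin 2]→L[ℝ] ℝ => β ![a, b]) e₂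
  have m₁ := fun a => congrArg (fun β : E [⋀^Fin 1]→L[ℝ] ℝ => β ![a]) (H.contract_v_Ω hy)
  have m₂ := fun a => congrArg (fun β : E [⋀^Fin 1]→L[ℝ] ℝ => β ![a]) (H.contract_rot_Ω hy)
  have m₁' : ∀ a, Ω y ![v y, a] = c * mu₂ v Ω y ![a] := fun a => by
    rw [← hlam]; exact m₁ a
  have m₂' : ∀ a, Ω y ![Complex.I • v y, a] = -c * mu₁ v Ω y ![a] := fun a => by
    rw [← hlam]; exact m₂ a
  have hθ : ∀ a, (c • (s₁ • mu₂ v Ω y - s₂ • mu₁ v Ω y)) ![a] =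
      c * (s₁ * mu₂ v Ω y ![a] - s₂ * mu₁ v Ω y ![a]) := fun a => rfl
  obtain ⟨e, he, -, -⟩ := H.exists_horizontal hE hy
  refine eq_zero_of_curryLeft_eq_zero hE he (v := v y) ?_ ?_
  · ext w
    rw [vec_two w]
    change extDeriv Ω y ![v y, w 0, w 1] - wedgeForm _ (Ω y) ![v y, w 0, w 1] = 0
    rw [k₁, wedgeForm_apply_three, m₁', m₁', hθ, hθ, hθ, H.mu₁_v hy, mu₂_v, transFun_apply, hlam]
    ring
  · ext w
    rw [vec_two w]
    change extDeriv Ω y ![Complex.I • v y, w 0, w 1] -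
      wedgeForm _ (Ω y) ![Complex.I • v y, w 0, w 1] = 0
    rw [k₂, wedgeForm_apply_three, m₂', m₂', hθ, hθ, hθ, mu₁_rot, H.mu₂_rot hy, transFun_apply,
      hlam]
    ring

/-- The Lee form is unique: wedging `1`-forms with the fundamental form is injective. -/
lemma wedgeForm_Ω_injective (H : HermData U v Ω) (hE : Module.finrank ℂ E = 2) (hy : y ∈ U)
    {θ θ' : E [⋀^Fin 1]→L[ℝ] ℝ} (h : wedgeForm θ (Ω y) = wedgeForm θ' (Ω y)) : θ = θ' := by
  obtain ⟨e, he, h1, h2⟩ := H.exists_horizontal hE hy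
  obtain ⟨i1, i2⟩ := H.horizontal_I hy h1 h2
  have hl : Ω y ![v y, Complex.I • v y] ≠ 0 := (H.lam_pos hy).ne'
  have hp := (H.pos y hy e (he.ne_zero 1)).ne'
  have key : ∀ a b c, θ ![a] * Ω y ![b, c] - θ ![b] * Ω y ![a, c] + θ ![c] * Ω y ![a, b] =
      θ' ![a] * Ω y ![b, c] - θ' ![b] * Ω y ![a, c] + θ' ![c] * Ω y ![a, b] := fun a b c => by
    rw [← wedgeForm_apply_three, h, wedgeForm_apply_three]
  have t3 : θ ![e] = θ' ![e] := by
    have := key (v y) (Complex.I • v y) e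
    rw [h1, h2] at this
    simpa [hl] using this
  have t4 : θ ![Complex.I • e] = θ' ![Complex.I • e] := by
    have := key (v y) (Complex.I • v y) (Complex.I • e)
    rw [i1, i2] at this
    simpa [hl] using this
  have t1 : θ ![v y] = θ' ![v y] := by
    have := key (v y) e (Complex.I • e)
    rw [h1, i1] at this
    simpa [hp] using this
  have t2 : θ ![Complex.I • v y] = θ' ![Complex.I • v y] := by
    have := key (Complex.I • v y) e (Complex.I • e)
    rw [h2, i2] at this
    simpa [hp] using this
  obtain ⟨b, b1, b2, b3, b4⟩ := exists_basis_real hE he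
  apply (ContinuousAlternatingMap.ofSubsingleton ℝ E ℝ (0 : Fin 1)).symm.injective
  apply ContinuousLinearMap.coe_injective
  refine b.ext ?_
  rintro ⟨i, j⟩
  change (ContinuousAlternatingMap.ofSubsingleton ℝ E ℝ (0 : Fin 1)).symm θ _ =
    (ContinuousAlternatingMap.ofSubsingleton ℝ E ℝ (0 : Fin 1)).symm θ' _
  rw [ofSubsingleton_symm_apply, ofSubsingleton_symm_apply]
  fin_cases i <;> fin_cases j <;> simp [b1, b2, b3, b4, t1, t2, t3, t4]

/-- If the Lee form `θ = c(σ₁μ₂ - σ₂μ₁)` is closed then `σ₁` and `σ₂` have zero derivative, because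
`d(θ(u)) = -ι_u dθ` for `u = v, iv` and `θ(v) = -cσ₂`, `θ(iv) = cσ₁`. -/
lemma fderiv_sigma_eq_zero (H : HermData U v Ω) (hE : Module.finrank ℂ E = 2) {c : ℝ} (hc : c ≠ 0)
    {s₁ s₂ : E → ℝ} (h₁ : ∀ z ∈ U, extDeriv (mu₁ v Ω) z = s₁ z • transFun v Ω z)
    (h₂ : ∀ z ∈ U, extDeriv (mu₂ v Ω) z = s₂ z • transFun v Ω z) (hy : y ∈ U)
    (hd : extDeriv (fun z => c • (s₁ z • mu₂ v Ω z - s₂ z • mu₁ v Ω z)) y = 0) :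
    fderiv ℝ s₁ y = 0 ∧ fderiv ℝ s₂ y = 0 := by
  set θ := fun z => c • (s₁ z • mu₂ v Ω z - s₂ z • mu₁ v Ω z) with hθ
  have S₁ := H.smooth_sigma hE (Or.inl rfl) h₁ hy
  have S₂ := H.smooth_sigma hE (Or.inr rfl) h₂ hy
  have hs : ContDiffAt ℝ ∞ θ y :=
    ContDiffAt.const_smul c ((S₁.smul (H.smooth_mu₂ hy)).sub (S₂.smul (H.smooth_mu₁ hy)))
  have hdif : ∀ {α : E → E [⋀^Fin 1]→L[ℝ] ℝ}, ContDiffAt ℝ ∞ α y → DifferentiableAt ℝ α y :=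
    fun h => h.differentiableAt (by simp)
  have hi : ∀ u, (u = v ∨ u = rot v) → InvAt u θ y := fun u hu =>
    InvAt.smul (differentiableAt_const c) (hdif
      ((S₁.smul (H.smooth_mu₂ hy)).sub (S₂.smul (H.smooth_mu₁ hy)))) (by simp)
      (InvAt.sub (hdif (S₁.smul (H.smooth_mu₂ hy))) (hdif (S₂.smul (H.smooth_mu₁ hy)))
        (InvAt.smul (S₁.differentiableAt (by simp)) (hdif (H.smooth_mu₂ hy))
          (H.fderiv_sigma_vert hE (Or.inl rfl) h₁ hu hy) (H.inv_mu₂ hu hy))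
        (InvAt.smul (S₂.differentiableAt (by simp)) (hdif (H.smooth_mu₁ hy))
          (H.fderiv_sigma_vert hE (Or.inr rfl) h₂ hu hy) (H.inv_mu₁ hu hy)))
  have hk : ∀ u, (u = v ∨ u = rot v) → extDeriv (contract u θ) y = 0 := fun u hu => by
    rw [← neg_eq_zero, ← contract_extDeriv_of_invAt (hdif hs) (H.diff_vert hu hy) (hi u hu)]
    rw [contract, hd]
    rfl
  have hv1 : (fun z => contract v θ z ![]) =ᶠ[𝓝 y] fun z => (-c) * s₂ z :=
    (H.eventually_mem hy).mono fun z hz => by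
      change c * (s₁ z * mu₂ v Ω z ![v z] - s₂ z * mu₁ v Ω z ![v z]) = _
      rw [H.mu₁_v hz, mu₂_v]
      ring
  have hv2 : (fun z => contract (rot v) θ z ![]) =ᶠ[𝓝 y] fun z => c * s₁ z :=
    (H.eventually_mem hy).mono fun z hz => by
      change c * (s₁ z * mu₂ v Ω z ![Complex.I • v z] - s₂ z * mu₁ v Ω z ![Complex.I • v z]) = _
      rw [mu₁_rot, H.mu₂_rot hz]
      ring
  constructor
  · ext a
    have := extDeriv_zero_form (differentiableAt_contract (hdif hs) (H.diff_vert (Or.inr rfl) hy))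
      hv2 a
    rw [hk _ (Or.inr rfl), fderiv_const_mul (S₁.differentiableAt (by simp))] at this
    simpa [hc] using this.symm
  · ext a
    have := extDeriv_zero_form (differentiableAt_contract (hdif hs) (H.diff_vert (Or.inl rfl) hy))
      hv1 a
    rw [hk _ (Or.inl rfl), fderiv_const_mul (S₂.differentiableAt (by simp))] at this
    simpa [hc] using this.symm

/-- The Lee form is closed if `σ₁` and `σ₂` are constant. -/
lemma extDeriv_lee_eq_zero (H : HermData U v Ω) {c s₁ s₂ : ℝ}
    (hy : y ∈ U) (h₁ : extDeriv (mu₁ v Ω) y = s₁ • transFun v Ω y)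
    (h₂ : extDeriv (mu₂ v Ω) y = s₂ • transFun v Ω y) :
    extDeriv (c • (s₁ • mu₂ v Ω + (-s₂) • mu₁ v Ω)) y = 0 := by
  have hdif : ∀ {α : E → E [⋀^Fin 1]→L[ℝ] ℝ}, ContDiffAt ℝ ∞ α y → DifferentiableAt ℝ α y :=
    fun h => h.differentiableAt (by simp)
  rw [extDeriv_smul, extDeriv_add ((hdif (H.smooth_mu₂ hy)).const_smul _)
    ((hdif (H.smooth_mu₁ hy)).const_smul _), extDeriv_smul, extDeriv_smul, h₁, h₂]
  rw [smul_smul, smul_smul, ← add_smul]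
  have : s₁ * s₂ + -s₂ * s₁ = 0 := by ring
  rw [this, zero_smul, smul_zero]

/-- If `λ = c` is constant and `β` is a basic `1`-form, then `d(β ∧ Ω)(v, iv, ·, ·) = c dβ`. -/
lemma contract_d_wedge (H : HermData U v Ω) {β : E → E [⋀^Fin 1]→L[ℝ] ℝ} {c : ℝ}
    (hc : ∀ z ∈ U, lamFun v Ω z = c)
    (hβ : ∀ z ∈ U, ContDiffAt ℝ ∞ β z) (hi : ∀ u, (u = v ∨ u = rot v) → ∀ z ∈ U, InvAt u β z)
    (hh : ∀ u, (u = v ∨ u = rot v) → ∀ z ∈ U, β z ![u z] = 0) (hy : y ∈ U) :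
    contract (rot v) (contract v (extDeriv fun z => wedgeForm (β z) (Ω z))) y =
      c • extDeriv β y := by
  have hinv : ∀ u, (u = v ∨ u = rot v) → ∀ z ∈ U, InvAt u (fun z => wedgeForm (β z) (Ω z)) z :=
    fun u hu z hz => InvAt.wedgeForm_three ((hβ z hz).of_le (by simp))
      ((H.smooth_Ω z hz).of_le (by simp)) (hi u hu z hz) (H.inv_vert hu hz)
  rw [H.contract_contract_extDeriv (u := v) (w := rot v) (Or.inl rfl) (Or.inr rfl)
    (fun z hz => contDiffAt_wedgeForm (hβ z hz) (H.smooth_Ω z hz)) (hinv _ (Or.inl rfl))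
    (hinv _ (Or.inr rfl)) hy, ← extDeriv_smul]
  refine H.extDeriv_congr_on hy fun z hz => ?_
  ext w
  rw [vec_one w]
  change wedgeForm (β z) (Ω z) ![v z, rot v z, w 0] = c * β z ![w 0]
  rw [wedgeForm_apply_three, hh v (Or.inl rfl) z hz, hh (rot v) (Or.inr rfl) z hz, ← hc z hz]
  change _ - _ + _ * lamFun v Ω z = _
  ring

end HermData
end

/-! ### Differential forms in charts -/

section
variable {E : Type*} [NormedAddCommGroup E] [NormedSpace ℂ E]
variable {M : Type*} [TopologicalSpace M] [ChartedSpace E M] {k : ℕ}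

/-- The differential of the inverse chart at `x₀`, meaningful on the target of the chart. -/
noncomputable def chartInvD (x₀ : M) (y : E) :
    E →L[ℝ] TangentSpace 𝓘(ℝ, E) ((extChartAt 𝓘(ℝ, E) x₀).symm y) :=
  mfderiv 𝓘(ℝ, E) 𝓘(ℝ, E) (extChartAt 𝓘(ℝ, E) x₀).symm y

lemma chartRep_apply (x₀ : M) (α : DForm E M k) (y : E) (w : Fin k → E) :
    chartRep x₀ α y w = α ((extChartAt 𝓘(ℝ, E) x₀).symm y) (fun i => chartInvD x₀ y (w i)) := rfl

lemma isOpen_target (x₀ : M) : IsOpen (extChartAt 𝓘(ℝ, E) x₀).target :=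
  isOpen_extChartAt_target x₀

lemma mem_source_symm {x₀ : M} {y : E} (hy : y ∈ (extChartAt 𝓘(ℝ, E) x₀).target) :
    (extChartAt 𝓘(ℝ, E) x₀).symm y ∈ (chartAt E x₀).source := by
  have := (extChartAt 𝓘(ℝ, E) x₀).map_target hy
  rwa [extChartAt_source] at this

lemma chartRep_wedge (θ : DForm E M 1) (α : DForm E M k) (x₀ : M) (y : E) :
    chartRep x₀ (wedge θ α) y = wedgeForm (chartRep x₀ θ y) (chartRep x₀ α y) :=
  wedgeForm_compContinuousLinearMap (E := E) (F := E) (θ ((extChartAt 𝓘(ℝ, E) x₀).symm y))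
    (α ((extChartAt 𝓘(ℝ, E) x₀).symm y)) (chartInvD x₀ y)

lemma SmoothForm.contDiffAt {α : DForm E M k} (hα : SmoothForm α) {x₀ : M} {y : E}
    (hy : y ∈ (extChartAt 𝓘(ℝ, E) x₀).target) : ContDiffAt ℝ ∞ (chartRep x₀ α) y :=
  (hα x₀).contDiffAt ((isOpen_target x₀).mem_nhds hy)

lemma SmoothForm.wedge {θ : DForm E M 1} {α : DForm E M k} (hθ : SmoothForm θ)
    (hα : SmoothForm α) : SmoothForm (wedge θ α) := fun _ =>
  ContDiffOn.congr (fun _ hy => (contDiffAt_wedgeForm (hθ.contDiffAt hy)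
    (hα.contDiffAt hy)).contDiffWithinAt) fun y _ => chartRep_wedge θ α _ y

variable [IsManifold 𝓘(ℂ, E) ω M]

lemma mdifferentiableAt_symm {x₀ : M} {y : E} (hy : y ∈ (extChartAt 𝓘(ℝ, E) x₀).target) :
    MDifferentiableAt 𝓘(ℝ, E) 𝓘(ℝ, E) (extChartAt 𝓘(ℝ, E) x₀).symm y :=
  (((contMDiffOn_extChartAt_symm (n := ∞) x₀).contMDiffAt
    ((isOpen_target x₀).mem_nhds hy))).mdifferentiableAt (by simp)

lemma isInvertible_chartInvD {x₀ : M} {y : E} (hy : y ∈ (extChartAt 𝓘(ℝ, E) x₀).target) :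
    (chartInvD x₀ y).IsInvertible := by
  have h := isInvertible_mfderivWithin_extChartAt_symm (I := 𝓘(ℝ, E)) hy
  rwa [modelWithCornersSelf_coe, Set.range_id, mfderivWithin_univ] at h

/-- The coordinate change between the charts at `x₀` and `x₁`. -/
noncomputable def coordChange (x₀ x₁ : M) : E → E :=
  extChartAt 𝓘(ℝ, E) x₁ ∘ (extChartAt 𝓘(ℝ, E) x₀).symm

lemma contDiffAt_coordChange {x₀ x₁ : M} {y : E} (hy : y ∈ (extChartAt 𝓘(ℝ, E) x₀).target)
    (hy' : (extChartAt 𝓘(ℝ, E) x₀).symm y ∈ (chartAt E x₁).source) :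
    ContDiffAt ℝ ∞ (coordChange x₀ x₁) y := by
  rw [← contMDiffAt_iff_contDiffAt]
  exact (contMDiffAt_extChartAt' (I := 𝓘(ℝ, E)) hy').comp y
    ((contMDiffOn_extChartAt_symm (n := ∞) x₀).contMDiffAt ((isOpen_target x₀).mem_nhds hy))

lemma differentiableAt_coordChange_complex {x₀ x₁ : M} {y : E}
    (hy : y ∈ (extChartAt 𝓘(ℝ, E) x₀).target)
    (hy' : (extChartAt 𝓘(ℝ, E) x₀).symm y ∈ (chartAt E x₁).source) :
    DifferentiableAt ℂ (coordChange x₀ x₁) y := by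
  have h : ContDiffAt ℂ ω (extChartAt 𝓘(ℂ, E) x₁ ∘ (extChartAt 𝓘(ℂ, E) x₀).symm) y := by
    rw [← contMDiffAt_iff_contDiffAt]
    exact (contMDiffAt_extChartAt' (I := 𝓘(ℂ, E)) hy').comp y
      ((contMDiffOn_extChartAt_symm (I := 𝓘(ℂ, E)) (n := ω) x₀).contMDiffAt
        ((isOpen_extChartAt_target (I := 𝓘(ℂ, E)) x₀).mem_nhds hy))
  exact h.differentiableAt (by simp)

lemma fderiv_coordChange_I {x₀ x₁ : M} {y : E} (hy : y ∈ (extChartAt 𝓘(ℝ, E) x₀).target)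
    (hy' : (extChartAt 𝓘(ℝ, E) x₀).symm y ∈ (chartAt E x₁).source) (e : E) :
    fderiv ℝ (coordChange x₀ x₁) y (Complex.I • e) =
      Complex.I • fderiv ℝ (coordChange x₀ x₁) y e := by
  rw [(differentiableAt_coordChange_complex hy hy').fderiv_restrictScalars ℝ]
  simp

lemma fderiv_coordChange {x₀ x₁ : M} {y : E} (hy : y ∈ (extChartAt 𝓘(ℝ, E) x₀).target)
    (hy' : (extChartAt 𝓘(ℝ, E) x₀).symm y ∈ (chartAt E x₁).source) (e : E) :
    fderiv ℝ (coordChange x₀ x₁) y e =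
      mfderiv 𝓘(ℝ, E) 𝓘(ℝ, E) (extChartAt 𝓘(ℝ, E) x₁) ((extChartAt 𝓘(ℝ, E) x₀).symm y)
        (chartInvD x₀ y e) := by
  have h := mfderiv_comp y (mdifferentiableAt_extChartAt (I := 𝓘(ℝ, E)) hy')
    (mdifferentiableAt_symm hy)
  rw [← mfderiv_eq_fderiv]
  exact congrArg (fun L => L e) h

/-- Change of charts for a form. -/
lemma chartRep_eq_coordChange {x₀ x₁ : M} {y : E} (α : DForm E M k)
    (hy : y ∈ (extChartAt 𝓘(ℝ, E) x₀).target)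
    (hy' : (extChartAt 𝓘(ℝ, E) x₀).symm y ∈ (chartAt E x₁).source) :
    chartRep x₀ α y = (chartRep x₁ α (coordChange x₀ x₁ y)).compContinuousLinearMap
      (fderiv ℝ (coordChange x₀ x₁) y) := by
  ext w
  rw [chartRep_apply, apply_eq_chartRep α x₁ hy']
  rw [ContinuousAlternatingMap.compContinuousLinearMap_apply]
  congr 1
  funext i
  exact (fderiv_coordChange hy hy' (w i)).symm

/-- The differential of the inverse chart is complex linear: it is also that of a coordinate change
to the preferred chart at the target point, in which `J` is multiplication by `i`. -/
lemma chartInvD_I {x₀ : M} {y : E} (hy : y ∈ (extChartAt 𝓘(ℝ, E) x₀).target) (e : E) :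
    chartInvD x₀ y (Complex.I • e) = J _ (chartInvD x₀ y e) := by
  have h : chartInvD x₀ y = fderiv ℝ (coordChange x₀ ((extChartAt 𝓘(ℝ, E) x₀).symm y)) y := by
    have h1 := (mdifferentiableAt_symm hy).mfderiv
    rw [chartInvD, h1]
    simp only [mfld_simps, fderivWithin_univ]
    rfl
  rw [h]
  exact fderiv_coordChange_I hy (mem_chart_source _ _) e

lemma form_eq_of_chartRep_eq {x₀ : M} {y : E} {α β : DForm E M k}
    (hy : y ∈ (extChartAt 𝓘(ℝ, E) x₀).target) (h : chartRep x₀ α y = chartRep x₀ β y) :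
    α ((extChartAt 𝓘(ℝ, E) x₀).symm y) = β ((extChartAt 𝓘(ℝ, E) x₀).symm y) := by
  obtain ⟨L, hL⟩ := isInvertible_chartInvD hy
  ext w
  have h1 := congrArg (fun a : E [⋀^Fin k]→L[ℝ] ℝ => a (fun i => L.symm (w i))) h
  simp only [chartRep_apply] at h1
  have h2 : (fun i => chartInvD x₀ y (L.symm (w i))) = w := by
    funext i
    rw [← hL]
    exact L.apply_symm_apply (w i)
  rwa [h2] at h1

lemma apply_eq_of_chartRep_eq {α β : DForm E M k} {x : M}
    (h : chartRep x α (extChartAt 𝓘(ℝ, E) x x) = chartRep x β (extChartAt 𝓘(ℝ, E) x x)) :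
    α x = β x := by
  have := form_eq_of_chartRep_eq (mem_extChartAt_target x) h
  rwa [extChartAt_to_inv] at this

/-- The exterior derivative can be computed in any chart. -/
lemma chartRep_extD {α : DForm E M k} (hα : SmoothForm α) {x₀ : M} {y : E}
    (hy : y ∈ (extChartAt 𝓘(ℝ, E) x₀).target) :
    chartRep x₀ (extD α) y = extDeriv (chartRep x₀ α) y := by
  set p := (extChartAt 𝓘(ℝ, E) x₀).symm y with hp
  have hps : p ∈ (chartAt E p).source := mem_chart_source _ _
  have hev : chartRep x₀ α =ᶠ[𝓝 y] fun z =>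
      (chartRep p α (coordChange x₀ p z)).compContinuousLinearMap
        (fderiv ℝ (coordChange x₀ p) z) := by
    have h1 : ContinuousAt (extChartAt 𝓘(ℝ, E) x₀).symm y := continuousAt_extChartAt_symm'' hy
    filter_upwards [(isOpen_target x₀).mem_nhds hy,
      h1.preimage_mem_nhds ((chartAt E p).open_source.mem_nhds hps)] with z hz hz'
    exact chartRep_eq_coordChange α hz hz'
  rw [hev.extDeriv_eq, extDeriv_pullback (f := coordChange x₀ p) (x := y) (r := ∞)
    (hα.differentiableAt p) (contDiffAt_coordChange hy hps) (by simpa using two_le_infty)]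
  ext w
  change extDeriv (chartRep p α) (coordChange x₀ p y) (fun i => mfderiv 𝓘(ℝ, E) 𝓘(ℝ, E)
    (extChartAt 𝓘(ℝ, E) p) p (chartInvD x₀ y (w i))) =
    extDeriv (chartRep p α) (coordChange x₀ p y) (fun i => fderiv ℝ (coordChange x₀ p) y (w i))
  congr 1
  funext i
  exact (fderiv_coordChange hy hps (w i)).symm

lemma SmoothForm.extD {α : DForm E M k} (hα : SmoothForm α) : SmoothForm (extD α) := fun _ =>
  ContDiffOn.congr (fun _ hy => (contDiffAt_extDeriv (hα.contDiffAt hy)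
    (by simp)).contDiffWithinAt) fun _ hy => chartRep_extD hα hy

lemma chartRep_JForm (α : DForm E M k) {x₀ : M} {y : E}
    (hy : y ∈ (extChartAt 𝓘(ℝ, E) x₀).target) :
    chartRep x₀ (JForm α) y = (chartRep x₀ α y).compContinuousLinearMap (-mulI E) := by
  ext w
  rw [chartRep_apply, JForm, ContinuousAlternatingMap.compContinuousLinearMap_apply,
    ContinuousAlternatingMap.compContinuousLinearMap_apply, chartRep_apply]
  congr 1
  funext i
  simp only [Function.comp_apply, neg_apply, map_neg, mulI_apply]
  rw [chartInvD_I hy]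

lemma SmoothForm.JForm {α : DForm E M k} (hα : SmoothForm α) : SmoothForm (JForm α) := fun _ =>
  ContDiffOn.congr (fun _ hy => (ContDiffAt.comp
    (g := ContinuousAlternatingMap.compContinuousLinearMapCLM (ι := Fin k) (F := ℝ) (-mulI E)) _
    (ContinuousLinearMap.contDiff _).contDiffAt (hα.contDiffAt hy)).contDiffWithinAt)
    fun _ hy => chartRep_JForm α hy

end

/-! ### Vector fields and invariance in charts -/

section
variable {E : Type*} [NormedAddCommGroup E] [NormedSpace ℂ E]
variable {M : Type*} [TopologicalSpace M] [ChartedSpace E M] {k : ℕ}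

/-- The vector field `V` read in the chart at `x₀`, i.e. its pull-back by the inverse of the chart
(meaningful on the target of the chart, where the differential is invertible). -/
noncomputable def fieldRep (x₀ : M) (V : VField E M) (y : E) : E :=
  (chartInvD x₀ y).inverse (V ((extChartAt 𝓘(ℝ, E) x₀).symm y))

variable [IsManifold 𝓘(ℂ, E) ω M]

lemma chartInvD_fieldRep {x₀ : M} {y : E} (hy : y ∈ (extChartAt 𝓘(ℝ, E) x₀).target)
    (V : VField E M) : chartInvD x₀ y (fieldRep x₀ V y) = V ((extChartAt 𝓘(ℝ, E) x₀).symm y) := by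
  obtain ⟨L, hL⟩ := isInvertible_chartInvD hy
  rw [fieldRep, ← hL, ContinuousLinearMap.inverse_equiv]
  exact L.apply_symm_apply _

lemma fieldRep_eq_of {x₀ : M} {y : E} (hy : y ∈ (extChartAt 𝓘(ℝ, E) x₀).target)
    {V : VField E M} {e : E} (h : chartInvD x₀ y e = V ((extChartAt 𝓘(ℝ, E) x₀).symm y)) :
    fieldRep x₀ V y = e := by
  obtain ⟨L, hL⟩ := isInvertible_chartInvD hy
  rw [fieldRep, ← h, ← hL, ContinuousLinearMap.inverse_equiv]
  exact L.symm_apply_apply _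

lemma fieldRep_JField {x₀ : M} {y : E} (hy : y ∈ (extChartAt 𝓘(ℝ, E) x₀).target)
    (V : VField E M) : fieldRep x₀ (JField V) y = Complex.I • fieldRep x₀ V y := by
  apply fieldRep_eq_of hy
  rw [chartInvD_I hy, chartInvD_fieldRep hy]
  rfl

/-- The value `α(X₁, …, Xₖ)` computed in a chart. -/
lemma apply_fields_eq {α : DForm E M k} {X : Fin k → VField E M} {x₀ : M} {y : E}
    (hy : y ∈ (extChartAt 𝓘(ℝ, E) x₀).target) :
    α ((extChartAt 𝓘(ℝ, E) x₀).symm y) (fun i => X i ((extChartAt 𝓘(ℝ, E) x₀).symm y)) =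
      chartRep x₀ α y (fun i => fieldRep x₀ (X i) y) := by
  rw [chartRep_apply]
  congr 1
  funext i
  exact (chartInvD_fieldRep hy (X i)).symm

lemma isInvertible_mfderiv_chart {x₀ q : M} (hq : q ∈ (chartAt E x₀).source) :
    (mfderiv 𝓘(ℝ, E) 𝓘(ℝ, E) (extChartAt 𝓘(ℝ, E) x₀) q).IsInvertible :=
  isInvertible_mfderiv_extChartAt (by rwa [extChartAt_source])

lemma chartInvD_eq_inverse {x₀ : M} {z : E} (hz : z ∈ (extChartAt 𝓘(ℝ, E) x₀).target) (e : E) :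
    chartInvD x₀ z e = (mfderiv 𝓘(ℝ, E) 𝓘(ℝ, E) (extChartAt 𝓘(ℝ, E) x₀)
      ((extChartAt 𝓘(ℝ, E) x₀).symm z)).inverse e := by
  obtain ⟨L, hL⟩ := isInvertible_mfderiv_chart (mem_source_symm hz)
  have h2 := mfderiv_extChartAt_comp_mfderivWithin_extChartAt_symm (I := 𝓘(ℝ, E)) hz
  rw [modelWithCornersSelf_coe, Set.range_id, mfderivWithin_univ] at h2
  rw [← hL, ContinuousLinearMap.inverse_equiv]
  refine (L.eq_symm_apply).2 ((congrArg (fun A => A (chartInvD x₀ z e)) hL).trans ?_)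
  exact congrArg (fun A => A e) h2

lemma fieldDeriv_eq {V : VField E M} {F : M → ℝ} {x₀ : M} {y : E}
    (hy : y ∈ (extChartAt 𝓘(ℝ, E) x₀).target)
    (hF : MDifferentiableAt 𝓘(ℝ, E) 𝓘(ℝ, ℝ) F ((extChartAt 𝓘(ℝ, E) x₀).symm y)) :
    fieldDeriv V F ((extChartAt 𝓘(ℝ, E) x₀).symm y) =
      fderiv ℝ (F ∘ (extChartAt 𝓘(ℝ, E) x₀).symm) y (fieldRep x₀ V y) := by
  have h := mfderiv_comp y hF (mdifferentiableAt_symm hy)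
  rw [mfderiv_eq_fderiv] at h
  have h1 := chartInvD_fieldRep hy V
  rw [h, fieldDeriv]
  exact congrArg _ h1.symm

variable [CompleteSpace E]

lemma contMDiffAt_mpullback {x₀ q : M} (hq : q ∈ (chartAt E x₀).source) {W : E → E}
    (hW : ContDiffAt ℝ ∞ W (extChartAt 𝓘(ℝ, E) x₀ q)) :
    ContMDiffAt 𝓘(ℝ, E) (𝓘(ℝ, E).prod 𝓘(ℝ, E)) ∞ (fun x => (⟨x, mpullback 𝓘(ℝ, E) 𝓘(ℝ, E)
      (extChartAt 𝓘(ℝ, E) x₀) W x⟩ : TangentBundle 𝓘(ℝ, E) M)) q :=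
  ContMDiffAt.mpullback_vectorField_preimage (I := 𝓘(ℝ, E)) (I' := 𝓘(ℝ, E))
      (f := extChartAt 𝓘(ℝ, E) x₀) (x₀ := q) (V := W) (m := ∞) (n := ∞)
      (contMDiffAt_vectorSpace_iff_contDiffAt.2 hW)
      (contMDiffAt_extChartAt' hq) (isInvertible_mfderiv_chart hq) (by simp)

/-- A field is smooth if its representation in the preferred chart at each point is. -/
lemma smoothField_of_fieldRep {V : VField E M}
    (h : ∀ x, ContDiffAt ℝ ∞ (fieldRep x V) (extChartAt 𝓘(ℝ, E) x x)) : SmoothField V := by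
  intro x
  refine (contMDiffAt_mpullback (mem_chart_source E x) (h x)).congr_of_eventuallyEq ?_
  filter_upwards [(chartAt E x).open_source.mem_nhds (mem_chart_source E x)] with q hq
  have hq' : q ∈ (extChartAt 𝓘(ℝ, E) x).source := by rwa [extChartAt_source]
  congr 1
  have hz := (extChartAt 𝓘(ℝ, E) x).map_source hq'
  have h1 := chartInvD_fieldRep hz V
  rw [chartInvD_eq_inverse hz, (extChartAt 𝓘(ℝ, E) x).left_inv hq'] at h1
  exact h1.symm

lemma SmoothField.contDiffAt {V : VField E M} (hV : SmoothField V) {x₀ : M} {y : E}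
    (hy : y ∈ (extChartAt 𝓘(ℝ, E) x₀).target) : ContDiffAt ℝ ∞ (fieldRep x₀ V) y := by
  have hi := isInvertible_mfderivWithin_extChartAt_symm (I := 𝓘(ℝ, E)) hy
  rw [modelWithCornersSelf_coe, Set.range_id, mfderivWithin_univ] at hi
  have h := ContMDiffAt.mpullback_vectorField_preimage (I := 𝓘(ℝ, E)) (I' := 𝓘(ℝ, E))
    (f := (extChartAt 𝓘(ℝ, E) x₀).symm) (x₀ := y) (V := V) (m := ∞) (n := ∞)
    (hV _) ((contMDiffOn_extChartAt_symm (n := ∞) x₀).contMDiffAt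
      ((isOpen_target x₀).mem_nhds hy)) hi (by simp)
  have key : ∀ W : Π x : E, TangentSpace 𝓘(ℝ, E) x,
      ContMDiffAt 𝓘(ℝ, E) 𝓘(ℝ, E).tangent ∞ (fun x => (W x : TangentBundle 𝓘(ℝ, E) E)) y →
      ContDiffAt (E := E) (F := E) ℝ ∞ W y := fun W => contMDiffAt_vectorSpace_iff_contDiffAt.1
  exact key (fieldRep x₀ V) h

lemma fieldRep_mlieBracket {V W : VField E M} (hV : SmoothField V) (hW : SmoothField W) {x₀ : M}
    {y : E} (hy : y ∈ (extChartAt 𝓘(ℝ, E) x₀).target) :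
    fieldRep x₀ (mlieBracket 𝓘(ℝ, E) V W) y =
      lieBracket ℝ (fieldRep x₀ V) (fieldRep x₀ W) y := by
  have : IsManifold 𝓘(ℝ, E) (minSmoothness ℝ 2) M :=
    IsManifold.of_le (n := ∞) (by simpa using two_le_infty)
  have h := mpullback_mlieBracket (I := 𝓘(ℝ, E)) (I' := 𝓘(ℝ, E))
    (f := (extChartAt 𝓘(ℝ, E) x₀).symm) (x₀ := y) (V := V) (W := W) (n := ∞)
    ((hV _).mdifferentiableAt (by simp)) ((hW _).mdifferentiableAt (by simp))
    ((contMDiffOn_extChartAt_symm (n := ∞) x₀).contMDiffAt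
      ((isOpen_target x₀).mem_nhds hy)) (by simpa using two_le_infty)
  have h2 : ∀ A B : Π x : E, TangentSpace 𝓘(ℝ, E) x,
      mlieBracket 𝓘(ℝ, E) A B y = lieBracket ℝ A B y := fun A B => by
    rw [← mlieBracketWithin_univ, mlieBracketWithin_eq_lieBracketWithin]
    exact congrFun (lieBracketWithin_univ (𝕜 := ℝ) (E := E)) y
  exact h.trans (h2 _ _)

/-- A constant vector field in a chart extends to a global vector field. -/
lemma exists_smoothField_eq_const [FiniteDimensional ℝ E] [T2Space M] {x₀ : M} {y : E}
    (hy : y ∈ (extChartAt 𝓘(ℝ, E) x₀).target) (e : E) :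
    ∃ X : VField E M, SmoothField X ∧ fieldRep x₀ X =ᶠ[𝓝 y] fun _ => e := by
  set p := (extChartAt 𝓘(ℝ, E) x₀).symm y with hp
  have hps : p ∈ (chartAt E x₀).source := mem_source_symm hy
  obtain ⟨f, -, hf⟩ := (SmoothBumpFunction.nhds_basis_tsupport (I := 𝓘(ℝ, E)) p).mem_iff.1
    ((chartAt E x₀).open_source.mem_nhds hps)
  set Y : VField E M := mpullback 𝓘(ℝ, E) 𝓘(ℝ, E) (extChartAt 𝓘(ℝ, E) x₀) (fun _ => e)
  have hY : ContMDiffOn 𝓘(ℝ, E) (𝓘(ℝ, E).prod 𝓘(ℝ, E)) ∞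
      (fun x => (⟨x, Y x⟩ : TangentBundle 𝓘(ℝ, E) M)) (chartAt E x₀).source := fun q hq =>
    (contMDiffAt_mpullback hq contDiffAt_const).contMDiffWithinAt
  refine ⟨fun q => f q • Y q, ContMDiffOn.smul_section_of_tsupport (ψ := f) (s := Y)
    f.contMDiff.contMDiffOn (chartAt E x₀).open_source hf hY, ?_⟩
  have h1 : ContinuousAt (extChartAt 𝓘(ℝ, E) x₀).symm y := continuousAt_extChartAt_symm'' hy
  filter_upwards [(isOpen_target x₀).mem_nhds hy, h1.eventually f.eventuallyEq_one] with z hz hz'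
  apply fieldRep_eq_of hz
  simp only [hz', Pi.one_apply, one_smul]
  exact chartInvD_eq_inverse hz e

lemma SmoothField.JField {V : VField E M} (hV : SmoothField V) : SmoothField (JField V) := by
  refine smoothField_of_fieldRep fun x => ?_
  have h : ContDiffAt ℝ ∞ (rot (fieldRep x V)) (extChartAt 𝓘(ℝ, E) x x) :=
    contDiffAt_rot (hV.contDiffAt (mem_extChartAt_target x))
  refine h.congr_of_eventuallyEq ?_
  filter_upwards [(isOpen_target x).mem_nhds (mem_extChartAt_target x)] with z hz
  exact fieldRep_JField hz V

/-- Both sides of the definition of `LieInvariant` differ by the Lie derivative in a chart. -/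
lemma lieInvariant_formula {α : DForm E M k} (hα : SmoothForm α) {V : VField E M}
    (hV : SmoothField V) {X : Fin k → VField E M} (hX : ∀ i, SmoothField (X i)) {x₀ : M} {y : E}
    (hy : y ∈ (extChartAt 𝓘(ℝ, E) x₀).target) :
    fieldDeriv V (fun p => α p (fun i => X i p)) ((extChartAt 𝓘(ℝ, E) x₀).symm y) -
      ∑ i, α ((extChartAt 𝓘(ℝ, E) x₀).symm y) (Function.update
        (fun j => X j ((extChartAt 𝓘(ℝ, E) x₀).symm y)) i
          (mlieBracket 𝓘(ℝ, E) V (X i) ((extChartAt 𝓘(ℝ, E) x₀).symm y))) =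
      lieD (fieldRep x₀ V) (chartRep x₀ α) y (fun i => fieldRep x₀ (X i) y) := by
  rw [fieldDeriv_eq hy (hα.mdifferentiableAt_apply hX _)]
  have hev : ((fun p => α p (fun i => X i p)) ∘ (extChartAt 𝓘(ℝ, E) x₀).symm) =ᶠ[𝓝 y]
      fun z => chartRep x₀ α z (fun i => fieldRep x₀ (X i) z) := by
    filter_upwards [(isOpen_target x₀).mem_nhds hy] with z hz
    exact apply_fields_eq hz
  rw [hev.fderiv_eq, fderiv_continuousAlternatingMap_apply_apply
    ((hα.contDiffAt hy).differentiableAt (by simp))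
    (fun i => ((hX i).contDiffAt hy).differentiableAt (by simp)), lieD, add_sub_assoc,
    ← Finset.sum_sub_distrib]
  congr 1
  refine Finset.sum_congr rfl fun i _ => ?_
  have h1 : α ((extChartAt 𝓘(ℝ, E) x₀).symm y) (Function.update
        (fun j => X j ((extChartAt 𝓘(ℝ, E) x₀).symm y)) i
          (mlieBracket 𝓘(ℝ, E) V (X i) ((extChartAt 𝓘(ℝ, E) x₀).symm y))) =
      chartRep x₀ α y (Function.update (fun j => fieldRep x₀ (X j) y) i
        (lieBracket ℝ (fieldRep x₀ V) (fieldRep x₀ (X i)) y)) := by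
    rw [chartRep_apply, ← fieldRep_mlieBracket hV (hX i) hy]
    congr 1
    funext j
    by_cases hj : j = i
    · subst hj
      simp only [Function.update_self]
      exact (chartInvD_fieldRep hy _).symm
    · simp only [Function.update_of_ne hj]
      exact (chartInvD_fieldRep hy _).symm
  rw [h1, lieBracket, ContinuousAlternatingMap.map_update_sub]
  ring

/-- A `V`-invariant form is invariant in charts: `LieInvariant` is tested on global fields extending
constant vectors. -/
lemma invAt_of_lieInvariant [FiniteDimensional ℝ E] [T2Space M] {α : DForm E M k}
    (hα : SmoothForm α) {V : VField E M}
    (hV : SmoothField V) (h : LieInvariant V (fun x v => α x v)) {x₀ : M} {y : E}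
    (hy : y ∈ (extChartAt 𝓘(ℝ, E) x₀).target) : InvAt (fieldRep x₀ V) (chartRep x₀ α) y := by
  intro w
  choose X hX hXw using fun i => exists_smoothField_eq_const hy (w i)
  have h1 := lieInvariant_formula hα hV hX hy
  rw [h X hX, sub_self] at h1
  have h2 : (fun i => fieldRep x₀ (X i) y) = w := funext fun i => (hXw i).eq_of_nhds
  rw [h2] at h1
  exact h1.symm

lemma lieInvariant_of_invAt {α : DForm E M k} (hα : SmoothForm α) {V : VField E M}
    (hV : SmoothField V)
    (h : ∀ x₀ : M, ∀ y ∈ (extChartAt 𝓘(ℝ, E) x₀).target, InvAt (fieldRep x₀ V) (chartRep x₀ α) y) :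
    LieInvariant V (fun x v => α x v) := by
  intro X hX x
  have h1 := lieInvariant_formula hα hV hX (mem_extChartAt_target (I := 𝓘(ℝ, E)) x)
  rw [h x _ (mem_extChartAt_target x), extChartAt_to_inv, sub_eq_zero] at h1
  exact h1

/-- A vector field with `ℒ_V J = 0` is holomorphic in charts. -/
lemma fderiv_fieldRep_I [FiniteDimensional ℝ E] [T2Space M] {V : VField E M} (hV : SmoothField V)
    (h : ∀ X : VField E M, SmoothField X →
      mlieBracket 𝓘(ℝ, E) V (JField X) = JField (mlieBracket 𝓘(ℝ, E) V X)) {x₀ : M} {y : E}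
    (hy : y ∈ (extChartAt 𝓘(ℝ, E) x₀).target) (e : E) :
    fderiv ℝ (fieldRep x₀ V) y (Complex.I • e) = Complex.I • fderiv ℝ (fieldRep x₀ V) y e := by
  obtain ⟨X, hX, hXe⟩ := exists_smoothField_eq_const hy e
  have h1 := congrArg (fun W => fieldRep x₀ W y) (h X hX)
  simp only [fieldRep_JField hy, fieldRep_mlieBracket hV hX hy,
    fieldRep_mlieBracket hV hX.JField hy, lieBracket] at h1
  have h2 : fieldRep x₀ (JField X) =ᶠ[𝓝 y] fun _ => Complex.I • e := by
    filter_upwards [hXe, (isOpen_target x₀).mem_nhds hy] with z hz hz'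
    rw [fieldRep_JField hz', hz]
  rw [hXe.fderiv_eq, h2.fderiv_eq, hXe.eq_of_nhds] at h1
  simpa using h1

end

/-! ### Smoothness and invariance of the fundamental form -/

section

variable {E : Type*} [NormedAddCommGroup E] [NormedSpace ℝ E] {n : ℕ}

lemma InvAt.congr {v v' : E → E} {α α' : E → E [⋀^Fin n]→L[ℝ] ℝ} {y : E} (h : InvAt v α y)
    (hv : v =ᶠ[𝓝 y] v') (hα : α =ᶠ[𝓝 y] α') : InvAt v' α' y := fun w => by
  rw [lieD, ← hv.fderiv_eq, ← hα.fderiv_eq, ← hv.eq_of_nhds, ← hα.eq_of_nhds]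
  exact h w

lemma InvAt.linear_comb {u v : E → E} {α : E → E [⋀^Fin n]→L[ℝ] ℝ} {y : E}
    (hu : DifferentiableAt ℝ u y) (hv : DifferentiableAt ℝ v y) (iu : InvAt u α y)
    (iv : InvAt v α y) (a b : ℝ) : InvAt (fun z => a • u z + b • v z) α y := fun w => by
  have h1 := iu w
  have h2 := iv w
  rw [lieD] at h1 h2 ⊢
  have h : fderiv ℝ (fun z => a • u z + b • v z) y = a • fderiv ℝ u y + b • fderiv ℝ v y :=
    ((hu.hasFDerivAt.const_smul a).add (hv.hasFDerivAt.const_smul b)).fderiv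
  simp only [h, map_add, map_smul, add_apply, smul_apply, ContinuousAlternatingMap.add_apply,
    ContinuousAlternatingMap.smul_apply, ContinuousAlternatingMap.map_update_add,
    ContinuousAlternatingMap.map_update_smul, Finset.sum_add_distrib, ← Finset.smul_sum]
  linear_combination (exp := 1) a * h1 + b * h2

/-- In finite dimensions, a form whose values on constant vectors are smooth is smooth. -/
lemma contDiffAt_form_of_apply [FiniteDimensional ℝ E] {α : E → E [⋀^Fin n]→L[ℝ] ℝ} {y : E}
    {r : WithTop ℕ∞} (h : ∀ w : Fin n → E, ContDiffAt ℝ r (fun z => α z w) y) :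
    ContDiffAt ℝ r α y := by
  let bs := Module.finBasis ℝ E
  let L : (E [⋀^Fin n]→L[ℝ] ℝ) →ₗ[ℝ] ((Fin n → Fin (Module.finrank ℝ E)) → ℝ) :=
    { toFun := fun β s => β (fun i => bs (s i))
      map_add' := fun _ _ => rfl
      map_smul' := fun _ _ => rfl }
  have hL : LinearMap.ker L = ⊥ := by
    refine LinearMap.ker_eq_bot'.2 fun β hβ => ?_
    apply ContinuousAlternatingMap.toAlternatingMap_injective
    exact Module.Basis.ext_alternating bs fun s _ => congrFun hβ s
  obtain ⟨R, hR⟩ := L.exists_leftInverse_of_injective hL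
  have h1 : ContDiffAt ℝ r (fun z => L (α z)) y := contDiffAt_pi.2 fun s => h _
  have h2 := (LinearMap.toContinuousLinearMap R).contDiff.contDiffAt.comp y h1
  refine h2.congr_of_eventuallyEq (.of_forall fun z => ?_)
  exact (congrArg (fun A => A (α z)) hR).symm

end

namespace HermitianMetric

variable {E : Type*} [NormedAddCommGroup E] [NormedSpace ℂ E]
variable {M : Type*} [TopologicalSpace M] [ChartedSpace E M] [IsManifold 𝓘(ℂ, E) ω M]
variable (g : HermitianMetric E M)

lemma fundForm_apply (x : M) (w : Fin 2 → TangentSpace 𝓘(ℝ, E) x) :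
    g.fundForm x w = g.inner x (J x (w 0)) (w 1) := rfl

lemma inner_J_left (x : M) (a c : TangentSpace 𝓘(ℝ, E) x) :
    g.inner x (J x a) c = -g.inner x a (J x c) := by
  have h := g.hermitian x a (J x c)
  rw [J_J, map_neg] at h
  linarith

lemma inner_J_self (x : M) (a : TangentSpace 𝓘(ℝ, E) x) : g.inner x (J x a) a = 0 := by
  have h := g.inner_J_left x a a
  rw [g.symm x a] at h
  linarith

lemma contMDiffAt_inner {X Y : VField E M} {q : M}
    (hX : ContMDiffAt 𝓘(ℝ, E) (𝓘(ℝ, E).prod 𝓘(ℝ, E)) ∞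
      (fun x => (⟨x, X x⟩ : TangentBundle 𝓘(ℝ, E) M)) q)
    (hY : ContMDiffAt 𝓘(ℝ, E) (𝓘(ℝ, E).prod 𝓘(ℝ, E)) ∞
      (fun x => (⟨x, Y x⟩ : TangentBundle 𝓘(ℝ, E) M)) q) :
    ContMDiffAt 𝓘(ℝ, E) 𝓘(ℝ, ℝ) ∞ (fun x => g.inner x (X x) (Y x)) q := by
  have : ContMDiffAt 𝓘(ℝ, E) (𝓘(ℝ, E).prod 𝓘(ℝ)) ∞
      (fun m ↦ Bundle.TotalSpace.mk' ℝ (E := Bundle.Trivial M ℝ) m (g.inner m (X m) (Y m))) q := by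
    apply ContMDiffAt.clm_bundle_apply₂ (F₁ := E) (F₂ := E)
    · exact g.contMDiff.contMDiffAt
    · exact hX
    · exact hY
  rw [Bundle.contMDiffAt_totalSpace] at this
  exact this.2

lemma smoothForm_fundForm [FiniteDimensional ℝ E] [CompleteSpace E] : SmoothForm g.fundForm := by
  intro x₀ y hy
  refine (contDiffAt_form_of_apply fun w => ?_).contDiffWithinAt
  have hq := mem_source_symm hy
  have h := g.contMDiffAt_inner (contMDiffAt_mpullback hq contDiffAt_const)
    (contMDiffAt_mpullback hq contDiffAt_const) (X := mpullback 𝓘(ℝ, E) 𝓘(ℝ, E)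
      (extChartAt 𝓘(ℝ, E) x₀) (fun _ => Complex.I • w 0)) (Y := mpullback 𝓘(ℝ, E) 𝓘(ℝ, E)
      (extChartAt 𝓘(ℝ, E) x₀) (fun _ => w 1))
  have h2 := (h.comp y ((contMDiffOn_extChartAt_symm (n := ∞) x₀).contMDiffAt
      ((isOpen_target x₀).mem_nhds hy)))
  rw [contMDiffAt_iff_contDiffAt] at h2
  refine h2.congr_of_eventuallyEq ?_
  filter_upwards [(isOpen_target x₀).mem_nhds hy] with z hz
  have e1 := chartInvD_eq_inverse hz (Complex.I • w 0)
  have e2 := chartInvD_eq_inverse hz (w 1)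
  rw [chartInvD_I hz] at e1
  rw [chartRep_apply, fundForm_apply, e1, e2]
  rfl

variable {g} {𝔱 : Submodule ℝ (VField E M)}

/-- `ℒ_V g = 0` and `ℒ_V J = 0` give `ℒ_V ω = 0`. -/
lemma IsInvariant.fundForm (hg : g.IsInvariant 𝔱) (h𝔱 : IsFreeAbelianHolomorphic 𝔱)
    [FiniteDimensional ℝ E] [CompleteSpace E] {V : VField E M} (hV : V ∈ 𝔱) :
    LieInvariant V (fun x v => g.fundForm x v) := by
  intro X hX x
  have h := hg V hV ![JField (X 0), X 1] (fun i => by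
    fin_cases i
    exacts [(hX 0).JField, hX 1]) x
  rw [Fin.sum_univ_two] at h ⊢
  refine h.trans ?_
  simp only [fundForm_apply, Matrix.cons_val_zero, h𝔱.preserves_J V hV _ (hX 0)]
  simp [JField]

end HermitianMetric

/-! ### From the invariant metric to the local model -/

namespace HermitianMetric

variable {E : Type*} [NormedAddCommGroup E] [NormedSpace ℂ E]
variable {M : Type*} [TopologicalSpace M] [ChartedSpace E M]
variable {𝔱 : Submodule ℝ (VField E M)} {b : Module.Basis (Fin 2) ℝ 𝔱}

lemma basis_one (hb : (b 1).1 = JField (b 0).1) (x : M) : (b 1).1 x = J x ((b 0).1 x) :=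
  congrFun hb x

variable [IsManifold 𝓘(ℂ, E) ω M] {g : HermitianMetric E M}

lemma lam_eq (hb : (b 1).1 = JField (b 0).1) (x : M) :
    g.lam b x = g.inner x ((b 0).1 x) ((b 0).1 x) := by
  rw [lam, basis_one hb, g.hermitian]

lemma lam_pos (h𝔱 : IsFreeAbelianHolomorphic 𝔱) (hb : (b 1).1 = JField (b 0).1) (x : M) :
    0 < g.lam b x := by
  rw [lam_eq hb]
  exact g.inner_basis_pos h𝔱 b 0 x

lemma conn_zero_apply (hb : (b 1).1 = JField (b 0).1) (x : M)
    (a : Fin 1 → TangentSpace 𝓘(ℝ, E) x) :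
    g.conn b 0 x a = (g.lam b x)⁻¹ * g.inner x ((b 0).1 x) (a 0) := by
  rw [conn_apply, lam_eq hb]

lemma conn_one_apply (hb : (b 1).1 = JField (b 0).1) (x : M)
    (a : Fin 1 → TangentSpace 𝓘(ℝ, E) x) :
    g.conn b 1 x a = (g.lam b x)⁻¹ * g.inner x (J x ((b 0).1 x)) (a 0) := by
  rw [conn_apply, lam_eq hb, basis_one hb, g.hermitian]

lemma horProj_apply (x : M) (a : TangentSpace 𝓘(ℝ, E) x) :
    g.horProj b x a = a - (g.conn b 0 x (fun _ => a) • (b 0).1 x +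
      g.conn b 1 x (fun _ => a) • (b 1).1 x) := by
  rw [horProj, Fin.sum_univ_two]
  rfl

/-- `ω̌ = ω - λ μ₁ ∧ μ₂`. -/
lemma transForm_apply (h𝔱 : IsFreeAbelianHolomorphic 𝔱) (hb : (b 1).1 = JField (b 0).1) (x : M)
    (w : Fin 2 → TangentSpace 𝓘(ℝ, E) x) :
    g.transForm b x w = g.fundForm x w - g.lam b x *
      (g.conn b 0 x (fun _ => w 0) * g.conn b 1 x (fun _ => w 1) -
        g.conn b 0 x (fun _ => w 1) * g.conn b 1 x (fun _ => w 0)) := by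
  change g.inner x (J x (g.horProj b x (w 0))) (g.horProj b x (w 1)) = _
  have hl := (lam_pos (g := g) h𝔱 hb x).ne'
  rw [horProj_apply, horProj_apply, fundForm_apply, conn_zero_apply hb, conn_one_apply hb,
    conn_zero_apply hb, conn_one_apply hb, basis_one hb]
  generalize w 0 = a
  generalize w 1 = c
  have hu := lam_eq (g := g) hb x
  generalize (b 0).1 x = u at *
  have h1 : g.inner x u (J x u) = 0 := by rw [g.symm, inner_J_self]
  have h2 : g.inner x (J x u) (J x u) = g.lam b x := by rw [g.hermitian, hu]
  have h3 : g.inner x (J x a) u = - g.inner x (J x u) a := by rw [inner_J_left, g.symm]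
  have h4 : g.inner x (J x a) (J x u) = g.inner x u a := by rw [g.hermitian, g.symm]
  simp only [map_sub, map_add, map_smul, J_J, sub_apply, add_apply, smul_apply, smul_eq_mul,
    neg_apply, map_neg, h1, h2, ← hu, h3, h4, inner_J_self]
  field_simp
  ring

lemma fieldRep_basis_one (hb : (b 1).1 = JField (b 0).1) {x₀ : M} {y : E}
    (hy : y ∈ (extChartAt 𝓘(ℝ, E) x₀).target) :
    fieldRep x₀ (b 1).1 y = rot (fieldRep x₀ (b 0).1) y := by
  rw [hb]
  exact fieldRep_JField hy _

/-- The elements of `𝔱` are the real combinations of `V₁` and `JV₁`. -/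
lemma fieldRep_eq_comb (hb : (b 1).1 = JField (b 0).1) {V : VField E M} (hV : V ∈ 𝔱) :
    ∃ c d : ℝ, ∀ x₀ : M, ∀ y ∈ (extChartAt 𝓘(ℝ, E) x₀).target,
      fieldRep x₀ V y = c • fieldRep x₀ (b 0).1 y + d • rot (fieldRep x₀ (b 0).1) y := by
  refine ⟨b.repr ⟨V, hV⟩ 0, b.repr ⟨V, hV⟩ 1, fun x₀ y hy => ?_⟩
  have hV' := congrArg Subtype.val (b.sum_repr ⟨V, hV⟩)
  rw [Fin.sum_univ_two] at hV'
  apply fieldRep_eq_of hy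
  rw [map_add, map_smul, map_smul, chartInvD_fieldRep hy, ← fieldRep_basis_one hb hy,
    chartInvD_fieldRep hy]
  exact congrFun hV' _

lemma lam_symm (hb : (b 1).1 = JField (b 0).1) {x₀ : M} {y : E}
    (hy : y ∈ (extChartAt 𝓘(ℝ, E) x₀).target) :
    g.lam b ((extChartAt 𝓘(ℝ, E) x₀).symm y) =
      lamFun (fieldRep x₀ (b 0).1) (chartRep x₀ g.fundForm) y := by
  rw [lamFun, chartRep_apply, fundForm_apply, lam]
  simp only [Matrix.cons_val_zero, Matrix.cons_val_one, chartInvD_I hy, chartInvD_fieldRep hy,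
    basis_one hb]

lemma chartRep_conn_zero (hb : (b 1).1 = JField (b 0).1) {x₀ : M} {y : E}
    (hy : y ∈ (extChartAt 𝓘(ℝ, E) x₀).target) : chartRep x₀ (g.conn b 0) y =
      mu₁ (fieldRep x₀ (b 0).1) (chartRep x₀ g.fundForm) y := by
  ext w
  rw [vec_one w, HermData.mu₁_apply, ← lam_symm hb hy, chartRep_apply, conn_zero_apply hb,
    chartRep_apply, fundForm_apply]
  simp only [Matrix.cons_val_zero, Matrix.cons_val_one, chartInvD_I hy, chartInvD_fieldRep hy, J_J,
    map_neg, neg_apply]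
  ring

lemma chartRep_conn_one (hb : (b 1).1 = JField (b 0).1) {x₀ : M} {y : E}
    (hy : y ∈ (extChartAt 𝓘(ℝ, E) x₀).target) : chartRep x₀ (g.conn b 1) y =
      mu₂ (fieldRep x₀ (b 0).1) (chartRep x₀ g.fundForm) y := by
  ext w
  rw [vec_one w, HermData.mu₂_apply, ← lam_symm hb hy, chartRep_apply, conn_one_apply hb,
    chartRep_apply, fundForm_apply]
  simp only [Matrix.cons_val_zero, Matrix.cons_val_one, chartInvD_fieldRep hy]

lemma chartRep_transForm (h𝔱 : IsFreeAbelianHolomorphic 𝔱) (hb : (b 1).1 = JField (b 0).1) {x₀ : M}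
    {y : E} (hy : y ∈ (extChartAt 𝓘(ℝ, E) x₀).target) : chartRep x₀ (g.transForm b) y =
      transFun (fieldRep x₀ (b 0).1) (chartRep x₀ g.fundForm) y := by
  ext w
  rw [vec_two w, HermData.transFun_apply, ← chartRep_conn_zero hb hy, ← chartRep_conn_one hb hy,
    ← lam_symm hb hy, chartRep_apply, transForm_apply h𝔱 hb]
  simp only [chartRep_apply, conn_zero_apply hb, conn_one_apply hb, Matrix.cons_val_zero,
    Matrix.cons_val_one, Matrix.cons_val_fin_one]

variable [FiniteDimensional ℝ E] [T2Space M]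

/-- In a chart, a `𝔱`-invariant Hermitian metric is given by local data. -/
lemma hermData (h𝔱 : IsFreeAbelianHolomorphic 𝔱) (hb : (b 1).1 = JField (b 0).1)
    (hg : g.IsInvariant 𝔱) (x₀ : M) :
    HermData (extChartAt 𝓘(ℝ, E) x₀).target (fieldRep x₀ (b 0).1) (chartRep x₀ g.fundForm) := by
  have : CompleteSpace E := FiniteDimensional.complete ℝ E
  have hs := fun i => h𝔱.smooth _ (b i).2
  refine ⟨isOpen_target x₀, fun y hy => (hs 0).contDiffAt hy,
    fun y hy => g.smoothForm_fundForm.contDiffAt hy, fun y hy h0 => ?_,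
    fun y hy e => fderiv_fieldRep_I (hs 0) (h𝔱.preserves_J _ (b 0).2) hy e,
    fun y hy => invAt_of_lieInvariant g.smoothForm_fundForm (hs 0) (hg.fundForm h𝔱 (b 0).2) hy,
    fun y hy => ?_, fun y hy a c => ?_, fun y hy a ha => ?_⟩
  · have h1 := chartInvD_fieldRep hy (b 0).1
    rw [h0, map_zero] at h1
    exact b.ne_zero 0 (Subtype.ext (h𝔱.free _ (b 0).2 _ h1.symm))
  · refine (invAt_of_lieInvariant g.smoothForm_fundForm (hs 1)
      (hg.fundForm h𝔱 (b 1).2) hy).congr ?_ .rfl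
    filter_upwards [(isOpen_target x₀).mem_nhds hy] with z hz
    exact fieldRep_basis_one hb hz
  · simp only [chartRep_apply, fundForm_apply, Matrix.cons_val_zero, Matrix.cons_val_one,
      chartInvD_I hy, g.hermitian]
  · simp only [chartRep_apply, fundForm_apply, Matrix.cons_val_zero, Matrix.cons_val_one,
      chartInvD_I hy, g.hermitian]
    refine g.pos _ _ fun h0 => ha ?_
    obtain ⟨L, hL⟩ := isInvertible_chartInvD hy
    rw [← hL] at h0
    exact L.map_eq_zero_iff.1 h0

end HermitianMetric

/-! ### The maximum principle for pluriharmonic functions -/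

section
variable {E : Type*} [NormedAddCommGroup E] [NormedSpace ℂ E]

/-- The restriction of a pluriharmonic function to a complex line is harmonic. -/
lemma harmonicAt_complex_line {f : E → ℝ} {U : Set E} (hU : IsOpen U)
    (hf : ∀ z ∈ U, ContDiffAt ℝ 2 f z)
    (hp : ∀ z ∈ U, ∀ e, fderiv ℝ (fderiv ℝ f) z e e +
      fderiv ℝ (fderiv ℝ f) z (Complex.I • e) (Complex.I • e) = 0) (y a : E) {s : ℂ}
    (hs : y + s • a ∈ U) : InnerProductSpace.HarmonicAt (fun s : ℂ => f (y + s • a)) s := by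
  set D : ℂ →L[ℝ] E := (ContinuousLinearMap.toSpanSingleton ℂ a).restrictScalars ℝ with hD
  have hψ : ∀ s : ℂ, HasFDerivAt (fun s : ℂ => y + s • a) D s := fun s =>
    D.hasFDerivAt.const_add y
  have hψc : ContDiff ℝ 2 (fun s : ℂ => y + s • a) := contDiff_const.add D.contDiff
  have hev : ∀ {s : ℂ}, y + s • a ∈ U → ∀ᶠ t : ℂ in 𝓝 s, y + t • a ∈ U := fun hs =>
    hψc.continuous.continuousAt.eventually (hU.mem_nhds hs)
  have h1 : ∀ t : ℂ, y + t • a ∈ U → fderiv ℝ (fun s : ℂ => f (y + s • a)) t =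
      (fderiv ℝ f (y + t • a)).comp D := fun t ht =>
    ((((hf _ ht).differentiableAt (by simp)).hasFDerivAt).comp t (hψ t)).fderiv
  have h2 : ∀ t : ℂ, y + t • a ∈ U → ∀ c d : ℂ,
      fderiv ℝ (fderiv ℝ (fun s : ℂ => f (y + s • a))) t c d =
        fderiv ℝ (fderiv ℝ f) (y + t • a) (D c) (D d) := fun t ht c d => by
    have h3 : fderiv ℝ (fun s : ℂ => f (y + s • a)) =ᶠ[𝓝 t]
        fun t => (fderiv ℝ f (y + t • a)).comp D := (hev ht).mono h1
    have h4 : DifferentiableAt ℝ (fderiv ℝ f) (y + t • a) :=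
      ((hf _ ht).fderiv_right (m := 1) (by norm_num)).differentiableAt (by simp)
    have h5 : HasFDerivAt (fun t : ℂ => fderiv ℝ f (y + t • a))
      ((fderiv ℝ (fderiv ℝ f) (y + t • a)).comp D) t := h4.hasFDerivAt.comp t (hψ t)
    rw [h3.fderiv_eq, (h5.clm_comp (hasFDerivAt_const D t)).fderiv]
    simp
  refine ⟨(hf _ hs).comp s hψc.contDiffAt, (hev hs).mono fun t ht => ?_⟩
  have hDa : D 1 = a := by simp [hD]
  have hDi : D Complex.I = Complex.I • a := by simp [hD]
  rw [InnerProductSpace.laplacian_eq_iteratedFDeriv_complexPlane]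
  simp only [iteratedFDeriv_two_apply, Matrix.cons_val_zero, Matrix.cons_val_one, h2 t ht, hDa, hDi]
  exact hp _ ht a

/-- The maximum principle for pluriharmonic functions: on a complex line through the maximum point,
`f` is the real part of a holomorphic `F`, and `‖exp F‖ = exp f` has an interior maximum. -/
lemma eventually_eq_of_isLocalMax_pluriharmonic {f : E → ℝ} {U : Set E} (hU : IsOpen U)
    (hf : ∀ z ∈ U, ContDiffAt ℝ 2 f z)
    (hp : ∀ z ∈ U, ∀ e, fderiv ℝ (fderiv ℝ f) z e e +
      fderiv ℝ (fderiv ℝ f) z (Complex.I • e) (Complex.I • e) = 0) {y : E} (hy : y ∈ U)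
    (hmax : ∀ z ∈ U, f z ≤ f y) : ∀ᶠ w in 𝓝 y, f w = f y := by
  obtain ⟨r, hr, hrU⟩ := Metric.isOpen_iff.1 hU y hy
  -- halving the radius keeps the disc of radius `2` on the line through `y` and `w` inside `U`
  filter_upwards [Metric.ball_mem_nhds y (half_pos hr)] with w hw
  have hmem : ∀ s ∈ Metric.ball (0 : ℂ) 2, y + s • (w - y) ∈ U := fun s hs => by
    apply hrU
    rw [mem_ball_iff_norm] at hw hs ⊢
    rw [add_sub_cancel_left, norm_smul]
    rw [sub_zero] at hs
    nlinarith [norm_nonneg s, norm_nonneg (w - y)]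
  obtain ⟨F, hF, hre⟩ := InnerProductSpace.HarmonicOnNhd.exists_analyticOnNhd_ball_re_eq
    (f := fun s : ℂ => f (y + s • (w - y))) (z := 0) (R := 2)
    fun s hs => harmonicAt_complex_line hU hf hp y (w - y) (hmem s hs)
  have hnorm : ∀ s ∈ Metric.ball (0 : ℂ) 2,
      ‖Complex.exp (F s)‖ = Real.exp (f (y + s • (w - y))) := fun s hs => by
    rw [Complex.norm_exp]
    exact congrArg Real.exp (hre hs)
  have h0 : (0 : ℂ) ∈ Metric.ball (0 : ℂ) 2 := by simp
  have h1 : (1 : ℂ) ∈ Metric.ball (0 : ℂ) 2 := by simp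
  have h := Complex.norm_eqOn_of_isPreconnected_of_isMaxOn (f := fun s => Complex.exp (F s))
    (convex_ball (0 : ℂ) 2).isPreconnected Metric.isOpen_ball
    (fun s hs => ((hF s hs).differentiableAt.cexp).differentiableWithinAt) h0
    (fun s hs => by
      simp only [Set.mem_ofPred_eq, Function.comp_apply, hnorm s hs, hnorm 0 h0]
      rw [Real.exp_le_exp, zero_smul, add_zero]
      exact hmax _ (hmem s hs)) h1
  simp only [Function.comp_apply, Function.const_apply, hnorm 0 h0, hnorm 1 h1] at h
  simpa using Real.exp_injective h

end

/-! ### Curvature functions, pluriclosed metrics and the Lee form -/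

section
variable {E : Type*} [NormedAddCommGroup E] [NormedSpace ℂ E]

lemma eventually_eq_of_fderiv_eq_zero {f : E → ℝ} {U : Set E} (hU : IsOpen U) {y : E} (hy : y ∈ U)
    (hf : ∀ z ∈ U, DifferentiableAt ℝ f z) (h : ∀ z ∈ U, fderiv ℝ f z = 0) :
    ∀ᶠ w in 𝓝 y, f w = f y := by
  obtain ⟨r, hr, hrU⟩ := Metric.isOpen_iff.1 hU y hy
  filter_upwards [Metric.ball_mem_nhds y hr] with w hw
  exact Metric.isOpen_ball.is_const_of_fderiv_eq_zero (convex_ball y r).isPreconnected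
    (fun z hz => (hf z (hrU hz)).differentiableWithinAt) (fun z hz => h z (hrU hz)) hw
    (Metric.mem_ball_self hr)

variable {M : Type*} [TopologicalSpace M] [ChartedSpace E M]

/-- A function which is locally constant in charts is constant. -/
lemma exists_eq_const_of_chart [PreconnectedSpace M] [Nonempty M] {f : M → ℝ}
    (h : ∀ x : M, ∀ᶠ y in 𝓝 (extChartAt 𝓘(ℝ, E) x x), f ((extChartAt 𝓘(ℝ, E) x).symm y) = f x) :
    ∃ c, ∀ x, f x = c := by
  have hl : IsLocallyConstant f := by
    refine (IsLocallyConstant.iff_eventually_eq f).2 fun x => ?_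
    filter_upwards [(continuousAt_extChartAt (I := 𝓘(ℝ, E)) x).eventually (h x),
      (chartAt E x).open_source.mem_nhds (mem_chart_source E x)] with q hq hq'
    rwa [(extChartAt 𝓘(ℝ, E) x).left_inv (by rwa [extChartAt_source])] at hq
  obtain ⟨x⟩ := ‹Nonempty M›
  exact ⟨f x, fun z => hl.apply_eq_of_preconnectedSpace z x⟩

lemma extDeriv_chartRep_congr {k : ℕ} {α : DForm E M k} {x₀ : M} {y : E}
    {A : E → E [⋀^Fin k]→L[ℝ] ℝ} (hy : y ∈ (extChartAt 𝓘(ℝ, E) x₀).target)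
    (h : ∀ z ∈ (extChartAt 𝓘(ℝ, E) x₀).target, chartRep x₀ α z = A z) :
    extDeriv (chartRep x₀ α) y = extDeriv A y := by
  apply Filter.EventuallyEq.extDeriv_eq
  filter_upwards [(isOpen_target x₀).mem_nhds hy] with z hz
  exact h z hz

variable [IsManifold 𝓘(ℂ, E) ω M]

lemma contMDiffAt_of_chart {f : M → ℝ} {x₀ : M} {y : E} (hy : y ∈ (extChartAt 𝓘(ℝ, E) x₀).target)
    (h : ContDiffAt ℝ ∞ (f ∘ (extChartAt 𝓘(ℝ, E) x₀).symm) y) :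
    ContMDiffAt 𝓘(ℝ, E) 𝓘(ℝ, ℝ) ∞ f ((extChartAt 𝓘(ℝ, E) x₀).symm y) := by
  have hs := mem_source_symm hy
  have h1 : ContDiffAt ℝ ∞ (f ∘ (extChartAt 𝓘(ℝ, E) x₀).symm)
      (extChartAt 𝓘(ℝ, E) x₀ ((extChartAt 𝓘(ℝ, E) x₀).symm y)) := by
    rwa [(extChartAt 𝓘(ℝ, E) x₀).right_inv hy]
  refine (h1.contMDiffAt.comp _
    (contMDiffAt_extChartAt' (I := 𝓘(ℝ, E)) hs)).congr_of_eventuallyEq ?_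
  filter_upwards [(chartAt E x₀).open_source.mem_nhds hs] with q hq
  exact congrArg f ((extChartAt 𝓘(ℝ, E) x₀).left_inv (by rwa [extChartAt_source])).symm

end

namespace HermitianMetric

variable {E : Type*} [NormedAddCommGroup E] [NormedSpace ℂ E]
variable {M : Type*} [TopologicalSpace M] [ChartedSpace E M] [IsManifold 𝓘(ℂ, E) ω M]
variable {𝔱 : Submodule ℝ (VField E M)} {b : Module.Basis (Fin 2) ℝ 𝔱} {g : HermitianMetric E M}

/-- Both connection forms at once, for the lemmas of the local model that treat `μ₁` and `μ₂`
alike. -/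
lemma chartRep_conn (hb : (b 1).1 = JField (b 0).1) (i : Fin 2) (x₀ : M) :
    ∃ μ : E → E [⋀^Fin 1]→L[ℝ] ℝ, (μ = mu₁ (fieldRep x₀ (b 0).1) (chartRep x₀ g.fundForm) ∨
      μ = mu₂ (fieldRep x₀ (b 0).1) (chartRep x₀ g.fundForm)) ∧
      ∀ y ∈ (extChartAt 𝓘(ℝ, E) x₀).target, chartRep x₀ (g.conn b i) y = μ y := by
  fin_cases i
  · exact ⟨_, Or.inl rfl, fun y hy => chartRep_conn_zero hb hy⟩
  · exact ⟨_, Or.inr rfl, fun y hy => chartRep_conn_one hb hy⟩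

lemma chartRep_dJd (g : HermitianMetric E M) [FiniteDimensional ℝ E] {x₀ : M} {y : E}
    (hy : y ∈ (extChartAt 𝓘(ℝ, E) x₀).target) :
    chartRep x₀ (extD (JForm (extD g.fundForm))) y =
      extDeriv (HermData.etaFun (chartRep x₀ g.fundForm)) y := by
  have : CompleteSpace E := FiniteDimensional.complete ℝ E
  rw [chartRep_extD g.smoothForm_fundForm.extD.JForm hy]
  refine extDeriv_chartRep_congr hy fun z hz => ?_
  rw [chartRep_JForm _ hz, chartRep_extD g.smoothForm_fundForm hz]
  rfl

variable [FiniteDimensional ℝ E] [T2Space M]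

lemma smoothForm_conn (h𝔱 : IsFreeAbelianHolomorphic 𝔱) (hb : (b 1).1 = JField (b 0).1)
    (hg : g.IsInvariant 𝔱) (i : Fin 2) : SmoothForm (g.conn b i) := fun x₀ => by
  obtain ⟨μ, hμ, h⟩ := chartRep_conn (g := g) hb i x₀
  exact ContDiffOn.congr (fun y hy =>
    ((hermData h𝔱 hb hg x₀).smooth_mu hμ hy).contDiffWithinAt) h

lemma smoothForm_transForm (h𝔱 : IsFreeAbelianHolomorphic 𝔱) (hb : (b 1).1 = JField (b 0).1)
    (hg : g.IsInvariant 𝔱) : SmoothForm (g.transForm b) := fun x₀ =>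
  ContDiffOn.congr (fun _ hy => ((hermData h𝔱 hb hg x₀).smooth_trans hy).contDiffWithinAt)
    fun _ hy => chartRep_transForm h𝔱 hb hy

lemma transForm_ne_zero (hE : Module.finrank ℂ E = 2) (h𝔱 : IsFreeAbelianHolomorphic 𝔱)
    (hb : (b 1).1 = JField (b 0).1) (hg : g.IsInvariant 𝔱) (x : M) : g.transForm b x ≠ 0 := by
  intro h
  have hy := mem_extChartAt_target (I := 𝓘(ℝ, E)) x
  apply (hermData h𝔱 hb hg x).trans_ne_zero hE hy
  rw [← chartRep_transForm h𝔱 hb hy]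
  ext w
  rw [chartRep_apply, extChartAt_to_inv]
  rw [h]
  rfl

/-- The curvature functions: `dμᵢ = σᵢ ω̌`. -/
lemma exists_sigma (hE : Module.finrank ℂ E = 2) (h𝔱 : IsFreeAbelianHolomorphic 𝔱)
    (hb : (b 1).1 = JField (b 0).1) (hg : g.IsInvariant 𝔱) :
    ∃ σ : Fin 2 → M → ℝ, ∀ i x, extD (g.conn b i) x = σ i x • g.transForm b x := by
  suffices h : ∀ i x, ∃ c : ℝ, extD (g.conn b i) x = c • g.transForm b x by
    choose σ hσ using h
    exact ⟨σ, hσ⟩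
  intro i x
  have hy := mem_extChartAt_target (I := 𝓘(ℝ, E)) x
  obtain ⟨μ, hμ, h⟩ := chartRep_conn (g := g) hb i x
  obtain ⟨c, hc⟩ := (hermData h𝔱 hb hg x).exists_dmu_eq hE hμ hy
  refine ⟨c, apply_eq_of_chartRep_eq (β := c • g.transForm b) ?_⟩
  rw [chartRep_extD (smoothForm_conn h𝔱 hb hg i) hy, extDeriv_chartRep_congr hy h, hc,
    chartRep_smul, Pi.smul_apply, chartRep_transForm h𝔱 hb hy]

variable {σ : Fin 2 → M → ℝ}

lemma extDeriv_conn (h𝔱 : IsFreeAbelianHolomorphic 𝔱)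
    (hb : (b 1).1 = JField (b 0).1) (hg : g.IsInvariant 𝔱)
    (hσ : ∀ i x, extD (g.conn b i) x = σ i x • g.transForm b x) {i : Fin 2} {x₀ : M}
    {μ : E → E [⋀^Fin 1]→L[ℝ] ℝ}
    (h : ∀ y ∈ (extChartAt 𝓘(ℝ, E) x₀).target, chartRep x₀ (g.conn b i) y = μ y) :
    ∀ y ∈ (extChartAt 𝓘(ℝ, E) x₀).target, extDeriv μ y =
      (σ i ∘ (extChartAt 𝓘(ℝ, E) x₀).symm) y •
        transFun (fieldRep x₀ (b 0).1) (chartRep x₀ g.fundForm) y := fun y hy => by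
  rw [← extDeriv_chartRep_congr hy h, ← chartRep_extD (smoothForm_conn h𝔱 hb hg i) hy,
    ← chartRep_transForm h𝔱 hb hy]
  ext w
  rw [chartRep_apply, hσ]
  rfl

lemma contDiffAt_sigma (hE : Module.finrank ℂ E = 2) (h𝔱 : IsFreeAbelianHolomorphic 𝔱)
    (hb : (b 1).1 = JField (b 0).1) (hg : g.IsInvariant 𝔱)
    (hσ : ∀ i x, extD (g.conn b i) x = σ i x • g.transForm b x) (i : Fin 2) {x₀ : M} {y : E}
    (hy : y ∈ (extChartAt 𝓘(ℝ, E) x₀).target) :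
    ContDiffAt ℝ ∞ (σ i ∘ (extChartAt 𝓘(ℝ, E) x₀).symm) y := by
  obtain ⟨μ, hμ, h⟩ := chartRep_conn (g := g) hb i x₀
  exact (hermData h𝔱 hb hg x₀).smooth_sigma hE hμ (extDeriv_conn h𝔱 hb hg hσ h) hy

lemma contMDiff_sigma (hE : Module.finrank ℂ E = 2) (h𝔱 : IsFreeAbelianHolomorphic 𝔱)
    (hb : (b 1).1 = JField (b 0).1) (hg : g.IsInvariant 𝔱)
    (hσ : ∀ i x, extD (g.conn b i) x = σ i x • g.transForm b x) (i : Fin 2) :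
    ContMDiff 𝓘(ℝ, E) 𝓘(ℝ, ℝ) ∞ (σ i) := fun x => by
  have hy := mem_extChartAt_target (I := 𝓘(ℝ, E)) x
  have h := contMDiffAt_of_chart hy (contDiffAt_sigma hE h𝔱 hb hg hσ i hy)
  rwa [extChartAt_to_inv] at h

lemma lieInvariant_sigma (hE : Module.finrank ℂ E = 2) (h𝔱 : IsFreeAbelianHolomorphic 𝔱)
    (hb : (b 1).1 = JField (b 0).1) (hg : g.IsInvariant 𝔱)
    (hσ : ∀ i x, extD (g.conn b i) x = σ i x • g.transForm b x) (i : Fin 2) {V : VField E M}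
    (hV : V ∈ 𝔱) : LieInvariant (k := 0) V (fun x _ => σ i x) := by
  intro X _ x
  have hy := mem_extChartAt_target (I := 𝓘(ℝ, E)) x
  rw [Finset.univ_eq_empty, Finset.sum_empty]
  have h := fieldDeriv_eq (V := V) hy
    ((contMDiff_sigma hE h𝔱 hb hg hσ i _).mdifferentiableAt (by simp))
  rw [extChartAt_to_inv] at h
  refine h.trans ?_
  obtain ⟨c, d, hcd⟩ := fieldRep_eq_comb hb hV
  obtain ⟨μ, hμ, hμ'⟩ := chartRep_conn (g := g) hb i x
  have hs := extDeriv_conn h𝔱 hb hg hσ hμ'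
  have H := hermData h𝔱 hb hg x
  rw [hcd x _ hy, map_add, map_smul, map_smul, H.fderiv_sigma_vert hE hμ hs (Or.inl rfl) hy,
    H.fderiv_sigma_vert hE hμ hs (Or.inr rfl) hy, smul_zero, smul_zero, add_zero]

lemma sigma_unique (hE : Module.finrank ℂ E = 2) (h𝔱 : IsFreeAbelianHolomorphic 𝔱)
    (hb : (b 1).1 = JField (b 0).1) (hg : g.IsInvariant 𝔱) {σ' : Fin 2 → M → ℝ}
    (hσ : ∀ i x, extD (g.conn b i) x = σ i x • g.transForm b x)
    (hσ' : ∀ i x, extD (g.conn b i) x = σ' i x • g.transForm b x) : σ' = σ := by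
  funext i x
  have h := (hσ' i x).symm.trans (hσ i x)
  exact smul_left_injective ℝ (transForm_ne_zero hE h𝔱 hb hg x) h

/-- `g` is pluriclosed if and only if `λ` is constant. If `dJdω = 0`, then `λ` is pluriharmonic and
hence constant by the maximum principle on the compact connected `M`. -/
lemma isPluriclosed_iff [CompactSpace M] [ConnectedSpace M]
    (hE : Module.finrank ℂ E = 2) (h𝔱 : IsFreeAbelianHolomorphic 𝔱)
    (hb : (b 1).1 = JField (b 0).1) (hg : g.IsInvariant 𝔱) :
    g.IsPluriclosed ↔ ∃ c : ℝ, ∀ x, g.lam b x = c := by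
  constructor
  · intro hpl
    have hlam : ∀ x₀ : M, ∀ y ∈ (extChartAt 𝓘(ℝ, E) x₀).target,
        ContDiffAt ℝ ∞ (g.lam b ∘ (extChartAt 𝓘(ℝ, E) x₀).symm) y := fun x₀ y hy => by
      refine ((hermData h𝔱 hb hg x₀).smooth_lam hy).congr_of_eventuallyEq ?_
      filter_upwards [(isOpen_target x₀).mem_nhds hy] with z hz
      exact lam_symm hb hz
    have hcont : Continuous (g.lam b) := continuous_iff_continuousAt.2 fun x => by
      have hy := mem_extChartAt_target (I := 𝓘(ℝ, E)) x
      have h := (contMDiffAt_of_chart hy (hlam x _ hy)).continuousAt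
      rwa [extChartAt_to_inv] at h
    obtain ⟨x₁, -, hx₁⟩ := isCompact_univ.exists_isMaxOn Set.univ_nonempty hcont.continuousOn
    refine ⟨g.lam b x₁, fun x => ?_⟩
    -- the set where `λ` attains its maximum is open and closed
    have hclopen : IsClopen {x | g.lam b x = g.lam b x₁} := by
      refine ⟨isClosed_eq hcont continuous_const, isOpen_iff_eventually.2 fun x hx => ?_⟩
      have hx : g.lam b x = g.lam b x₁ := hx
      have hy := mem_extChartAt_target (I := 𝓘(ℝ, E)) x
      have H := hermData h𝔱 hb hg x
      have h := eventually_eq_of_isLocalMax_pluriharmonic (isOpen_target x)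
        (fun z hz => (H.smooth_lam hz).of_le two_le_infty) (fun z hz e => H.pluriharmonic hz (by
          rw [← g.chartRep_dJd hz, hpl]; rfl) e) hy fun z hz => by
            rw [← lam_symm hb hz, ← lam_symm hb hy, extChartAt_to_inv, hx]
            exact hx₁ (Set.mem_univ _)
      filter_upwards [(continuousAt_extChartAt (I := 𝓘(ℝ, E)) x).eventually h,
        (chartAt E x).open_source.mem_nhds (mem_chart_source E x)] with q hq hq'
      have hq' : q ∈ (extChartAt 𝓘(ℝ, E) x).source := by rwa [extChartAt_source]
      rw [← lam_symm hb ((extChartAt 𝓘(ℝ, E) x).map_source hq'), ← lam_symm hb hy,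
        extChartAt_to_inv, (extChartAt 𝓘(ℝ, E) x).left_inv hq', hx] at hq
      exact hq
    have := hclopen.eq_univ ⟨x₁, rfl⟩
    exact (this.symm ▸ Set.mem_univ x : x ∈ {x | g.lam b x = g.lam b x₁})
  · rintro ⟨c, hc⟩
    funext x
    refine apply_eq_of_chartRep_eq (β := 0) ?_
    have hy := mem_extChartAt_target (I := 𝓘(ℝ, E)) x
    rw [g.chartRep_dJd hy, (hermData h𝔱 hb hg x).extDeriv_eta_eq_zero hE hy
      fun z hz => (lam_symm hb hz).symm.trans (hc _)]
    rfl

/-- If `λ` is constant, then the Lee form is `λ(σ₁μ₂ - σ₂μ₁)`. -/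
lemma isLeeForm_iff (hE : Module.finrank ℂ E = 2) (h𝔱 : IsFreeAbelianHolomorphic 𝔱)
    (hb : (b 1).1 = JField (b 0).1) (hg : g.IsInvariant 𝔱)
    (hσ : ∀ i x, extD (g.conn b i) x = σ i x • g.transForm b x)
    {c : ℝ} (hc : ∀ x, g.lam b x = c) (θ : DForm E M 1) : g.IsLeeForm θ ↔
      θ = fun x => g.lam b x • (σ 0 x • g.conn b 1 x - σ 1 x • g.conn b 0 x) := by
  have : CompleteSpace E := FiniteDimensional.complete ℝ E
  set θ₀ : DForm E M 1 := fun x => g.lam b x • (σ 0 x • g.conn b 1 x - σ 1 x • g.conn b 0 x)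
  have h0 : ∀ x : M, chartRep x (extD g.fundForm) (extChartAt 𝓘(ℝ, E) x x) =
      wedgeForm (chartRep x θ₀ (extChartAt 𝓘(ℝ, E) x x))
        (chartRep x g.fundForm (extChartAt 𝓘(ℝ, E) x x)) := fun x => by
    have hy := mem_extChartAt_target (I := 𝓘(ℝ, E)) x
    have H := hermData h𝔱 hb hg x
    rw [chartRep_extD g.smoothForm_fundForm hy, H.dΩ_eq_wedge hE hy
      (fun z hz => (lam_symm hb hz).symm.trans (hc _))
      (extDeriv_conn h𝔱 hb hg hσ (fun y hy => chartRep_conn_zero hb hy) _ hy)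
      (extDeriv_conn h𝔱 hb hg hσ (fun y hy => chartRep_conn_one hb hy) _ hy),
      ← chartRep_conn_zero hb hy, ← chartRep_conn_one hb hy, ← hc x]
    simp only [Function.comp_apply, extChartAt_to_inv]
    congr 1
    ext w
    simp only [ContinuousAlternatingMap.smul_apply, ContinuousAlternatingMap.sub_apply,
      chartRep_apply, θ₀, extChartAt_to_inv]
  constructor
  · intro h
    funext x
    refine apply_eq_of_chartRep_eq ?_
    have hy := mem_extChartAt_target (I := 𝓘(ℝ, E)) x
    have H := hermData h𝔱 hb hg x
    refine H.wedgeForm_Ω_injective hE hy ?_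
    rw [← h0 x, h, chartRep_wedge]
  · rintro rfl
    funext x
    refine apply_eq_of_chartRep_eq ?_
    rw [h0 x, chartRep_wedge]

end HermitianMetric

/-! ### The transverse form and closedness of the Lee form -/

namespace HermitianMetric

variable {E : Type*} [NormedAddCommGroup E] [NormedSpace ℂ E]
variable {M : Type*} [TopologicalSpace M] [ChartedSpace E M] [IsManifold 𝓘(ℂ, E) ω M]
variable {𝔱 : Submodule ℝ (VField E M)} {b : Module.Basis (Fin 2) ℝ 𝔱} {g : HermitianMetric E M}

lemma horProj_eq_zero (h𝔱 : IsFreeAbelianHolomorphic 𝔱) (hb : (b 1).1 = JField (b 0).1)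
    {V : VField E M} (hV : V ∈ 𝔱) (x : M) : g.horProj b x (V x) = 0 := by
  have h : ∀ j, g.horProj b x ((b j).1 x) = 0 := fun j => by
    rw [horProj_apply, g.conn_basis h𝔱 b hb 0 j x, g.conn_basis h𝔱 b hb 1 j x]
    fin_cases j <;> simp
  have hV' := congrArg Subtype.val (b.sum_repr ⟨V, hV⟩)
  rw [Fin.sum_univ_two] at hV'
  have hVx : V x = b.repr ⟨V, hV⟩ 0 • (b 0).1 x + b.repr ⟨V, hV⟩ 1 • (b 1).1 x :=
    (congrFun hV' x).symm
  rw [hVx, map_add, map_smul, map_smul, h, h, smul_zero, smul_zero, add_zero]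

variable [FiniteDimensional ℝ E] [T2Space M]

lemma transForm_mem_basicForms (h𝔱 : IsFreeAbelianHolomorphic 𝔱) (hb : (b 1).1 = JField (b 0).1)
    (hg : g.IsInvariant 𝔱) : g.transForm b ∈ basicForms 𝔱 2 := by
  have : CompleteSpace E := FiniteDimensional.complete ℝ E
  have hs := smoothForm_transForm h𝔱 hb hg
  refine ⟨hs, fun V hV => ⟨lieInvariant_of_invAt hs (h𝔱.smooth V hV) fun x₀ y hy => ?_,
    fun x w ⟨i, hi⟩ => ?_⟩⟩
  · obtain ⟨c, d, hcd⟩ := fieldRep_eq_comb hb hV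
    have H := hermData h𝔱 hb hg x₀
    refine (InvAt.linear_comb (H.diff_vert (Or.inl rfl) hy) (H.diff_vert (Or.inr rfl) hy)
      (H.inv_trans (Or.inl rfl) hy) (H.inv_trans (Or.inr rfl) hy) c d).congr ?_ ?_
    · filter_upwards [(isOpen_target x₀).mem_nhds hy] with z hz
      exact (hcd x₀ z hz).symm
    · filter_upwards [(isOpen_target x₀).mem_nhds hy] with z hz
      exact (chartRep_transForm h𝔱 hb hz).symm
  · rw [transForm, ContinuousAlternatingMap.compContinuousLinearMap_apply]
    refine ContinuousAlternatingMap.map_coord_zero _ i ?_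
    rw [Function.comp_apply, hi, horProj_eq_zero h𝔱 hb hV]

lemma extD_transForm (hE : Module.finrank ℂ E = 2) (h𝔱 : IsFreeAbelianHolomorphic 𝔱)
    (hb : (b 1).1 = JField (b 0).1) (hg : g.IsInvariant 𝔱) : extD (g.transForm b) = 0 := by
  funext x
  refine apply_eq_of_chartRep_eq (β := 0) ?_
  have hy := mem_extChartAt_target (I := 𝓘(ℝ, E)) x
  rw [chartRep_extD (smoothForm_transForm h𝔱 hb hg) hy, extDeriv_chartRep_congr hy
    (fun z hz => chartRep_transForm h𝔱 hb hz), (hermData h𝔱 hb hg x).extDeriv_trans hE hy]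
  rfl

variable {σ : Fin 2 → M → ℝ}

/-- The Lee form is closed if and only if the curvature functions are constant. -/
lemma extD_lee_eq_zero_iff [ConnectedSpace M] (hE : Module.finrank ℂ E = 2)
    (h𝔱 : IsFreeAbelianHolomorphic 𝔱)
    (hb : (b 1).1 = JField (b 0).1) (hg : g.IsInvariant 𝔱)
    (hσ : ∀ i x, extD (g.conn b i) x = σ i x • g.transForm b x) {c : ℝ} (hc : ∀ x, g.lam b x = c) :
    extD (fun x => g.lam b x • (σ 0 x • g.conn b 1 x - σ 1 x • g.conn b 0 x) : DForm E M 1) = 0 ↔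
      ∀ i, ∃ c : ℝ, ∀ x, σ i x = c := by
  set θ : DForm E M 1 := fun x => g.lam b x • (σ 0 x • g.conn b 1 x - σ 1 x • g.conn b 0 x)
  have hθ : ∀ x₀ : M, ∀ y ∈ (extChartAt 𝓘(ℝ, E) x₀).target, chartRep x₀ θ y =
      c • ((σ 0 ∘ (extChartAt 𝓘(ℝ, E) x₀).symm) y •
        mu₂ (fieldRep x₀ (b 0).1) (chartRep x₀ g.fundForm) y -
        (σ 1 ∘ (extChartAt 𝓘(ℝ, E) x₀).symm) y •
        mu₁ (fieldRep x₀ (b 0).1) (chartRep x₀ g.fundForm) y) := fun x₀ y hy => by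
    rw [← chartRep_conn_zero hb hy, ← chartRep_conn_one hb hy,
      ← hc ((extChartAt 𝓘(ℝ, E) x₀).symm y)]
    rfl
  have hs : SmoothForm θ := fun x₀ => by
    have H := hermData h𝔱 hb hg x₀
    refine ContDiffOn.congr (fun y hy => ContDiffAt.contDiffWithinAt ?_) (hθ x₀)
    exact (((contDiffAt_sigma hE h𝔱 hb hg hσ 0 hy).smul (H.smooth_mu₂ hy)).sub
      ((contDiffAt_sigma hE h𝔱 hb hg hσ 1 hy).smul (H.smooth_mu₁ hy))).const_smul c
  have h₀ := fun x₀ : M => extDeriv_conn h𝔱 hb hg hσ (i := 0) (x₀ := x₀)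
    (fun y hy => chartRep_conn_zero hb hy)
  have h₁ := fun x₀ : M => extDeriv_conn h𝔱 hb hg hσ (i := 1) (x₀ := x₀)
    (fun y hy => chartRep_conn_one hb hy)
  constructor
  · intro hd
    have key : ∀ i, ∀ x₀ : M, ∀ y ∈ (extChartAt 𝓘(ℝ, E) x₀).target,
        fderiv ℝ (σ i ∘ (extChartAt 𝓘(ℝ, E) x₀).symm) y = 0 := fun i x₀ y hy => by
      have hc0 : c ≠ 0 := by
        rw [← hc x₀]
        exact (lam_pos h𝔱 hb x₀).ne'
      have h := (hermData h𝔱 hb hg x₀).fderiv_sigma_eq_zero hE hc0 (h₀ x₀) (h₁ x₀) hy (by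
        rw [← extDeriv_chartRep_congr hy (hθ x₀), ← chartRep_extD hs hy, hd]
        rfl)
      fin_cases i
      exacts [h.1, h.2]
    refine fun i => exists_eq_const_of_chart (E := E) fun x => ?_
    have h := eventually_eq_of_fderiv_eq_zero (isOpen_target x) (mem_extChartAt_target x)
      (fun z hz => (contDiffAt_sigma hE h𝔱 hb hg hσ i hz).differentiableAt (by simp)) (key i x)
    simpa only [Function.comp_apply, extChartAt_to_inv] using h
  · intro h
    choose s hsc using h
    funext x
    refine apply_eq_of_chartRep_eq (β := 0) ?_
    have hy := mem_extChartAt_target (I := 𝓘(ℝ, E)) x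
    have e₀ := h₀ x _ hy
    have e₁ := h₁ x _ hy
    rw [Function.comp_apply, hsc] at e₀ e₁
    have h2 := (hermData h𝔱 hb hg x).extDeriv_lee_eq_zero (c := c) hy e₀ e₁
    rw [chartRep_extD hs hy, ← h2.trans (show 0 = chartRep x (0 : DForm E M 2) _ from rfl)]
    refine extDeriv_chartRep_congr hy fun z hz => ?_
    rw [hθ x z hz, Function.comp_apply, Function.comp_apply, hsc, hsc]
    ext w
    change c * (s 0 * mu₂ _ _ z w - s 1 * mu₁ _ _ z w) =
      c * (s 0 * mu₂ _ _ z w + -s 1 * mu₁ _ _ z w)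
    ring

end HermitianMetric

/-! ### Orientation and Stokes' theorem on a vector space -/

section

variable {E : Type*} [NormedAddCommGroup E] [NormedSpace ℂ E]

lemma finrank_real_eq_four (hE : Module.finrank ℂ E = 2) : Module.finrank ℝ E = 4 := by
  rw [finrank_real_of_complex, hE]

lemma finiteDimensional_real_of_finrank (hE : Module.finrank ℂ E = 2) : FiniteDimensional ℝ E :=
  FiniteDimensional.of_finrank_pos (by rw [finrank_real_eq_four hE]; norm_num)

/-- A `4`-form is multiplied by the determinant under a real linear map. -/
lemma top_form_map (hE : Module.finrank ℂ E = 2) (A : E [⋀^Fin 4]→L[ℝ] ℝ) (L : E →ₗ[ℝ] E)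
    (w : Fin 4 → E) : A (fun i => L (w i)) = LinearMap.det L * A w := by
  have := finiteDimensional_real_of_finrank hE
  let e := Module.finBasisOfFinrankEq ℝ E (finrank_real_eq_four hE)
  have h := fun u : Fin 4 → E => congrArg (fun B : E [⋀^Fin 4]→ₗ[ℝ] ℝ => B u)
    (AlternatingMap.eq_smul_basis_det e A.toAlternatingMap)
  simp only [AlternatingMap.smul_apply, ContinuousAlternatingMap.coe_toAlternatingMap] at h
  rw [h, h w]
  have h2 := e.det_comp L w
  rw [show (fun i => L (w i)) = L ∘ w from rfl, h2]
  simp only [smul_eq_mul]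
  ring

/-- Complex linear maps preserve the orientation. -/
lemma det_restrictScalars_nonneg (L : E →ₗ[ℂ] E) :
    0 ≤ LinearMap.det (L.restrictScalars ℝ) := by
  rw [LinearMap.det_restrictScalars, Algebra.norm_complex_apply]
  exact Complex.normSq_nonneg _

/-- A `4`-form which is positive on one complex frame is positive on all of them. -/
lemma pos_of_pos_frame (hE : Module.finrank ℂ E = 2) (A : E [⋀^Fin 4]→L[ℝ] ℝ)
    (bs : Module.Basis (Fin 2) ℂ E) {v e : E}
    (h : 0 < A ![v, Complex.I • v, e, Complex.I • e]) :
    0 < A ![bs 0, Complex.I • bs 0, bs 1, Complex.I • bs 1] := by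
  let L : E →ₗ[ℂ] E := bs.constr ℂ ![v, e]
  have h0 : L (bs 0) = v := by simp [L]
  have h1 : L (bs 1) = e := by simp [L]
  have h2 := top_form_map hE A (L.restrictScalars ℝ)
    ![bs 0, Complex.I • bs 0, bs 1, Complex.I • bs 1]
  have h3 : (fun i => (L.restrictScalars ℝ) (![bs 0, Complex.I • bs 0, bs 1, Complex.I • bs 1] i)) =
      ![v, Complex.I • v, e, Complex.I • e] := by
    ext i
    fin_cases i <;> simp [h0, h1]
  rw [h3] at h2
  rw [h2] at h
  exact pos_of_mul_pos_right h (det_restrictScalars_nonneg L)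

end

section

open MeasureTheory

variable {E : Type*} [NormedAddCommGroup E] [NormedSpace ℝ E] [FiniteDimensional ℝ E]
  [MeasurableSpace E] [BorelSpace E] (μ : Measure E) [μ.IsAddHaarMeasure]

/-- The integral of a directional derivative of a compactly supported function vanishes. -/
lemma integral_fderiv_apply_eq_zero {f : E → ℝ} (hf : ContDiff ℝ 1 f) (hs : HasCompactSupport f)
    (e : E) : ∫ y, fderiv ℝ f y e ∂μ = 0 := by
  have hi : Integrable (fun y => fderiv ℝ f y e) μ :=
    ((hf.continuous_fderiv (by simp)).clm_apply continuous_const).integrable_of_hasCompactSupport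
      (hs.fderiv_apply ℝ e)
  have h := integral_mul_fderiv_eq_neg_fderiv_mul_of_integrable (μ := μ) (f := fun _ : E => (1 : ℝ))
    (g := f) (v := e) (by simp) (by simpa using hi)
    (by simpa using hf.continuous.integrable_of_hasCompactSupport hs)
    (fun x _ => differentiableAt_const _) (fun x _ => (hf.differentiable (by simp)) x)
  simpa using h

/-- Stokes' theorem for compactly supported forms on a vector space. -/
lemma integral_extDeriv_eq_zero {n : ℕ} {α : E → E [⋀^Fin n]→L[ℝ] ℝ} (hα : ContDiff ℝ 1 α)
    (hs : HasCompactSupport α) (w : Fin (n + 1) → E) : ∫ y, extDeriv α y w ∂μ = 0 := by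
  have hd := hα.differentiable (by simp)
  have hc : ∀ u : Fin n → E, ContDiff ℝ 1 (fun z => α z u) := fun u =>
    (ContinuousAlternatingMap.apply ℝ E ℝ u).contDiff.comp hα
  have hcs : ∀ u : Fin n → E, HasCompactSupport (fun z => α z u) := fun u =>
    hs.comp_left (g := fun a : E [⋀^Fin n]→L[ℝ] ℝ => a u) rfl
  have h1 : ∀ y, extDeriv α y w = ∑ i : Fin (n + 1), ((-1 : ℝ) ^ (i : ℕ)) *
      fderiv ℝ (fun z => α z (i.removeNth w)) y (w i) := fun y => by
    rw [extDeriv_apply']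
    refine Finset.sum_congr rfl fun i _ => ?_
    rw [fderiv_apply_const (hd y)]
    simp
  simp only [h1]
  rw [integral_finsetSum]
  · refine Finset.sum_eq_zero fun i _ => ?_
    rw [integral_const_mul, integral_fderiv_apply_eq_zero μ (hc _) (hcs _), mul_zero]
  · intro i _
    refine Integrable.const_mul ?_ _
    exact (((hc _).continuous_fderiv (by simp)).clm_apply
      continuous_const).integrable_of_hasCompactSupport ((hcs _).fderiv_apply ℝ _)

/-- Stokes' theorem for a form on an open set `U` which vanishes outside a compact subset. -/
lemma setIntegral_extDeriv_eq_zero {n : ℕ} {α : E → E [⋀^Fin n]→L[ℝ] ℝ} {U K : Set E}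
    (hU : IsOpen U) (hK : IsCompact K) (hKU : K ⊆ U) (hα : ∀ y ∈ U, ContDiffAt ℝ 1 α y)
    (h0 : ∀ y ∈ U, y ∉ K → α y = 0) (w : Fin (n + 1) → E) : ∫ y in U, extDeriv α y w ∂μ = 0 := by
  have hin : ∀ y ∈ U, U.indicator α =ᶠ[𝓝 y] α := fun y hy => by
    filter_upwards [hU.mem_nhds hy] with z hz
    exact Set.indicator_of_mem hz α
  have hzero : ∀ y, y ∉ K → U.indicator α y = 0 := fun y hy => by
    by_cases hyU : y ∈ U
    · rw [Set.indicator_of_mem hyU, h0 y hyU hy]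
    · exact Set.indicator_of_notMem hyU α
  have hout : ∀ y, y ∉ K → U.indicator α =ᶠ[𝓝 y] fun _ => 0 := fun y hy => by
    filter_upwards [hK.isClosed.isOpen_compl.mem_nhds hy] with z hz
    exact hzero z hz
  have hd : ContDiff ℝ 1 (U.indicator α) := contDiff_iff_contDiffAt.2 fun y => by
    by_cases hy : y ∈ K
    · exact (hα y (hKU hy)).congr_of_eventuallyEq (hin y (hKU hy))
    · exact contDiffAt_const.congr_of_eventuallyEq (hout y hy)
  have h := integral_extDeriv_eq_zero μ hd (HasCompactSupport.intro hK hzero) w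
  have hz : ∀ y, y ∉ U → extDeriv (U.indicator α) y w = 0 := fun y hy => by
    rw [(hout y fun h => hy (hKU h)).extDeriv_eq, extDeriv_apply']
    simp
  rw [← h, ← setIntegral_eq_integral_of_forall_compl_eq_zero hz]
  refine setIntegral_congr_fun hU.measurableSet fun y hy => ?_
  exact congrArg (fun a : E [⋀^Fin (n + 1)]→L[ℝ] ℝ => a w) (hin y hy).extDeriv_eq.symm

end

/-! ### Stokes' theorem on a compact complex surface -/

section

open MeasureTheory

variable {E : Type*} [NormedAddCommGroup E] [NormedSpace ℂ E]
variable {M : Type*} [TopologicalSpace M] [ChartedSpace E M] {k : ℕ}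

lemma chartRep_eq_zero {α : DForm E M k} {x₀ : M} {y : E}
    (h : α ((extChartAt 𝓘(ℝ, E) x₀).symm y) = 0) : chartRep x₀ α y = 0 := by
  ext w
  rw [chartRep_apply, h]
  rfl

lemma chartRep_sum {ι : Type*} (s : Finset ι) (α : ι → DForm E M k) (x₀ : M) :
    chartRep x₀ (∑ i ∈ s, α i) = ∑ i ∈ s, chartRep x₀ (α i) :=
  map_sum (⟨⟨chartRep x₀, rfl⟩, fun _ _ => rfl⟩ : DForm E M k →+ (E → E [⋀^Fin k]→L[ℝ] ℝ)) α s

lemma chartRep_smul_fun (f : M → ℝ) (α : DForm E M k) (x₀ : M) (y : E) :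
    chartRep x₀ (fun x => f x • α x : DForm E M k) y =
      f ((extChartAt 𝓘(ℝ, E) x₀).symm y) • chartRep x₀ α y := rfl

lemma SmoothForm.sum {ι : Type*} {s : Finset ι} {α : ι → DForm E M k}
    (h : ∀ i ∈ s, SmoothForm (α i)) : SmoothForm (∑ i ∈ s, α i) := fun x₀ => by
  rw [chartRep_sum, Finset.sum_fn]
  exact ContDiffOn.sum fun i hi => h i hi x₀

lemma extD_sum {ι : Type*} {s : Finset ι} {α : ι → DForm E M k}
    (h : ∀ i ∈ s, SmoothForm (α i)) : extD (∑ i ∈ s, α i) = ∑ i ∈ s, extD (α i) := by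
  classical
  induction s using Finset.induction_on with
  | empty => simpa using extD_smul (0 : ℝ) (0 : DForm E M k)
  | insert a s ha ih =>
    have hs : ∀ i ∈ s, SmoothForm (α i) := fun i hi => h i (Finset.mem_insert_of_mem hi)
    rw [Finset.sum_insert ha, Finset.sum_insert ha,
      extD_add (h a (Finset.mem_insert_self a s)) (SmoothForm.sum hs), ih hs]

/-- The exterior derivative is local: it vanishes off the support of a form. -/
lemma extD_eq_zero_of_notMem {f : M → ℝ} {α : DForm E M k} {p : M} (hp : p ∉ tsupport f) :
    extD (fun x => f x • α x : DForm E M k) p = 0 := by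
  have h : chartRep p (fun x => f x • α x : DForm E M k) =ᶠ[𝓝 (extChartAt 𝓘(ℝ, E) p p)]
      fun _ => 0 := by
    have h1 : ContinuousAt (extChartAt 𝓘(ℝ, E) p).symm (extChartAt 𝓘(ℝ, E) p p) :=
      continuousAt_extChartAt_symm p
    have h2 : ∀ᶠ q in 𝓝 ((extChartAt 𝓘(ℝ, E) p).symm (extChartAt 𝓘(ℝ, E) p p)), f q = 0 := by
      rw [extChartAt_to_inv]
      exact notMem_tsupport_iff_eventuallyEq.1 hp
    filter_upwards [h1.eventually h2] with z hz
    rw [chartRep_smul_fun, hz, zero_smul]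
  have h0 : extDeriv (fun _ : E => (0 : E [⋀^Fin k]→L[ℝ] ℝ)) (extChartAt 𝓘(ℝ, E) p p) = 0 := by
    ext w
    rw [extDeriv_apply']
    simp
  rw [extD, h.extDeriv_eq, h0]
  rfl

lemma isCompact_image_chart [CompactSpace M] {K : Set M} (hK : IsClosed K) {i : M}
    (hKi : K ⊆ (chartAt E i).source) : IsCompact (extChartAt 𝓘(ℝ, E) i '' K) :=
  hK.isCompact.image_of_continuousOn ((continuousOn_extChartAt i).mono (by rwa [extChartAt_source]))

lemma image_chart_subset {K : Set M} {i : M} (hKi : K ⊆ (chartAt E i).source) :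
    extChartAt 𝓘(ℝ, E) i '' K ⊆ (extChartAt 𝓘(ℝ, E) i).target := by
  rintro _ ⟨p, hp, rfl⟩
  exact (extChartAt 𝓘(ℝ, E) i).map_source (by rw [extChartAt_source]; exact hKi hp)

lemma continuousOn_chart_mul {f : M → ℝ} (hf : Continuous f) {η : DForm E M k} (hη : SmoothForm η)
    (i : M) (w : Fin k → E) : ContinuousOn (fun y => f ((extChartAt 𝓘(ℝ, E) i).symm y) *
      chartRep i η y w) (extChartAt 𝓘(ℝ, E) i).target :=
  (hf.comp_continuousOn (continuousOn_extChartAt_symm i)).mul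
    ((ContinuousAlternatingMap.apply ℝ E ℝ w).continuous.comp_continuousOn (hη i).continuousOn)

lemma integrableOn_chart [MeasurableSpace E] [BorelSpace E] (μ : Measure E)
    [IsFiniteMeasureOnCompacts μ] [CompactSpace M] {K : Set M} (hK : IsClosed K) {i : M}
    (hKi : K ⊆ (chartAt E i).source) {h : E → ℝ}
    (hc : ContinuousOn h (extChartAt 𝓘(ℝ, E) i).target)
    (h0 : ∀ y ∈ (extChartAt 𝓘(ℝ, E) i).target, (extChartAt 𝓘(ℝ, E) i).symm y ∉ K → h y = 0) :
    IntegrableOn h (extChartAt 𝓘(ℝ, E) i).target μ := by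
  refine ((hc.mono (image_chart_subset hKi)).integrableOn_compact
    (isCompact_image_chart hK hKi)).of_forall_sdiff_eq_zero (isOpen_target i).measurableSet ?_
  rintro y ⟨hy, hy'⟩
  exact h0 y hy fun h => hy' ⟨_, h, (extChartAt 𝓘(ℝ, E) i).right_inv hy⟩

variable [IsManifold 𝓘(ℂ, E) ω M]

lemma SmoothForm.smul {f : M → ℝ} (hf : ContMDiff 𝓘(ℝ, E) 𝓘(ℝ, ℝ) ∞ f) {α : DForm E M k}
    (hα : SmoothForm α) : SmoothForm (fun x => f x • α x : DForm E M k) := fun x₀ y hy => by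
  have h := (hf _).comp y ((contMDiffOn_extChartAt_symm (I := 𝓘(ℝ, E)) (n := ∞) x₀).contMDiffAt
      ((isOpen_target x₀).mem_nhds hy))
  exact ((contMDiffAt_iff_contDiffAt.1 h).smul (hα.contDiffAt hy)).contDiffWithinAt

variable [FiniteDimensional ℝ E] [MeasurableSpace E] [BorelSpace E]
variable (μ : Measure E) [μ.IsAddHaarMeasure]

/-- The integral of a `4`-form does not depend on the chart: because coordinate changes are
holomorphic, their real Jacobian is nonnegative. -/
lemma setIntegral_chart_eq (hE : Module.finrank ℂ E = 2) {η : DForm E M 4} {f : M → ℝ} {i j : M}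
    (hi : ∀ p, p ∉ (chartAt E i).source → f p = 0 ∨ η p = 0)
    (hj : ∀ p, p ∉ (chartAt E j).source → f p = 0 ∨ η p = 0) (w : Fin 4 → E) :
    ∫ y in (extChartAt 𝓘(ℝ, E) i).target,
        f ((extChartAt 𝓘(ℝ, E) i).symm y) * chartRep i η y w ∂μ =
      ∫ y in (extChartAt 𝓘(ℝ, E) j).target,
        f ((extChartAt 𝓘(ℝ, E) j).symm y) * chartRep j η y w ∂μ := by
  have hopen : ∀ a c : M, IsOpen ((extChartAt 𝓘(ℝ, E) a).target ∩
      (extChartAt 𝓘(ℝ, E) a).symm ⁻¹' (chartAt E c).source) := fun a c =>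
    (continuousOn_extChartAt_symm a).isOpen_inter_preimage (isOpen_target a)
      (chartAt E c).open_source
  have hshrink : ∀ a c : M, (∀ p, p ∉ (chartAt E c).source → f p = 0 ∨ η p = 0) →
      ∫ y in (extChartAt 𝓘(ℝ, E) a).target,
        f ((extChartAt 𝓘(ℝ, E) a).symm y) * chartRep a η y w ∂μ =
      ∫ y in (extChartAt 𝓘(ℝ, E) a).target ∩
          (extChartAt 𝓘(ℝ, E) a).symm ⁻¹' (chartAt E c).source,
        f ((extChartAt 𝓘(ℝ, E) a).symm y) * chartRep a η y w ∂μ := fun a c hc => by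
    refine setIntegral_eq_of_subset_of_forall_sdiff_eq_zero (isOpen_target a).measurableSet
      Set.inter_subset_left fun y hy => ?_
    have hy' : (extChartAt 𝓘(ℝ, E) a).symm y ∉ (chartAt E c).source := fun h => hy.2 ⟨hy.1, h⟩
    rcases hc _ hy' with h | h
    · rw [h, zero_mul]
    · rw [chartRep_eq_zero h]
      exact mul_zero _
  rw [hshrink i j hj, hshrink j i hi]
  set S := (extChartAt 𝓘(ℝ, E) i).target ∩
    (extChartAt 𝓘(ℝ, E) i).symm ⁻¹' (chartAt E j).source with hS
  have hinv : ∀ {a c : M} {y : E}, y ∈ (extChartAt 𝓘(ℝ, E) a).target →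
      (extChartAt 𝓘(ℝ, E) a).symm y ∈ (chartAt E c).source →
      (extChartAt 𝓘(ℝ, E) c).symm (coordChange a c y) = (extChartAt 𝓘(ℝ, E) a).symm y :=
    fun _ hy => (extChartAt 𝓘(ℝ, E) _).left_inv (by rwa [extChartAt_source])
  have hmaps : ∀ {a c : M} {y : E}, y ∈ (extChartAt 𝓘(ℝ, E) a).target →
      (extChartAt 𝓘(ℝ, E) a).symm y ∈ (chartAt E c).source →
      coordChange a c y ∈ (extChartAt 𝓘(ℝ, E) c).target :=
    fun _ hy => (extChartAt 𝓘(ℝ, E) _).map_source (by rwa [extChartAt_source])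
  have himage : coordChange i j '' S = (extChartAt 𝓘(ℝ, E) j).target ∩
      (extChartAt 𝓘(ℝ, E) j).symm ⁻¹' (chartAt E i).source := by
    ext z
    constructor
    · rintro ⟨y, ⟨hy, hy'⟩, rfl⟩
      refine ⟨hmaps hy hy', ?_⟩
      rw [Set.mem_preimage, hinv hy hy']
      exact mem_source_symm hy
    · rintro ⟨hz, hz'⟩
      refine ⟨coordChange j i z, ⟨hmaps hz hz', ?_⟩, ?_⟩
      · rw [Set.mem_preimage, hinv hz hz']
        exact mem_source_symm hz
      · rw [coordChange, Function.comp_apply, hinv hz hz']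
        exact (extChartAt 𝓘(ℝ, E) j).right_inv hz
  have hinj : Set.InjOn (coordChange i j) S := fun y hy z hz h => by
    have h1 := congrArg (extChartAt 𝓘(ℝ, E) j).symm h
    rw [hinv hy.1 hy.2, hinv hz.1 hz.2] at h1
    exact (extChartAt 𝓘(ℝ, E) i).symm.injOn hy.1 hz.1 h1
  rw [← himage, integral_image_eq_integral_abs_det_fderiv_smul μ (hopen i j).measurableSet
    (fun y hy => ((contDiffAt_coordChange hy.1 hy.2).differentiableAt
      (by simp)).hasFDerivAt.hasFDerivWithinAt) hinj]
  refine setIntegral_congr_fun (hopen i j).measurableSet fun y hy => ?_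
  have hdet : 0 ≤ (fderiv ℝ (coordChange i j) y).det := by
    rw [(differentiableAt_coordChange_complex hy.1 hy.2).fderiv_restrictScalars ℝ]
    exact det_restrictScalars_nonneg _
  have h1 := top_form_map hE (chartRep j η (coordChange i j y))
    (fderiv ℝ (coordChange i j) y : E →ₗ[ℝ] E) w
  simp only [hinv hy.1 hy.2, abs_of_nonneg hdet, smul_eq_mul]
  rw [chartRep_eq_coordChange η hy.1 hy.2]
  refine (congrArg _ h1).trans ?_
  rw [ContinuousLinearMap.det]
  ring

/-- Stokes' theorem on a compact complex surface: `∫ dξ = 0`, where the integral of a `4`-form is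
computed with a partition of unity. -/
lemma sum_integral_extD_eq_zero (hE : Module.finrank ℂ E = 2) [CompactSpace M]
    {ρ : SmoothPartitionOfUnity M 𝓘(ℝ, E) M Set.univ}
    (hρ : ρ.IsSubordinate fun x => (chartAt E x).source) {s : Finset M}
    (hs : ∀ p, ∑ i ∈ s, ρ i p = 1) {ξ : DForm E M 3} (hξ : SmoothForm ξ) (w : Fin 4 → E) :
    ∑ i ∈ s, ∫ y in (extChartAt 𝓘(ℝ, E) i).target,
      ρ i ((extChartAt 𝓘(ℝ, E) i).symm y) * chartRep i (extD ξ) y w ∂μ = 0 := by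
  have hsm : ∀ j, SmoothForm (fun x => ρ j x • ξ x : DForm E M 3) := fun j =>
    hξ.smul (ρ j).contMDiff
  have hdec : extD ξ = ∑ j ∈ s, extD (fun x => ρ j x • ξ x : DForm E M 3) := by
    rw [← extD_sum fun j _ => hsm j]
    congr 1
    funext p
    rw [Finset.sum_apply, ← Finset.sum_smul, hs, one_smul]
  have h1 : ∀ i j, IntegrableOn (fun y => ρ i ((extChartAt 𝓘(ℝ, E) i).symm y) *
      chartRep i (extD (fun x => ρ j x • ξ x : DForm E M 3)) y w)
      (extChartAt 𝓘(ℝ, E) i).target μ := fun i j =>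
    integrableOn_chart μ (isClosed_tsupport (ρ i)) (hρ i)
      (continuousOn_chart_mul (ρ i).contMDiff.continuous (hsm j).extD i w) fun y _ hy' => by
        rw [image_eq_zero_of_notMem_tsupport hy', zero_mul]
  have h2 : ∀ i j, IntegrableOn (fun y => ρ i ((extChartAt 𝓘(ℝ, E) j).symm y) *
      chartRep j (extD (fun x => ρ j x • ξ x : DForm E M 3)) y w)
      (extChartAt 𝓘(ℝ, E) j).target μ := fun i j =>
    integrableOn_chart μ (isClosed_tsupport (ρ j)) (hρ j)
      (continuousOn_chart_mul (ρ i).contMDiff.continuous (hsm j).extD j w) fun y _ hy' => by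
        rw [chartRep_eq_zero (extD_eq_zero_of_notMem hy')]
        exact mul_zero _
  -- `ρᵢ d(ρⱼξ)` is supported in both charts, so its integral moves from the chart at `i` to that at
  -- `j`; summing over `i` removes `ρᵢ`, and Stokes' theorem on the vector space applies
  calc _ = ∑ i ∈ s, ∑ j ∈ s, ∫ y in (extChartAt 𝓘(ℝ, E) i).target,
        ρ i ((extChartAt 𝓘(ℝ, E) i).symm y) *
          chartRep i (extD (fun x => ρ j x • ξ x : DForm E M 3)) y w ∂μ := by
        refine Finset.sum_congr rfl fun i _ => ?_
        rw [← integral_finsetSum _ fun j _ => h1 i j]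
        refine setIntegral_congr_fun (isOpen_target i).measurableSet fun y _ => ?_
        simp only [← Finset.mul_sum]
        congr 1
        rw [hdec, chartRep_sum, Finset.sum_apply, ContinuousAlternatingMap.sum_apply]
    _ = ∑ i ∈ s, ∑ j ∈ s, ∫ y in (extChartAt 𝓘(ℝ, E) j).target,
        ρ i ((extChartAt 𝓘(ℝ, E) j).symm y) *
          chartRep j (extD (fun x => ρ j x • ξ x : DForm E M 3)) y w ∂μ := by
        refine Finset.sum_congr rfl fun i _ => Finset.sum_congr rfl fun j _ => ?_
        exact setIntegral_chart_eq μ hE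
          (fun p hp => Or.inl (image_eq_zero_of_notMem_tsupport fun h => hp (hρ i h)))
          (fun p hp => Or.inr (extD_eq_zero_of_notMem fun h => hp (hρ j h))) w
    _ = ∑ j ∈ s, ∫ y in (extChartAt 𝓘(ℝ, E) j).target,
          chartRep j (extD (fun x => ρ j x • ξ x : DForm E M 3)) y w ∂μ := by
        rw [Finset.sum_comm]
        refine Finset.sum_congr rfl fun j _ => ?_
        rw [← integral_finsetSum _ fun i _ => h2 i j]
        refine setIntegral_congr_fun (isOpen_target j).measurableSet fun y _ => ?_
        simp only [← Finset.sum_mul, hs, one_mul]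
    _ = 0 := by
        refine Finset.sum_eq_zero fun j _ => ?_
        rw [← setIntegral_extDeriv_eq_zero μ (isOpen_target j)
          (isCompact_image_chart (isClosed_tsupport (ρ j)) (hρ j))
          (image_chart_subset (hρ j))
          (α := chartRep j (fun x => ρ j x • ξ x : DForm E M 3))
          (fun y hy => ((hsm j).contDiffAt hy).of_le (by simp)) (fun y hy hy' => ?_) w]
        · refine setIntegral_congr_fun (isOpen_target j).measurableSet fun y hy => ?_
          exact congrArg (fun a : E [⋀^Fin 4]→L[ℝ] ℝ => a w) (chartRep_extD (hsm j) hy)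
        · have h0 : ρ j ((extChartAt 𝓘(ℝ, E) j).symm y) = 0 :=
            image_eq_zero_of_notMem_tsupport fun h =>
              hy' ⟨_, h, (extChartAt 𝓘(ℝ, E) j).right_inv hy⟩
          rw [chartRep_smul_fun, h0, zero_smul]

end

/-- On a compact complex surface, an exact `4`-form cannot be positive. Positivity is tested on a
fixed frame `w` of the model space in every chart; for complex frames it does not depend on the
frame, by `pos_of_pos_frame`. -/
lemma not_pos_extD {E : Type*} [NormedAddCommGroup E] [NormedSpace ℂ E]
    {M : Type*} [TopologicalSpace M] [ChartedSpace E M] [IsManifold 𝓘(ℂ, E) ω M] [T2Space M]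
    [CompactSpace M] [Nonempty M] (hE : Module.finrank ℂ E = 2) {ξ : DForm E M 3}
    (hξ : SmoothForm ξ) (w : Fin 4 → E) :
    ¬ ∀ x₀ : M, ∀ y ∈ (extChartAt 𝓘(ℝ, E) x₀).target, 0 < chartRep x₀ (extD ξ) y w := by
  intro hpos
  have := finiteDimensional_real_of_finrank hE
  borelize E
  have : LocallyCompactSpace E := by
    have := FiniteDimensional.proper ℝ E
    infer_instance
  let μ : MeasureTheory.Measure E := MeasureTheory.Measure.addHaar
  obtain ⟨ρ, hρ⟩ := SmoothPartitionOfUnity.exists_isSubordinate_chartAt_source 𝓘(ℝ, E) M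
  have hfin := ρ.locallyFinite.finite_nonempty_of_compact
  have hs : ∀ p, ∑ i ∈ hfin.toFinset, ρ i p = 1 := fun p => by
    rw [← ρ.sum_eq_one (Set.mem_univ p), finsum_eq_sum_of_support_subset]
    intro i hi
    exact (Set.Finite.mem_toFinset hfin).2 ⟨p, hi⟩
  have h0 := sum_integral_extD_eq_zero μ hE hρ hs hξ w
  have hnn : ∀ i, ∀ y ∈ (extChartAt 𝓘(ℝ, E) i).target,
      0 ≤ ρ i ((extChartAt 𝓘(ℝ, E) i).symm y) * chartRep i (extD ξ) y w := fun i y hy =>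
    mul_nonneg (ρ.nonneg i _) (hpos i y hy).le
  have hz := (Finset.sum_eq_zero_iff_of_nonneg fun i _ =>
    MeasureTheory.setIntegral_nonneg (isOpen_target i).measurableSet (hnn i)).1 h0
  obtain ⟨p⟩ := ‹Nonempty M›
  obtain ⟨i, hi, hip⟩ : ∃ i ∈ hfin.toFinset, ρ i p ≠ 0 := by
    by_contra! hcon
    have := hs p
    rw [Finset.sum_eq_zero hcon] at this
    exact zero_ne_one this
  have hi' := hz i hi
  have hint : MeasureTheory.IntegrableOn (fun y => ρ i ((extChartAt 𝓘(ℝ, E) i).symm y) *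
      chartRep i (extD ξ) y w) (extChartAt 𝓘(ℝ, E) i).target μ :=
    integrableOn_chart μ (isClosed_tsupport (ρ i)) (hρ i)
      (continuousOn_chart_mul (ρ i).contMDiff.continuous hξ.extD i w) fun y _ hy' => by
        rw [image_eq_zero_of_notMem_tsupport hy', zero_mul]
  refine hi'.not_gt ((MeasureTheory.setIntegral_pos_iff_support_of_nonneg_ae
    (MeasureTheory.ae_restrict_of_forall_mem (isOpen_target i).measurableSet (hnn i)) hint).2 ?_)
  have hopen : IsOpen ((extChartAt 𝓘(ℝ, E) i).target ∩
      (extChartAt 𝓘(ℝ, E) i).symm ⁻¹' (Function.support (ρ i))) :=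
    (continuousOn_extChartAt_symm i).isOpen_inter_preimage (isOpen_target i)
      (ρ i).contMDiff.continuous.isOpen_support
  have hps : p ∈ (extChartAt 𝓘(ℝ, E) i).source := by
    rw [extChartAt_source]
    exact hρ i (subset_tsupport _ hip)
  refine (hopen.measure_pos μ ⟨extChartAt 𝓘(ℝ, E) i p,
    (extChartAt 𝓘(ℝ, E) i).map_source hps, ?_⟩).trans_le (MeasureTheory.measure_mono ?_)
  · rw [Set.mem_preimage, (extChartAt 𝓘(ℝ, E) i).left_inv hps]
    exact hip
  · rintro y ⟨hy, hy'⟩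
    exact ⟨mul_ne_zero hy' (hpos i y hy).ne', hy⟩

/-! ### The transverse form is not exact -/

namespace HermitianMetric

/-- If `λ` is constant, the transverse form is not the exterior derivative of a basic `1`-form `γ`:
otherwise `d(γ ∧ ω)`, whose contraction with `V₁, JV₁` is `λ dγ = λ ω̌`, would be a positive exact
`4`-form. -/
lemma transForm_ne_extD_basic {E : Type*} [NormedAddCommGroup E] [NormedSpace ℂ E]
    {M : Type*} [TopologicalSpace M] [ChartedSpace E M] [IsManifold 𝓘(ℂ, E) ω M]
    [T2Space M] [CompactSpace M] [Nonempty M] {𝔱 : Submodule ℝ (VField E M)}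
    {b : Module.Basis (Fin 2) ℝ 𝔱} {g : HermitianMetric E M} (hE : Module.finrank ℂ E = 2)
    (h𝔱 : IsFreeAbelianHolomorphic 𝔱) (hb : (b 1).1 = JField (b 0).1) (hg : g.IsInvariant 𝔱)
    {c : ℝ} (hc : ∀ x, g.lam b x = c) {γ : DForm E M 1} (hγ : γ ∈ basicForms 𝔱 1) :
    extD γ ≠ g.transForm b := by
  intro hd
  have := finiteDimensional_real_of_finrank hE
  have : CompleteSpace E := FiniteDimensional.complete ℝ E
  have : FiniteDimensional ℂ E := FiniteDimensional.of_finrank_pos (by rw [hE]; norm_num)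
  let bs := Module.finBasisOfFinrankEq ℂ E hE
  have hξ : SmoothForm (wedge γ g.fundForm) := SmoothForm.wedge hγ.1 g.smoothForm_fundForm
  refine not_pos_extD hE hξ ![bs 0, Complex.I • bs 0, bs 1, Complex.I • bs 1] fun x₀ y hy => ?_
  have H := hermData h𝔱 hb hg x₀
  obtain ⟨e, he, h1, h2⟩ := H.exists_horizontal hE hy
  refine pos_of_pos_frame hE _ bs (v := fieldRep x₀ (b 0).1 y) (e := e) ?_
  have hmem : ∀ {u : E → E}, (u = fieldRep x₀ (b 0).1 ∨ u = rot (fieldRep x₀ (b 0).1)) →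
      ∃ V ∈ 𝔱, ∀ z ∈ (extChartAt 𝓘(ℝ, E) x₀).target, fieldRep x₀ V z = u z := by
    rintro u (rfl | rfl)
    · exact ⟨_, (b 0).2, fun z _ => rfl⟩
    · exact ⟨_, (b 1).2, fun z hz => fieldRep_basis_one hb hz⟩
  have key := H.contract_d_wedge (β := chartRep x₀ γ)
    (fun z hz => (lam_symm hb hz).symm.trans (hc _)) (fun z hz => hγ.1.contDiffAt hz)
    (fun u hu z hz => by
      obtain ⟨V, hV, hVu⟩ := hmem hu
      refine (invAt_of_lieInvariant hγ.1 (h𝔱.smooth V hV) (hγ.2 V hV).1 hz).congr ?_ .rfl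
      filter_upwards [(isOpen_target x₀).mem_nhds hz] with t ht
      exact hVu t ht)
    (fun u hu z hz => by
      obtain ⟨V, hV, hVu⟩ := hmem hu
      rw [← hVu z hz, chartRep_apply]
      exact (hγ.2 V hV).2 _ _ ⟨0, chartInvD_fieldRep hz V⟩) hy
  have hval := congrArg (fun a : E [⋀^Fin 2]→L[ℝ] ℝ => a ![e, Complex.I • e]) key
  rw [← chartRep_extD hγ.1 hy, hd, chartRep_transForm h𝔱 hb hy] at hval
  have hw : chartRep x₀ (wedge γ g.fundForm) = fun z =>
      wedgeForm (chartRep x₀ γ z) (chartRep x₀ g.fundForm z) :=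
    funext fun z => chartRep_wedge γ g.fundForm x₀ z
  rw [chartRep_extD hξ hy, hw]
  refine hval.trans_gt ?_
  rw [ContinuousAlternatingMap.smul_apply, smul_eq_mul]
  exact mul_pos (hc x₀ ▸ lam_pos h𝔱 hb x₀) (H.trans_pos hy he h1 h2)

end HermitianMetric

end TSurface

/-- `(M, J)` is a compact connected complex surface, `𝔱` a free `J`-invariant abelian Lie algebra of
holomorphic vector fields with basis `V₁ = b 0`, `V₂ = b 1 = J V₁`, and `g` a `𝔱`-invariant
Hermitian metric; `μ₁, μ₂` are `g.conn b 0`, `g.conn b 1`, `λ` is `g.lam b` and `ω̌` is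
`g.transForm b`. -/
theorem proposition3p1 {E : Type*} [NormedAddCommGroup E] [NormedSpace ℂ E]
    (hE : Module.finrank ℂ E = 2)
    {M : Type*} [TopologicalSpace M] [T2Space M] [CompactSpace M] [ConnectedSpace M]
    [ChartedSpace E M] [IsManifold 𝓘(ℂ, E) ω M]
    (𝔱 : Submodule ℝ (VField E M)) (h𝔱 : IsFreeAbelianHolomorphic 𝔱)
    (b : Module.Basis (Fin 2) ℝ 𝔱) (hb : (b 1 : VField E M) = JField (b 0 : VField E M))
    (g : HermitianMetric E M) (hg : g.IsInvariant 𝔱) :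
    -- the functions `σ₁, σ₂` with `dμᵢ = σᵢ ω̌`
    ∃ σ : Fin 2 → M → ℝ,
      (∀ i, ContMDiff 𝓘(ℝ, E) 𝓘(ℝ, ℝ) ∞ (σ i)) ∧
      (∀ i, ∀ V ∈ 𝔱, LieInvariant (k := 0) V (fun x _ => σ i x)) ∧
      (∀ i x, extD (g.conn b i) x = σ i x • g.transForm b x) ∧
      (∀ σ' : Fin 2 → M → ℝ,
        (∀ i x, extD (g.conn b i) x = σ' i x • g.transForm b x) → σ' = σ) ∧
      -- i)
      (g.IsPluriclosed ↔ ∃ c : ℝ, ∀ x, g.lam b x = c) ∧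
      -- ii) existence and uniqueness of the Lee form, and its value
      (g.IsPluriclosed → ∀ θ : DForm E M 1, g.IsLeeForm θ ↔
        θ = fun x => g.lam b x • (σ 0 x • g.conn b 1 x - σ 1 x • g.conn b 0 x)) ∧
      -- iii)
      (g.IsPluriclosed → ∀ θ : DForm E M 1, g.IsLeeForm θ →
        (extD θ = 0 ↔ ∀ i, ∃ c : ℝ, ∀ x, σ i x = c)) ∧
      -- iv) `ω̌` is a closed basic form, with non-zero class if `g` is pluriclosed
      ∃ β : closedBasic 𝔱 2, basicIncl 𝔱 2 β = g.transForm b ∧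
        (g.IsPluriclosed → (Submodule.Quotient.mk β : BasicCohomology 𝔱 2) ≠ 0) := by
  have := finiteDimensional_real_of_finrank hE
  have hb' : (b 1).1 = JField (b 0).1 := hb
  obtain ⟨σ, hσ⟩ := HermitianMetric.exists_sigma hE h𝔱 hb' hg
  have hpl := HermitianMetric.isPluriclosed_iff hE h𝔱 hb' hg
  refine ⟨σ, HermitianMetric.contMDiff_sigma hE h𝔱 hb' hg hσ,
    fun i V hV => HermitianMetric.lieInvariant_sigma hE h𝔱 hb' hg hσ i hV, hσ,
    fun σ' hσ' => HermitianMetric.sigma_unique hE h𝔱 hb' hg hσ hσ', hpl, fun hp => ?_,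
    fun hp θ hθ => ?_,
    ⟨⟨g.transForm b, HermitianMetric.transForm_mem_basicForms h𝔱 hb' hg⟩,
      LinearMap.mem_ker.2 (HermitianMetric.extD_transForm hE h𝔱 hb' hg)⟩, rfl, fun hp h0 => ?_⟩
  · obtain ⟨c, hc⟩ := hpl.1 hp
    exact HermitianMetric.isLeeForm_iff hE h𝔱 hb' hg hσ hc
  · obtain ⟨c, hc⟩ := hpl.1 hp
    rw [(HermitianMetric.isLeeForm_iff hE h𝔱 hb' hg hσ hc θ).1 hθ]
    exact HermitianMetric.extD_lee_eq_zero_iff hE h𝔱 hb' hg hσ hc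
  · obtain ⟨c, hc⟩ := hpl.1 hp
    obtain ⟨γ, hγ⟩ := (Submodule.Quotient.mk_eq_zero _).1 h0
    exact HermitianMetric.transForm_ne_extD_basic hE h𝔱 hb' hg hc γ.2 hγ
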